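/- Let $K$ be a field, let $G$ be a finite simple graph with vertex set $\{1,\dots,n\}$ and edge set $E(G)$, let $S=K[x_1,\dots,x_n]$ with its standard grading, and let $I=(x_ix_j : \{i,j\}\in E(G))\subseteq S$ be the edge ideal of $G$. For a finitely generated graded $S$-module $L$ let $$\operatorname{reg} L=\max\{\,i+j : H^i_{\mathfrak m}(L)_j\neq 0\,\},\qquad \mathfrak m=(x_1,\dots,x_n),$$ be its Castelnuovo–Mumford regularity, where $H^i_{\mathfrak m}$ denotes local cohomology and $\operatorname{reg} 0=-\infty$. Then for $s=2$ and for $s=3$, $$\operatorname{reg} I^s\le \operatorname{reg} I+2s-2 .$$ -/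

import Mathlib

noncomputable section

namespace EdgeIdealReg

open MvPolynomial

section Cech

variable {n : ℕ} {K : Type*} [Field K] (M : Type*) [AddCommGroup M] [Module (MvPolynomial (Fin n) K) M]

/-- The squarefree monomial `x_F = ∏_{v ∈ F} x_v`. -/
def xMon (K : Type*) [Field K] {n : ℕ} (F : Finset (Fin n)) : MvPolynomial (Fin n) K :=
  ∏ v ∈ F, X v

/-- The localization `M_{x_F}` of an `S`-module `M` at the powers of `x_F`,
where `S = K[x_1, …, x_n]`. -/
abbrev Loc (F : Finset (Fin n)) : Type _ :=
  LocalizedModule (Submonoid.powers (xMon K F)) M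

/-- For `F ⊆ F'`, every power of `x_F` acts invertibly on `M_{x_{F'}}`. -/
theorem isUnit_xMon_pow {F F' : Finset (Fin n)} (h : F ⊆ F')
    (s : Submonoid.powers (xMon K F)) :
    IsUnit (algebraMap (MvPolynomial (Fin n) K)
      (Module.End (MvPolynomial (Fin n) K) (Loc (K := K) M F')) s) := by
  obtain ⟨_, k, rfl⟩ := s
  have h1 := IsLocalizedModule.map_units
    (LocalizedModule.mkLinearMap (Submonoid.powers (xMon K F')) M)
    ⟨xMon K F', Submonoid.mem_powers _⟩
  have h2 : xMon K F' = xMon K (F' \ F) * xMon K F := by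
    unfold xMon
    exact (Finset.prod_sdiff h).symm
  simp only [h2, map_mul] at h1
  rw [Commute.isUnit_mul_iff (by
    rw [commute_iff_eq, ← map_mul, ← map_mul, mul_comm])] at h1
  simp only [map_pow]
  exact h1.2.pow k

/-- The canonical localization map `M_{x_F} → M_{x_{F'}}` for `F ⊆ F'`. -/
def res {F F' : Finset (Fin n)} (h : F ⊆ F') :
    Loc (K := K) M F →ₗ[MvPolynomial (Fin n) K] Loc (K := K) M F' :=
  LocalizedModule.lift (Submonoid.powers (xMon K F))
    (LocalizedModule.mkLinearMap (Submonoid.powers (xMon K F')) M)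
    (isUnit_xMon_pow M h)

/-- The `i`-th term `C^i(M) = ⨁_{|F| = i} M_{x_F}` of the Čech complex of `M` on
`x_1, …, x_n`. -/
abbrev Cech (n : ℕ) (K : Type*) [Field K] (M : Type*) [AddCommGroup M]
    [Module (MvPolynomial (Fin n) K) M] (i : ℕ) : Type _ :=
  (F : {F : Finset (Fin n) // F.card = i}) → Loc (K := K) M F.1

/-- The Čech differential `C^i(M) → C^{i+1}(M)`,
`(d c)_F = ∑_{v ∈ F} (-1)^{#{u ∈ F : u < v}} c_{F ∖ {v}}`, where `c_{F ∖ {v}}` is mapped to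
`M_{x_F}` by localization. -/
def cechD (i : ℕ) : Cech n K M i →ₗ[MvPolynomial (Fin n) K] Cech n K M (i + 1) :=
  LinearMap.pi fun F => ∑ v : {v : Fin n // v ∈ F.1},
    ((-1 : ℤ) ^ (F.1.filter (· < v.1)).card) •
      (res M (Finset.erase_subset v.1 F.1) ∘ₗ
        LinearMap.proj (R := MvPolynomial (Fin n) K)
          (φ := fun F : {F : Finset (Fin n) // F.card = i} => Loc (K := K) M F.1)
          ⟨F.1.erase v.1, by rw [Finset.card_erase_of_mem v.2, F.2, Nat.add_sub_cancel]⟩)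

/-- The Čech cocycles in `C^i(M)`. -/
def cocycles (n : ℕ) (K : Type*) [Field K] (M : Type*) [AddCommGroup M]
    [Module (MvPolynomial (Fin n) K) M] (i : ℕ) :
    Submodule (MvPolynomial (Fin n) K) (Cech n K M i) :=
  LinearMap.ker (cechD M i)

/-- The Čech coboundaries in `C^i(M)`. -/
def coboundaries (n : ℕ) (K : Type*) [Field K] (M : Type*) [AddCommGroup M]
    [Module (MvPolynomial (Fin n) K) M] :
    (i : ℕ) → Submodule (MvPolynomial (Fin n) K) (Cech n K M i)
  | 0 => ⊥
  | i + 1 => LinearMap.range (cechD M i)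

/-- The local cohomology module `H^i_𝔪(M)`, `𝔪 = (x_1, …, x_n)`, as the `i`-th cohomology of
the Čech complex of `M` on `x_1, …, x_n`. -/
abbrev LocalCoh (n : ℕ) (K : Type*) [Field K] (M : Type*) [AddCommGroup M]
    [Module (MvPolynomial (Fin n) K) M] (i : ℕ) : Type _ :=
  cocycles n K M i ⧸ (coboundaries n K M i).submoduleOf (cocycles n K M i)

variable {M}

/-- Let `M = ⨁_d ℳ d` be graded. The element `z` of `M_{x_F}` is homogeneous of degree `j`:
`z = m / x_F ^ k` with `m` homogeneous of degree `j + k |F|`. -/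
def LocHomogeneous (ℳ : ℤ → Set M) (j : ℤ) {F : Finset (Fin n)} (z : Loc (K := K) M F) : Prop :=
  ∃ (k : ℕ) (m : M), m ∈ ℳ (j + k * F.card) ∧
    z = LocalizedModule.mk m ⟨xMon K F ^ k, pow_mem (Submonoid.mem_powers _) k⟩

/-- The degree `j` part `H^i_𝔪(M)_j` of the local cohomology of the graded module
`M = ⨁_d ℳ d`: the classes of the cocycles all of whose components are homogeneous of
degree `j`. -/
def localCohDegree (n : ℕ) (K : Type*) [Field K] {M : Type*} [AddCommGroup M]
    [Module (MvPolynomial (Fin n) K) M] (ℳ : ℤ → Set M) (i : ℕ) (j : ℤ) :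
    Set (LocalCoh n K M i) :=
  {z | ∃ c : cocycles n K M i, (∀ F, LocHomogeneous ℳ j (c.1 F)) ∧ Submodule.Quotient.mk c = z}

/-- The Castelnuovo–Mumford regularity of the graded `S`-module `M = ⨁_d ℳ d`:
the supremum of all `i + j` with `H^i_𝔪(M)_j ≠ 0` (it is `-∞` for `M = 0`). -/
def regModule (n : ℕ) (K : Type*) [Field K] {M : Type*} [AddCommGroup M]
    [Module (MvPolynomial (Fin n) K) M] (ℳ : ℤ → Set M) : EReal :=
  ⨆ (i : ℕ) (j : ℤ) (_ : ∃ z ∈ localCohDegree n K ℳ i j, z ≠ 0), (((i + j : ℤ) : ℝ) : EReal)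

end Cech

/-- The standard grading of an ideal of `S = K[x_1, …, x_n]`, every variable having degree `1`:
the degree `j` part consists of the forms of degree `j` in the ideal. -/
def idealGrading {n : ℕ} {K : Type*} [Field K] (I : Ideal (MvPolynomial (Fin n) K)) (j : ℤ) :
    Set I :=
  {f | IsWeightedHomogeneous (fun _ : Fin n => (1 : ℤ)) (f : MvPolynomial (Fin n) K) j}

/-- The Castelnuovo–Mumford regularity of a homogeneous ideal of `K[x_1, …, x_n]`, as a
graded module. -/
def reg {n : ℕ} {K : Type*} [Field K] (I : Ideal (MvPolynomial (Fin n) K)) : EReal :=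
  regModule n K (idealGrading I)

/-- The edge ideal `(x_i x_j : {i, j} ∈ E(G))`. -/
def edgeIdeal {n : ℕ} (K : Type*) [Field K] (G : SimpleGraph (Fin n)) :
    Ideal (MvPolynomial (Fin n) K) :=
  Ideal.span {f | ∃ i j, G.Adj i j ∧ f = X i * X j}

end EdgeIdealReg

end

/-! Inside Laurent polynomials the Čech complex of a monomial ideal splits into multidegrees a ∈ ℤⁿ.
The strand of degree a is the simplicial cochain complex of the family `locSupport` of those F for
which x^a lies in the localization at x_F (`localCohDegree_eq_zero`, `vanishes_locSupport`). The
theorem thus concerns cohomology of families of finite sets, handled by three tools: the long exact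
sequence of a split family (`IsSplit`), the vanishing for cones (`vanishes_of_toggle`) and
Mayer–Vietoris (`vanishes_fam_or`).

For I^s let H be the set of negative coordinates of a, and cut the positive part of a into unit
slots. Then F belongs to the family iff F ⊇ H and either F contains an edge or s disjoint pieces can
be found among the slots, a piece being two adjacent slots or a single slot with a neighbour in F
(`mem_locSupport_iff_reach`). If there is a slot, the sets containing H form a cone, so one may pass
to the complement, one degree lower: the independent sets F ⊇ H whose met slots do not reach s
pieces.

The regularity of I itself, read off in the degrees a = -1_H, bounds the cohomology of the stars of
the independence complex (`bounded_indepAway`). The bound is inherited by the independent sets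
meeting no slot of a given set A. It improves by one if A contains an edge, and by two if A contains
two edges with no edge between them (`Bounded.edge`, `vanishes_avoid_two_edges`).

Since the sum of a is at most the number of slots minus |H|, it remains to prove vanishing for ρ +
2(s-1) - #slots ≤ i - |H| (`vanishes_two`, `vanishes_three`). So every additional slot asks for one
more degree of vanishing. Large slot graphs are disposed of in all degrees at once: a slot with at
most one neighbour, which if met would already complete s pieces, is the apex of a cone
(`reach2_leaf`, `reach3_leaf`). The few small graphs left, up to two disjoint triangles on six slots
for s = 3, are covered by families avoiding sets of slots, where the improvement by edges pays for
the missing degrees. -/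

noncomputable section

namespace EdgeIdealReg

open MvPolynomial

/-! ### Cohomology of convex families of finite sets -/

section Families

variable {n : ℕ} {K : Type*} [Field K]

/-- The sign with which `F ∖ {v}` contributes to the coboundary at `F`. -/
def sgn (K : Type*) [Field K] (F : Finset (Fin n)) (v : Fin n) : K :=
  (-1) ^ (F.filter (· < v)).card

theorem sgn_mul_self (F : Finset (Fin n)) (v : Fin n) : sgn K F v * sgn K F v = 1 := by
  unfold sgn
  rw [← mul_pow]
  simp

theorem sgn_erase_of_lt {F : Finset (Fin n)} {u v : Fin n} (h : u < v) :
    sgn K (F.erase v) u = sgn K F u := by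
  unfold sgn
  rw [Finset.filter_erase, Finset.erase_eq_of_notMem]
  simp [h.le]

theorem sgn_erase_of_gt {F : Finset (Fin n)} {u v : Fin n} (hu : u ∈ F) (h : u < v) :
    sgn K (F.erase u) v = - sgn K F v := by
  unfold sgn
  have h1 : u ∈ F.filter (· < v) := by simp [hu, h]
  rw [Finset.filter_erase, ← Finset.card_erase_add_one h1, pow_succ]
  ring

theorem sgn_swap {F : Finset (Fin n)} {u v : Fin n} (hu : u ∈ F) (hv : v ∈ F) (h : u ≠ v) :
    sgn K F v * sgn K (F.erase v) u = -(sgn K F u * sgn K (F.erase u) v) := by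
  rcases lt_or_gt_of_ne h with h | h
  · rw [sgn_erase_of_lt h, sgn_erase_of_gt hu h]; ring
  · rw [sgn_erase_of_lt h, sgn_erase_of_gt hv h]; ring

/-- The simplicial coboundary on all functions on finite sets of vertices. -/
def bdry (c : Finset (Fin n) → K) (F : Finset (Fin n)) : K :=
  ∑ v ∈ F, sgn K F v * c (F.erase v)

theorem bdry_add (c d : Finset (Fin n) → K) (F : Finset (Fin n)) :
    bdry (fun F => c F + d F) F = bdry c F + bdry d F := by
  simp only [bdry, mul_add, Finset.sum_add_distrib]

theorem bdry_sub (c d : Finset (Fin n) → K) (F : Finset (Fin n)) :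
    bdry (fun F => c F - d F) F = bdry c F - bdry d F := by
  simp only [bdry, mul_sub, Finset.sum_sub_distrib]

theorem bdry_congr {c d : Finset (Fin n) → K} {F : Finset (Fin n)}
    (h : ∀ v ∈ F, c (F.erase v) = d (F.erase v)) : bdry c F = bdry d F :=
  Finset.sum_congr rfl fun v hv => by rw [h v hv]

/-- The terms for the ordered pairs (v, u) and (u, v) cancel by `sgn_swap`. -/
theorem bdry_bdry (c : Finset (Fin n) → K) (F : Finset (Fin n)) : bdry (bdry c) F = 0 := by
  unfold bdry
  simp only [Finset.mul_sum]
  rw [Finset.sum_sigma']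
  refine Finset.sum_involution (fun p _ => ⟨p.2, p.1⟩) ?_ ?_ ?_ ?_
  · rintro ⟨v, u⟩ h
    simp only [Finset.mem_sigma, Finset.mem_erase] at h
    simp only [← mul_assoc]
    rw [sgn_swap h.2.2 h.1 h.2.1, Finset.erase_right_comm]
    ring
  · rintro ⟨v, u⟩ h _ h'
    simp only [Finset.mem_sigma, Finset.mem_erase] at h
    exact h.2.1 (congrArg Sigma.fst h')
  · rintro ⟨v, u⟩ h
    simp only [Finset.mem_sigma, Finset.mem_erase] at h ⊢
    exact ⟨h.2.2, h.2.1.symm, h.1⟩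
  · rintro ⟨v, u⟩ h
    rfl

/-- `c` is a cochain of degree `i` on the family `Q`. -/
def IsCochain (Q : Set (Finset (Fin n))) (i : ℤ) (c : Finset (Fin n) → K) : Prop :=
  ∀ F, c F ≠ 0 → F ∈ Q ∧ (F.card : ℤ) = i

/-- The `i`-th cohomology (with coefficients in `K`) of the family `Q` vanishes. -/
def Vanishes (K : Type*) [Field K] (Q : Set (Finset (Fin n))) (i : ℤ) : Prop :=
  ∀ c : Finset (Fin n) → K, IsCochain Q i c → (∀ F ∈ Q, bdry c F = 0) →
    ∃ e : Finset (Fin n) → K, IsCochain Q (i - 1) e ∧ ∀ F ∈ Q, bdry e F = c F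

open Classical in
/-- Restriction of a function to a family. -/
def cut (Q : Set (Finset (Fin n))) (c : Finset (Fin n) → K) (F : Finset (Fin n)) : K :=
  if F ∈ Q then c F else 0

theorem cut_of_mem {Q : Set (Finset (Fin n))} {F : Finset (Fin n)} (h : F ∈ Q)
    (c : Finset (Fin n) → K) : cut Q c F = c F := if_pos h

theorem cut_of_notMem {Q : Set (Finset (Fin n))} {F : Finset (Fin n)} (h : F ∉ Q)
    (c : Finset (Fin n) → K) : cut Q c F = 0 := if_neg h

theorem IsCochain.eq_zero {Q : Set (Finset (Fin n))} {i : ℤ} {c : Finset (Fin n) → K}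
    (hc : IsCochain Q i c) {F : Finset (Fin n)} (h : F ∉ Q) : c F = 0 := by
  by_contra h'
  exact h (hc F h').1

theorem IsCochain.sub {Q : Set (Finset (Fin n))} {i : ℤ} {c d : Finset (Fin n) → K}
    (hc : IsCochain Q i c) (hd : IsCochain Q i d) : IsCochain Q i fun F => c F - d F := by
  intro F h
  by_cases h' : c F = 0
  · exact hd F (by simpa [h'] using h)
  · exact hc F h'

theorem IsCochain.add {Q : Set (Finset (Fin n))} {i : ℤ} {c d : Finset (Fin n) → K}
    (hc : IsCochain Q i c) (hd : IsCochain Q i d) : IsCochain Q i fun F => c F + d F := by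
  intro F h
  by_cases h' : c F = 0
  · exact hd F (by simpa [h'] using h)
  · exact hc F h'

theorem IsCochain.mono {Q Q' : Set (Finset (Fin n))} {i : ℤ} {c : Finset (Fin n) → K}
    (hc : IsCochain Q i c) (h : Q ⊆ Q') : IsCochain Q' i c :=
  fun F hF => ⟨h (hc F hF).1, (hc F hF).2⟩

theorem IsCochain.cut {Q Q' : Set (Finset (Fin n))} {i : ℤ} {c : Finset (Fin n) → K}
    (hc : IsCochain Q i c) : IsCochain Q' i (cut Q' c) := by
  intro F hF
  by_cases h : F ∈ Q'
  · rw [cut_of_mem h] at hF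
    exact ⟨h, (hc F hF).2⟩
  · exact absurd (cut_of_notMem h c) hF

theorem IsCochain.cut_bdry {Q Q' : Set (Finset (Fin n))} {i : ℤ} {c : Finset (Fin n) → K}
    (hc : IsCochain Q i c) : IsCochain Q' (i + 1) (EdgeIdealReg.cut Q' (bdry c)) := by
  intro F hF
  by_cases h : F ∈ Q'
  · rw [cut_of_mem h] at hF
    obtain ⟨v, hv, hv'⟩ := Finset.exists_ne_zero_of_sum_ne_zero hF
    have h2 := (hc _ (right_ne_zero_of_mul hv')).2
    refine ⟨h, ?_⟩
    rw [← h2, ← Finset.card_erase_add_one hv]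
    push_cast
    ring
  · exact absurd (cut_of_notMem h _) hF

/-- Convexity makes cochains on Q a complex: a face lying between two members of Q is in Q, so
cutting off the values outside Q loses nothing. -/
theorem bdry_cut_bdry {Q : Set (Finset (Fin n))} (hQ : Q.OrdConnected) {i : ℤ}
    {c : Finset (Fin n) → K} (hc : IsCochain Q i c) {F : Finset (Fin n)} (hF : F ∈ Q) :
    bdry (cut Q (bdry c)) F = 0 := by
  rw [← bdry_bdry c F]
  refine bdry_congr fun v hv => ?_
  by_cases h : F.erase v ∈ Q
  · rw [cut_of_mem h]
  · rw [cut_of_notMem h, eq_comm]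
    refine Finset.sum_eq_zero fun u hu => ?_
    by_cases h' : c ((F.erase v).erase u) = 0
    · rw [h', mul_zero]
    · exact absurd (hQ.out (hc _ h').1 hF ⟨Finset.erase_subset _ _, Finset.erase_subset _ _⟩) h

/-- A decomposition of a convex family into a part closed upwards and its complement. -/
structure IsSplit (Q Q₁ Q₂ : Set (Finset (Fin n))) : Prop where
  conv : Q.OrdConnected
  union : Q₁ ∪ Q₂ = Q
  disj : Disjoint Q₁ Q₂
  upper : ∀ F ∈ Q₂, ∀ F' ∈ Q, F ⊆ F' → F' ∈ Q₂

namespace IsSplit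

variable {Q Q₁ Q₂ : Set (Finset (Fin n))}

theorem left_subset (h : IsSplit Q Q₁ Q₂) : Q₁ ⊆ Q := h.union ▸ Set.subset_union_left

theorem right_subset (h : IsSplit Q Q₁ Q₂) : Q₂ ⊆ Q := h.union ▸ Set.subset_union_right

theorem mem_or (h : IsSplit Q Q₁ Q₂) {F : Finset (Fin n)} (hF : F ∈ Q) : F ∈ Q₁ ∨ F ∈ Q₂ := by
  rw [← h.union] at hF
  exact hF

theorem not_both (h : IsSplit Q Q₁ Q₂) {F : Finset (Fin n)} (h1 : F ∈ Q₁) (h2 : F ∈ Q₂) : False :=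
  Set.disjoint_left.1 h.disj h1 h2

theorem erase_notMem (h : IsSplit Q Q₁ Q₂) {F : Finset (Fin n)} (h1 : F ∈ Q₁) (v : Fin n) :
    F.erase v ∉ Q₂ := fun h2 =>
  h.not_both h1 (h.upper _ h2 _ (h.left_subset h1) (Finset.erase_subset _ _))

theorem bdry_cut_left (h : IsSplit Q Q₁ Q₂) {i : ℤ} {c : Finset (Fin n) → K}
    (hc : IsCochain Q i c) {F : Finset (Fin n)} (h1 : F ∈ Q₁) :
    bdry (cut Q₁ c) F = bdry c F := by
  refine bdry_congr fun v _ => ?_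
  by_cases h' : F.erase v ∈ Q₁
  · rw [cut_of_mem h']
  · rw [cut_of_notMem h', eq_comm]
    refine hc.eq_zero fun h3 => ?_
    rcases h.mem_or h3 with h4 | h4
    · exact h' h4
    · exact h.erase_notMem h1 v h4

theorem bdry_right_eq_zero (h : IsSplit Q Q₁ Q₂) {i : ℤ} {c : Finset (Fin n) → K}
    (hc : IsCochain Q₂ i c) {F : Finset (Fin n)} (h1 : F ∈ Q₁) : bdry c F = 0 :=
  Finset.sum_eq_zero fun v _ => by rw [hc.eq_zero (h.erase_notMem h1 v), mul_zero]

theorem cochain_right (h : IsSplit Q Q₁ Q₂) {i : ℤ} {c : Finset (Fin n) → K}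
    (hc : IsCochain Q i c) (h0 : ∀ F ∈ Q₁, c F = 0) : IsCochain Q₂ i c := by
  intro F hF
  refine ⟨?_, (hc F hF).2⟩
  rcases h.mem_or (hc F hF).1 with h1 | h1
  · exact absurd (h0 F h1) hF
  · exact h1

/-- Cochains on the upper part Q₂ form a subcomplex with quotient the cochains on Q₁. This lemma and
the next two are exactness of H^{i-1}(Q₁) → H^i(Q₂) → H^i(Q) → H^i(Q₁) → H^{i+1}(Q₂) at the three
middle terms. -/
theorem vanishes (h : IsSplit Q Q₁ Q₂) {i : ℤ} (v1 : Vanishes K Q₁ i) (v2 : Vanishes K Q₂ i) :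
    Vanishes K Q i := by
  intro c hc hcc
  obtain ⟨e, he, he'⟩ := v1 (cut Q₁ c) hc.cut fun F hF => by
    rw [h.bdry_cut_left hc hF, hcc F (h.left_subset hF)]
  have heQ := he.mono h.left_subset
  have hd : IsCochain Q i (cut Q (bdry e)) := by simpa using heQ.cut_bdry (Q' := Q)
  have h2 : IsCochain Q₂ i fun F => c F - cut Q (bdry e) F := by
    refine h.cochain_right (hc.sub hd) fun F hF => ?_
    rw [cut_of_mem (h.left_subset hF), he' F hF, cut_of_mem hF, sub_self]
  obtain ⟨e2, he2, he2'⟩ := v2 _ h2 fun F hF => by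
    rw [bdry_sub, hcc F (h.right_subset hF), bdry_cut_bdry h.conv heQ (h.right_subset hF), sub_zero]
  refine ⟨_, heQ.add (he2.mono h.right_subset), fun F hF => ?_⟩
  rw [bdry_add]
  rcases h.mem_or hF with h1 | h1
  · rw [he' F h1, h.bdry_right_eq_zero he2 h1, cut_of_mem h1, add_zero]
  · rw [he2' F h1, cut_of_mem hF]
    ring

theorem vanishes_left (h : IsSplit Q Q₁ Q₂) {i : ℤ} (v : Vanishes K Q i)
    (v2 : Vanishes K Q₂ (i + 1)) : Vanishes K Q₁ i := by
  intro c hc hcc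
  have hcQ := hc.mono h.left_subset
  have h2 : IsCochain Q₂ (i + 1) (cut Q (bdry c)) := by
    refine h.cochain_right hcQ.cut_bdry fun F hF => ?_
    rw [cut_of_mem (h.left_subset hF), hcc F hF]
  obtain ⟨e, he, he'⟩ := v2 _ h2 fun F hF => bdry_cut_bdry h.conv hcQ (h.right_subset hF)
  rw [add_sub_cancel_right] at he
  obtain ⟨g, hg, hg'⟩ := v _ (hcQ.sub (he.mono h.right_subset)) fun F hF => by
    rw [bdry_sub]
    rcases h.mem_or hF with h1 | h1
    · rw [hcc F h1, h.bdry_right_eq_zero he h1, sub_zero]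
    · rw [he' F h1, cut_of_mem hF, sub_self]
  refine ⟨cut Q₁ g, hg.cut, fun F hF => ?_⟩
  rw [h.bdry_cut_left hg hF, hg' F (h.left_subset hF), he.eq_zero, sub_zero]
  exact fun h2 => h.not_both hF h2

theorem vanishes_right (h : IsSplit Q Q₁ Q₂) {i : ℤ} (v : Vanishes K Q i)
    (v1 : Vanishes K Q₁ (i - 1)) : Vanishes K Q₂ i := by
  intro c hc hcc
  obtain ⟨g, hg, hg'⟩ := v c (hc.mono h.right_subset) fun F hF => by
    rcases h.mem_or hF with h1 | h1
    · exact h.bdry_right_eq_zero hc h1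
    · exact hcc F h1
  obtain ⟨e, he, he'⟩ := v1 (cut Q₁ g) hg.cut fun F hF => by
    rw [h.bdry_cut_left hg hF, hg' F (h.left_subset hF), hc.eq_zero]
    exact fun h2 => h.not_both hF h2
  have heQ := he.mono h.left_subset
  have hd : IsCochain Q (i - 1) (cut Q (bdry e)) := by simpa using heQ.cut_bdry (Q' := Q)
  refine ⟨fun F => g F - cut Q (bdry e) F, h.cochain_right (hg.sub hd) fun F hF => ?_,
    fun F hF => ?_⟩
  · rw [cut_of_mem (h.left_subset hF), he' F hF, cut_of_mem hF, sub_self]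
  · rw [bdry_sub, hg' F (h.right_subset hF), bdry_cut_bdry h.conv heQ (h.right_subset hF), sub_zero]

end IsSplit

/-- A family stable under inserting and erasing `v` is a cone, hence has no cohomology. -/
theorem vanishes_of_toggle {Q : Set (Finset (Fin n))} (v : Fin n)
    (h : ∀ F, v ∉ F → (F ∈ Q ↔ insert v F ∈ Q)) (i : ℤ) : Vanishes K Q i := by
  intro c hc hcc
  classical
  -- The contracting homotopy of the cone: evaluate c after inserting the apex.
  refine ⟨fun F => if v ∈ F then 0 else sgn K (insert v F) v * c (insert v F), ?_, ?_⟩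
  · intro F hF
    by_cases hv : v ∈ F
    · simp [hv] at hF
    · simp only [hv, if_false] at hF
      obtain ⟨h1, h2⟩ := hc _ (right_ne_zero_of_mul hF)
      refine ⟨(h F hv).2 h1, ?_⟩
      rw [Finset.card_insert_of_notMem hv] at h2
      push_cast at h2
      omega
  · intro F hF
    by_cases hv : v ∈ F
    · unfold bdry
      dsimp only
      rw [Finset.sum_eq_single v]
      · rw [if_neg (by simp), Finset.insert_erase hv, ← mul_assoc, sgn_mul_self, one_mul]
      · intro u hu huv
        rw [if_pos (by simp [hv, huv.symm]), mul_zero]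
      · exact fun h' => absurd hv h'
    · have h1 := hcc _ ((h F hv).1 hF)
      unfold bdry at h1 ⊢
      rw [Finset.sum_insert hv, Finset.erase_insert hv] at h1
      -- The cocycle condition at F ∪ {v}, solved for the term in which v is deleted.
      have h2 : c F = - (sgn K (insert v F) v *
          ∑ u ∈ F, sgn K (insert v F) u * c ((insert v F).erase u)) := by
        have h3 := congrArg (fun x => sgn K (insert v F) v * x) h1
        simp only [mul_add, ← mul_assoc, sgn_mul_self, one_mul, mul_zero] at h3
        rw [eq_neg_iff_add_eq_zero]
        exact h3
      dsimp only
      rw [h2, Finset.mul_sum, ← Finset.sum_neg_distrib]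
      refine Finset.sum_congr rfl fun u hu => ?_
      have huv : u ≠ v := fun h' => hv (h' ▸ hu)
      rw [if_neg (by simp [hv])]
      rw [← Finset.erase_insert_of_ne huv.symm]
      have h4 := sgn_swap (K := K) (F := insert v F) (u := v) (v := u) (by simp) (by simp [hu])
        huv.symm
      rw [Finset.erase_insert hv] at h4
      have h5 : sgn K ((insert v F).erase u) v =
          -(sgn K (insert v F) u * sgn K (insert v F) v * sgn K F u) := by
        have := congrArg (fun x => sgn K (insert v F) u * x) h4
        simp only [← mul_assoc, sgn_mul_self, one_mul, mul_neg] at this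
        exact this
      rw [h5]
      linear_combination (-(sgn K (insert v F) u * sgn K (insert v F) v *
        c ((insert v F).erase u))) * sgn_mul_self (K := K) F u

theorem vanishes_empty (i : ℤ) : Vanishes K (∅ : Set (Finset (Fin n))) i :=
  fun _ _ _ => ⟨fun _ => 0, fun _ h => absurd rfl h, fun _ h => h.elim⟩

end Families

/-! ### Multigraded strands of the Čech complex of a monomial ideal -/

section Laurent

variable {n : ℕ} {K : Type*} [Field K]

/-- The embedding of exponent vectors into `ℤⁿ`. -/
def emb (n : ℕ) : (Fin n →₀ ℕ) →+ (Fin n → ℤ) where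
  toFun b v := b v
  map_zero' := by ext; simp
  map_add' a b := by ext; simp

theorem emb_injective : Function.Injective (emb n) := by
  intro a b h
  ext v
  exact Int.ofNat.inj (congrFun h v)

/-- Laurent polynomials in `n` variables. -/
abbrev Laurent (n : ℕ) (K : Type*) [Field K] : Type _ := AddMonoidAlgebra K (Fin n → ℤ)

/-- Polynomials as Laurent polynomials. -/
def toLaurent (n : ℕ) (K : Type*) [Field K] : MvPolynomial (Fin n) K →+* Laurent n K :=
  AddMonoidAlgebra.mapDomainRingHom K (emb n)

instance laurentModule : Module (MvPolynomial (Fin n) K) (Laurent n K) :=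
  Module.compHom _ (toLaurent n K)

theorem smul_laurent (p : MvPolynomial (Fin n) K) (f : Laurent n K) :
    p • f = toLaurent n K p * f := rfl

theorem toLaurent_monomial (b : Fin n →₀ ℕ) (r : K) :
    toLaurent n K (monomial b r) = AddMonoidAlgebra.single (emb n b) r := by
  exact AddMonoidAlgebra.mapDomain_single

theorem coeff_toLaurent (p : MvPolynomial (Fin n) K) (b : Fin n →₀ ℕ) :
    (toLaurent n K p).coeff (emb n b) = p.coeff b :=
  Finsupp.mapDomain_apply emb_injective _ _

theorem coeff_toLaurent_ne_zero {p : MvPolynomial (Fin n) K} {a : Fin n → ℤ}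
    (h : (toLaurent n K p).coeff a ≠ 0) : ∃ b ∈ p.support, emb n b = a := by
  by_contra! h'
  by_cases ha : a ∈ Set.range (emb n)
  · obtain ⟨b, rfl⟩ := ha
    rw [coeff_toLaurent] at h
    exact h' b (mem_support_iff.2 h) rfl
  · exact h (Finsupp.mapDomain_of_notMem_range _ _ ha)

/-- The indicator vector of `F`. -/
def ind (F : Finset (Fin n)) : Fin n → ℤ := fun v => if v ∈ F then 1 else 0

theorem xMon_eq (F : Finset (Fin n)) :
    xMon K F = monomial (∑ v ∈ F, Finsupp.single v 1) 1 := by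
  unfold xMon
  rw [monomial_sum_one]
  rfl

theorem emb_sum_single (F : Finset (Fin n)) :
    emb n (∑ v ∈ F, Finsupp.single v 1) = ind F := by
  ext u
  simp [emb, ind, Finsupp.single_apply]

theorem toLaurent_xMon_pow (F : Finset (Fin n)) (k : ℕ) :
    toLaurent n K (xMon K F ^ k) = AddMonoidAlgebra.single (k • ind F) 1 := by
  rw [map_pow, xMon_eq, toLaurent_monomial, emb_sum_single, AddMonoidAlgebra.single_pow, one_pow]

theorem coeff_xMon_pow_smul (F : Finset (Fin n)) (k : ℕ) (f : Laurent n K) (a : Fin n → ℤ) :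
    (xMon K F ^ k • f).coeff (a + k • ind F) = f.coeff a := by
  rw [smul_laurent, toLaurent_xMon_pow, add_comm, AddMonoidAlgebra.coeff_single_mul_add, one_mul]

theorem isUnit_laurent (F : Finset (Fin n)) (s : Submonoid.powers (xMon K F)) :
    IsUnit (algebraMap (MvPolynomial (Fin n) K)
      (Module.End (MvPolynomial (Fin n) K) (Laurent n K)) s) := by
  obtain ⟨_, k, rfl⟩ := s
  have h : AddMonoidAlgebra.single (k • ind F) (1 : K) *
      AddMonoidAlgebra.single (-(k • ind F)) (1 : K) = 1 := by
    rw [AddMonoidAlgebra.single_mul_single, add_neg_cancel, mul_one]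
    rfl
  rw [Module.End.isUnit_iff]
  constructor
  · intro f g hfg
    have h1 : toLaurent n K (xMon K F ^ k) * f = toLaurent n K (xMon K F ^ k) * g := hfg
    rw [toLaurent_xMon_pow] at h1
    have h2 := congrArg (fun x => AddMonoidAlgebra.single (-(k • ind F)) (1 : K) * x) h1
    simp only [← mul_assoc] at h2
    rwa [mul_comm (AddMonoidAlgebra.single (-(k • ind F)) (1 : K)), h, one_mul, one_mul] at h2
  · intro f
    refine ⟨AddMonoidAlgebra.single (-(k • ind F)) (1 : K) * f, ?_⟩
    change toLaurent n K (xMon K F ^ k) * _ = f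
    rw [toLaurent_xMon_pow]
    have h2 := congrArg (· * f) h
    rwa [mul_assoc, one_mul] at h2

variable (J : Ideal (MvPolynomial (Fin n) K))

/-- The elements of an ideal as Laurent polynomials. -/
def idealToLaurent : J →ₗ[MvPolynomial (Fin n) K] Laurent n K where
  toFun f := toLaurent n K f
  map_add' f g := by simp
  map_smul' p f := by
    rw [smul_laurent]
    simp

/-- The elements of a localization of an ideal as Laurent polynomials. -/
def locToLaurent (F : Finset (Fin n)) :
    Loc (K := K) J F →ₗ[MvPolynomial (Fin n) K] Laurent n K :=
  LocalizedModule.lift (Submonoid.powers (xMon K F)) (idealToLaurent J) (isUnit_laurent F)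

variable {J}

theorem locToLaurent_res {F F' : Finset (Fin n)} (h : F ⊆ F') (z : Loc (K := K) J F) :
    locToLaurent J F' (res J h z) = locToLaurent J F z := by
  have h1 : locToLaurent J F = locToLaurent J F' ∘ₗ res J h := by
    refine LocalizedModule.lift_unique _ _ _ _ ?_
    rw [LinearMap.comp_assoc, res, LocalizedModule.lift_comp]
    exact LocalizedModule.lift_comp _ _ _
  rw [h1]
  rfl

theorem xMon_pow_smul_locToLaurent {F : Finset (Fin n)} (k : ℕ) (m : J) :
    xMon K F ^ k • locToLaurent J F
      (LocalizedModule.mk m ⟨xMon K F ^ k, pow_mem (Submonoid.mem_powers _) k⟩) =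
      toLaurent n K m := by
  rw [← map_smul, LocalizedModule.smul'_mk]
  have h := LocalizedModule.mk_cancel
    (⟨xMon K F ^ k, pow_mem (Submonoid.mem_powers _) k⟩ : Submonoid.powers (xMon K F)) m
  rw [Submonoid.smul_def] at h
  rw [h, locToLaurent, LocalizedModule.lift_mk_one]
  rfl

theorem coeff_locToLaurent {F : Finset (Fin n)} (k : ℕ) (m : J) (a : Fin n → ℤ) :
    (locToLaurent J F
      (LocalizedModule.mk m ⟨xMon K F ^ k, pow_mem (Submonoid.mem_powers _) k⟩)).coeff a =
      (toLaurent n K m).coeff (a + k • ind F) := by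
  rw [← xMon_pow_smul_locToLaurent k m, coeff_xMon_pow_smul]

theorem exists_mk {F : Finset (Fin n)} (z : Loc (K := K) J F) : ∃ (k : ℕ) (m : J),
    z = LocalizedModule.mk m ⟨xMon K F ^ k, pow_mem (Submonoid.mem_powers _) k⟩ := by
  induction z using LocalizedModule.induction_on with
  | h m s =>
    obtain ⟨_, k, rfl⟩ := s
    exact ⟨k, m, rfl⟩

theorem toLaurent_injective : Function.Injective (toLaurent n K) :=
  fun p q h => MvPolynomial.ext _ _ fun b => by rw [← coeff_toLaurent, h, coeff_toLaurent]

theorem locToLaurent_injective (F : Finset (Fin n)) : Function.Injective (locToLaurent J F) := by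
  rw [injective_iff_map_eq_zero]
  intro z hz
  obtain ⟨k, m, rfl⟩ := exists_mk z
  have h := xMon_pow_smul_locToLaurent (F := F) k m
  rw [hz, smul_zero] at h
  have : m = 0 := by
    ext1
    exact toLaurent_injective (by rw [← h]; simp)
  rw [this, LocalizedModule.zero_mk]

/-- The sets `F` for which the Laurent monomial `x^a` lies in the localization at `x_F` of the
monomial ideal with exponents `A`. -/
def locSupport (A : Set (Fin n →₀ ℕ)) (a : Fin n → ℤ) : Set (Finset (Fin n)) :=
  {F | ∃ k : ℕ, ∃ b ∈ A, emb n b = a + k • ind F}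

/-- `J` is spanned by the monomials with exponents in `A`. -/
def IsMonomialIdeal (J : Ideal (MvPolynomial (Fin n) K)) (A : Set (Fin n →₀ ℕ)) : Prop :=
  ∀ f, f ∈ J ↔ ∀ a ∈ f.support, a ∈ A

variable {A : Set (Fin n →₀ ℕ)}

theorem mem_locSupport_of_coeff (hJ : IsMonomialIdeal J A) {F : Finset (Fin n)}
    {z : Loc (K := K) J F} {a : Fin n → ℤ} (h : (locToLaurent J F z).coeff a ≠ 0) :
    F ∈ locSupport A a := by
  obtain ⟨k, m, rfl⟩ := exists_mk z
  rw [coeff_locToLaurent] at h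
  obtain ⟨b, hb, hb'⟩ := coeff_toLaurent_ne_zero h
  exact ⟨k, b, (hJ _).1 m.2 b hb, hb'⟩

theorem sum_eq_of_coeff {F : Finset (Fin n)} {z : Loc (K := K) J F} {j : ℤ}
    (hz : LocHomogeneous (idealGrading J) j z) {a : Fin n → ℤ}
    (h : (locToLaurent J F z).coeff a ≠ 0) : ∑ v, a v = j := by
  obtain ⟨k, m, hm, rfl⟩ := hz
  rw [coeff_locToLaurent] at h
  obtain ⟨b, hb, hb'⟩ := coeff_toLaurent_ne_zero h
  have h1 := hm (mem_support_iff.1 hb)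
  have h2 : ∑ v, emb n b v = Finsupp.weight (fun _ : Fin n => (1 : ℤ)) b := by
    rw [Finsupp.weight_apply, Finsupp.sum_fintype _ _ (by simp)]
    simp [emb]
  rw [← h2, hb'] at h1
  simp only [Pi.add_apply, Pi.smul_apply, Finset.sum_add_distrib, ← Finset.smul_sum] at h1
  have h3 : ∑ v, ind F v = F.card := by simp [ind]
  rw [h3] at h1
  simpa using h1

theorem exists_locToLaurent_single (hJ : IsMonomialIdeal J A) {F : Finset (Fin n)}
    {a : Fin n → ℤ} (h : F ∈ locSupport A a) (r : K) :
    ∃ z : Loc (K := K) J F, LocHomogeneous (idealGrading J) (∑ v, a v) z ∧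
      locToLaurent J F z = AddMonoidAlgebra.single a r := by
  obtain ⟨k, b, hb, hb'⟩ := h
  have hm : monomial b r ∈ J := (hJ _).2 fun c hc => by
    rw [Finset.mem_singleton.1 (support_monomial_subset hc)]
    exact hb
  refine ⟨LocalizedModule.mk ⟨_, hm⟩ ⟨xMon K F ^ k, pow_mem (Submonoid.mem_powers _) k⟩,
    ⟨k, ⟨_, hm⟩, ?_, rfl⟩, ?_⟩
  · refine isWeightedHomogeneous_monomial _ _ _ ?_
    have h2 : ∑ v, emb n b v = Finsupp.weight (fun _ : Fin n => (1 : ℤ)) b := by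
      rw [Finsupp.weight_apply, Finsupp.sum_fintype _ _ (by simp)]
      simp [emb]
    have h3 : ∑ v, ind F v = F.card := by simp [ind]
    rw [← h2, hb']
    simp only [Pi.add_apply, Pi.smul_apply, Finset.sum_add_distrib, ← Finset.smul_sum, h3]
    simp
  · ext c
    rw [coeff_locToLaurent]
    dsimp only
    rw [toLaurent_monomial, hb', AddMonoidAlgebra.coeff_single, AddMonoidAlgebra.coeff_single,
      Finsupp.single_apply, Finsupp.single_apply]
    simp

theorem exists_locToLaurent (hJ : IsMonomialIdeal J A) {F : Finset (Fin n)} (f : Laurent n K)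
    (h : ∀ a, f.coeff a ≠ 0 → F ∈ locSupport A a) :
    ∃ z : Loc (K := K) J F, locToLaurent J F z = f := by
  have h1 : f = ∑ a ∈ f.coeff.support, AddMonoidAlgebra.single a (f.coeff a) := by
    ext c
    rw [AddMonoidAlgebra.coeff_sum]
    simp only [AddMonoidAlgebra.coeff_single]
    exact congrArg (· c) f.coeff.sum_single.symm
  have h2 : ∀ a, ∃ z : Loc (K := K) J F,
      locToLaurent J F z = AddMonoidAlgebra.single a (f.coeff a) := by
    intro a
    by_cases ha : f.coeff a = 0
    · exact ⟨0, by rw [ha, map_zero, AddMonoidAlgebra.single_zero]⟩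
    · obtain ⟨z, -, hz⟩ := exists_locToLaurent_single hJ (h a ha) (f.coeff a)
      exact ⟨z, hz⟩
  choose z hz using h2
  refine ⟨∑ a ∈ f.coeff.support, z a, ?_⟩
  rw [map_sum]
  simp only [hz]
  exact h1.symm

/-- The component of degree `a ∈ ℤⁿ` of a Čech cochain. -/
def component {i : ℕ} (c : Cech n K J i) (a : Fin n → ℤ) (F : Finset (Fin n)) : K :=
  if h : F.card = i then (locToLaurent J F (c ⟨F, h⟩)).coeff a else 0

theorem isCochain_component (hJ : IsMonomialIdeal J A) {i : ℕ} (c : Cech n K J i)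
    (a : Fin n → ℤ) : IsCochain (locSupport A a) i (component c a) := by
  intro F hF
  unfold component at hF
  split_ifs at hF with h
  · exact ⟨mem_locSupport_of_coeff hJ hF, by exact_mod_cast h⟩
  · exact absurd rfl hF

/-- Restriction between localizations becomes the identity inside Laurent polynomials, so in each
multidegree only the signs of the Čech differential survive. -/
theorem component_cechD {i : ℕ} (c : Cech n K J i) (a : Fin n → ℤ) {F : Finset (Fin n)}
    (hF : F.card = i + 1) :
    component (cechD J i c) a F = bdry (component c a) F := by
  unfold component bdry
  rw [dif_pos hF, ← Finset.sum_coe_sort F]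
  have h1 : locToLaurent J F (cechD J i c ⟨F, hF⟩) = ∑ v : {v // v ∈ F},
      ((-1 : ℤ) ^ (F.filter (· < v.1)).card) • locToLaurent J (F.erase v.1) (c ⟨F.erase v.1,
        by rw [Finset.card_erase_of_mem v.2, hF, Nat.add_sub_cancel]⟩) := by
    simp only [cechD, LinearMap.pi_apply, LinearMap.sum_apply, map_sum]
    refine Finset.sum_congr rfl fun v _ => ?_
    rw [← locToLaurent_res (Finset.erase_subset v.1 F), ← map_zsmul]
    rfl
  rw [h1, AddMonoidAlgebra.coeff_sum, Finsupp.finsetSum_apply]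
  refine Finset.sum_congr rfl fun v _ => ?_
  dsimp only
  rw [dif_pos (by rw [Finset.card_erase_of_mem v.2, hF, Nat.add_sub_cancel]), sgn]
  rcases Nat.even_or_odd (F.filter (· < v.1)).card with h2 | h2
  · rw [h2.neg_one_pow, h2.neg_one_pow, one_smul, one_mul]
  · rw [h2.neg_one_pow, h2.neg_one_pow, neg_smul, one_smul, neg_mul, one_mul]
    rfl

theorem cech_ext {i : ℕ} {c d : Cech n K J i}
    (h : ∀ a (F : Finset (Fin n)), F.card = i → component c a F = component d a F) : c = d := by
  funext ⟨F, hF⟩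
  refine locToLaurent_injective F ?_
  ext a
  have := h a F hF
  unfold component at this
  rwa [dif_pos hF, dif_pos hF] at this

/-- Finitely many multidegrees are needed for the strands to add up to a Laurent polynomial. -/
theorem exists_component_eq (hJ : IsMonomialIdeal J A) {i : ℕ}
    (e : (Fin n → ℤ) → Finset (Fin n) → K) (he : ∀ a, IsCochain (locSupport A a) i (e a))
    (S : Finset (Fin n → ℤ)) (hS : ∀ a ∉ S, ∀ F, e a F = 0) :
    ∃ c : Cech n K J i, ∀ a F, component c a F = e a F := by
  have h : ∀ F : {F : Finset (Fin n) // F.card = i}, ∃ z : Loc (K := K) J F.1,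
      ∀ a, (locToLaurent J F.1 z).coeff a = e a F.1 := by
    rintro ⟨F, hF⟩
    have hf : ∀ a, (∑ a ∈ S, AddMonoidAlgebra.single a (e a F) : Laurent n K).coeff a = e a F := by
      intro a
      rw [AddMonoidAlgebra.coeff_sum, Finsupp.finsetSum_apply]
      simp only [AddMonoidAlgebra.coeff_single, Finsupp.single_apply]
      rw [Finset.sum_ite_eq']
      split_ifs with h
      · rfl
      · exact (hS a h F).symm
    obtain ⟨z, hz⟩ := exists_locToLaurent hJ (F := F)
      (∑ a ∈ S, AddMonoidAlgebra.single a (e a F)) fun a ha => (he a F (by rwa [hf] at ha)).1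
    exact ⟨z, fun a => by rw [hz, hf]⟩
  choose z hz using h
  refine ⟨z, fun a F => ?_⟩
  unfold component
  split_ifs with hF
  · exact hz ⟨F, hF⟩ a
  · by_contra h'
    exact hF (by exact_mod_cast (he a F (Ne.symm h')).2)

theorem bdry_eq_zero_of_notMem {a : Fin n → ℤ} {i : ℤ} {c : Finset (Fin n) → K}
    (hc : IsCochain (locSupport A a) i c) (hA : ∀ F F', F ⊆ F' → F ∈ locSupport A a →
      F' ∈ locSupport A a) {F : Finset (Fin n)} (hF : F ∉ locSupport A a) : bdry c F = 0 :=
  Finset.sum_eq_zero fun v _ => by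
    rw [hc.eq_zero fun h => hF (hA _ _ (Finset.erase_subset _ _) h), mul_zero]

theorem IsMonomialIdeal.upper (hJ : IsMonomialIdeal J A) {b b' : Fin n →₀ ℕ} (h : b ≤ b')
    (hb : b ∈ A) : b' ∈ A := by
  have h1 : monomial b (1 : K) ∈ J := (hJ _).2 fun c hc => by
    rw [Finset.mem_singleton.1 (support_monomial_subset hc)]
    exact hb
  have h2 : monomial b' (1 : K) ∈ J := by
    have := J.mul_mem_left (monomial (b' - b) 1) h1
    rwa [monomial_mul, tsub_add_cancel_of_le h, one_mul] at this
  exact (hJ _).1 h2 b' (by simp [mem_support_iff])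

theorem locSupport_upper (hJ : IsMonomialIdeal J A) (a : Fin n → ℤ) (F F' : Finset (Fin n))
    (h : F ⊆ F') (hF : F ∈ locSupport A a) : F' ∈ locSupport A a := by
  obtain ⟨k, b, hb, hb'⟩ := hF
  refine ⟨k, b + k • ∑ v ∈ F' \ F, Finsupp.single v 1, hJ.upper le_self_add hb, ?_⟩
  rw [map_add, hb', map_nsmul, emb_sum_single, add_assoc, ← smul_add]
  congr 2
  ext v
  simp only [ind, Pi.add_apply, Finset.mem_sdiff]
  by_cases h1 : v ∈ F
  · simp [h1, h h1]
  · simp [h1]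

/-- A homogeneous cocycle of degree j lives in the multidegrees of sum j; primitives are found
strand by strand and reassembled. -/
theorem localCohDegree_eq_zero (hJ : IsMonomialIdeal J A) {i : ℕ} {j : ℤ}
    (h : ∀ a : Fin n → ℤ, ∑ v, a v = j → Vanishes K (locSupport A a) i) :
    ∀ z ∈ localCohDegree n K (idealGrading J) i j, z = 0 := by
  classical
  rintro _ ⟨c, hc, rfl⟩
  rw [Submodule.Quotient.mk_eq_zero, Submodule.submoduleOf, Submodule.mem_comap]
  have hcoc : ∀ a, ∀ F ∈ locSupport A a, bdry (component c.1 a) F = 0 := by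
    intro a F _
    by_cases hF : F.card = i + 1
    · rw [← component_cechD _ _ hF, show cechD J i c.1 = 0 from c.2]
      simp [component]
    · refine Finset.sum_eq_zero fun v hv => ?_
      rw [component, dif_neg, mul_zero]
      intro h'
      exact hF (by rw [← h', Finset.card_erase_add_one hv])
  have hex : ∀ a : Fin n → ℤ, ∃ e : Finset (Fin n) → K,
      IsCochain (locSupport A a) ((i : ℤ) - 1) e ∧
      (∀ F ∈ locSupport A a, bdry e F = component c.1 a F) ∧
      -- Requiring a zero primitive where the strand is zero keeps the support of the assembled
      -- primitive finite.
      ((∀ F, component c.1 a F = 0) → ∀ F, e F = 0) := by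
    intro a
    by_cases ha : ∀ F, component c.1 a F = 0
    · exact ⟨fun _ => 0, fun F h => absurd rfl h, fun F _ => by simp [bdry, ha], fun _ _ => rfl⟩
    · push Not at ha
      obtain ⟨F, hF⟩ := ha
      have haj : ∑ v, a v = j := by
        unfold component at hF
        split_ifs at hF with h'
        · exact sum_eq_of_coeff (hc ⟨F, h'⟩) hF
        · exact absurd rfl hF
      obtain ⟨e, he, he'⟩ := h a haj _ (isCochain_component hJ c.1 a) (hcoc a)
      exact ⟨e, he, he', fun h0 => absurd (h0 F) hF⟩
  choose e he he' he0 using hex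
  have hall : ∀ a F, bdry (e a) F = component c.1 a F := by
    intro a F
    by_cases hF : F ∈ locSupport A a
    · exact he' a F hF
    · rw [bdry_eq_zero_of_notMem (he a) (locSupport_upper hJ a) hF,
        (isCochain_component hJ c.1 a).eq_zero hF]
  cases i with
  | zero =>
    change (c : Cech n K J 0) ∈ (⊥ : Submodule _ _)
    rw [Submodule.mem_bot]
    refine cech_ext fun a F _ => ?_
    rw [← hall]
    refine (Finset.sum_eq_zero fun v _ => ?_).trans (by simp [component])
    by_contra h'
    have := (he a _ (right_ne_zero_of_mul h')).2
    push_cast at this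
  | succ i =>
    let S : Finset (Fin n → ℤ) := Finset.univ.biUnion
      fun F : {F : Finset (Fin n) // F.card = i + 1} => (locToLaurent J F.1 (c.1 F)).coeff.support
    have hS : ∀ a ∉ S, ∀ F, e a F = 0 := by
      intro a ha
      refine he0 a fun F => ?_
      unfold component
      split_ifs with hF
      · by_contra h'
        exact ha (Finset.mem_biUnion.2 ⟨⟨F, hF⟩, Finset.mem_univ _, Finsupp.mem_support_iff.2 h'⟩)
      · rfl
    obtain ⟨E, hE⟩ := exists_component_eq hJ e (i := i) (by simpa using he) S hS
    refine ⟨E, cech_ext fun a F hF => ?_⟩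
    rw [component_cechD _ _ hF, show component E a = e a from funext (hE a), hall]
    rfl

/-- The converse transfer: a cocycle on the family is placed in the single multidegree a, and the
strand of degree a of any Čech primitive is a primitive for it. -/
theorem vanishes_locSupport (hJ : IsMonomialIdeal J A) {i : ℕ} {j : ℤ}
    (h : ∀ z ∈ localCohDegree n K (idealGrading J) i j, z = 0) {a : Fin n → ℤ}
    (ha : ∑ v, a v = j) : Vanishes K (locSupport A a) i := by
  classical
  intro c hc hcc
  have hall : ∀ F, bdry c F = 0 := by
    intro F
    by_cases hF : F ∈ locSupport A a
    · exact hcc F hF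
    · exact bdry_eq_zero_of_notMem hc (locSupport_upper hJ a) hF
  have hz : ∀ F : {F : Finset (Fin n) // F.card = i}, ∃ z : Loc (K := K) J F.1,
      LocHomogeneous (idealGrading J) j z ∧
        locToLaurent J F.1 z = AddMonoidAlgebra.single a (c F.1) := by
    rintro ⟨F, hF⟩
    by_cases hcF : c F = 0
    · refine ⟨0, ⟨0, 0, ?_, (LocalizedModule.zero_mk _).symm⟩, ?_⟩
      · exact isWeightedHomogeneous_zero _ _ _
      · rw [hcF, map_zero, AddMonoidAlgebra.single_zero]
    · subst ha
      exact exists_locToLaurent_single hJ (hc F hcF).1 (c F)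
  choose C hC hC' using hz
  have hcomp : ∀ a' F, component C a' F = if a = a' then c F else 0 := by
    intro a' F
    unfold component
    split_ifs with h1 h2 h2
    · rw [hC' ⟨F, h1⟩, AddMonoidAlgebra.coeff_single, Finsupp.single_apply, if_pos h2]
    · rw [hC' ⟨F, h1⟩, AddMonoidAlgebra.coeff_single, Finsupp.single_apply, if_neg h2]
    · by_contra h'
      exact h1 (by exact_mod_cast (hc F (Ne.symm h')).2)
    · rfl
  have hker : C ∈ cocycles n K J i := by
    change cechD J i C = 0
    refine cech_ext fun a' F hF => ?_
    rw [component_cechD _ _ hF]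
    have h0 : component (0 : Cech n K J (i + 1)) a' F = 0 := by simp [component]
    rw [h0]
    by_cases h1 : a = a'
    · rw [show component C a' = c from funext fun F => by rw [hcomp, if_pos h1], hall]
    · rw [show component C a' = fun _ => 0 from funext fun F => by rw [hcomp, if_neg h1]]
      simp [bdry]
  have h1 := h _ ⟨⟨C, hker⟩, hC, rfl⟩
  rw [Submodule.Quotient.mk_eq_zero, Submodule.submoduleOf, Submodule.mem_comap] at h1
  cases i with
  | zero =>
    change C ∈ (⊥ : Submodule _ _) at h1
    rw [Submodule.mem_bot] at h1
    refine ⟨fun _ => 0, fun F h => absurd rfl h, fun F _ => ?_⟩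
    have h2 := hcomp a F
    rw [if_pos rfl, h1] at h2
    rw [← h2]
    simp [bdry, component]
  | succ i =>
    obtain ⟨E, hE⟩ := h1
    refine ⟨component E a, by simpa using isCochain_component hJ E a, fun F _ => ?_⟩
    have h2 := hcomp a F
    rw [if_pos rfl] at h2
    rw [← h2]
    by_cases hF : F.card = i + 1
    · rw [← component_cechD _ _ hF, hE]
      rfl
    · have hr : component C a F = 0 := dif_neg hF
      rw [hr]
      refine Finset.sum_eq_zero fun v hv => ?_
      rw [component, dif_neg, mul_zero]
      intro h'
      exact hF (by rw [← h', Finset.card_erase_add_one hv])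

end Laurent

/-! ### Exponents of powers of edge ideals, and slots -/

section Exponents

variable {n : ℕ} {K : Type*} [Field K] (G : SimpleGraph (Fin n))

/-- The exponent of the product of the edges in a list. -/
def listExp (L : List (Fin n × Fin n)) : Fin n →₀ ℕ :=
  (L.map fun e => Finsupp.single e.1 1 + Finsupp.single e.2 1).sum

theorem listExp_apply (L : List (Fin n × Fin n)) (v : Fin n) :
    listExp L v = (L.map Prod.fst ++ L.map Prod.snd).count v := by
  unfold listExp
  induction L with
  | nil => simp
  | cons e L ih =>
    simp only [List.map_cons, List.sum_cons, Finsupp.add_apply, ih, List.count_append,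
      List.count_cons, Finsupp.single_apply]
    simp only [beq_iff_eq]
    omega

/-- The exponents of the monomials in the `s`-th power of the edge ideal. -/
def powerExp (s : ℕ) : Set (Fin n →₀ ℕ) :=
  {b | ∃ L : List (Fin n × Fin n), L.length = s ∧ (∀ e ∈ L, G.Adj e.1 e.2) ∧
    ∀ v, (L.map Prod.fst ++ L.map Prod.snd).count v ≤ b v}

theorem edgeIdeal_pow (s : ℕ) : edgeIdeal K G ^ s = Ideal.span ((fun d => monomial d (1 : K)) ''
    {d | ∃ L : List (Fin n × Fin n), L.length = s ∧ (∀ e ∈ L, G.Adj e.1 e.2) ∧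
      listExp L = d}) := by
  induction s with
  | zero =>
    rw [pow_zero, Ideal.one_eq_top, eq_comm, Ideal.eq_top_iff_one]
    refine Ideal.subset_span ⟨0, ⟨[], rfl, by simp, rfl⟩, rfl⟩
  | succ s ih =>
    rw [pow_succ', ih, edgeIdeal, Ideal.span_mul_span']
    congr 1
    ext f
    simp only [Set.mem_mul, Set.mem_ofPred_eq, Set.mem_image]
    constructor
    · rintro ⟨_, ⟨i, j, hij, rfl⟩, _, ⟨_, ⟨L, hL, hL', rfl⟩, rfl⟩, rfl⟩
      refine ⟨_, ⟨(i, j) :: L, by simp [hL], ?_, rfl⟩, ?_⟩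
      · simp only [List.mem_cons, forall_eq_or_imp]
        exact ⟨hij, hL'⟩
      · simp only [listExp, List.map_cons, List.sum_cons, X, monomial_mul, one_mul]
    · rintro ⟨_, ⟨L, hL, hL', rfl⟩, rfl⟩
      obtain ⟨⟨i, j⟩, L, rfl⟩ := List.exists_cons_of_length_eq_add_one hL
      simp only [List.mem_cons, forall_eq_or_imp] at hL'
      refine ⟨_, ⟨i, j, hL'.1, rfl⟩, _, ⟨_, ⟨L, by simpa using hL, hL'.2, rfl⟩, rfl⟩, ?_⟩
      simp only [listExp, List.map_cons, List.sum_cons, X, monomial_mul, one_mul]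

theorem isMonomialIdeal_edgeIdeal_pow (s : ℕ) :
    IsMonomialIdeal (edgeIdeal K G ^ s) (powerExp G s) := by
  intro f
  rw [edgeIdeal_pow, mem_ideal_span_monomial_image]
  refine forall₂_congr fun b _ => ?_
  constructor
  · rintro ⟨_, ⟨L, hL, hL', rfl⟩, h⟩
    exact ⟨L, hL, hL', fun v => by rw [← listExp_apply]; exact h v⟩
  · rintro ⟨L, hL, hL', h⟩
    exact ⟨_, ⟨L, hL, hL', rfl⟩, fun v => by rw [listExp_apply]; exact h v⟩

/-- The set `F` contains an edge. -/
def HasEdge (F : Finset (Fin n)) : Prop := ∃ u ∈ F, ∃ v ∈ F, G.Adj u v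

/-- The set of coordinates where `a` is negative. -/
def negSupp (a : Fin n → ℤ) : Finset (Fin n) := Finset.univ.filter (a · < 0)

variable {G}

/-- Inverting x_F makes the exponents on F irrelevant, so divisibility by a product of s edges is
tested only outside F. -/
theorem mem_locSupport_powerExp (s : ℕ) (a : Fin n → ℤ) (F : Finset (Fin n)) :
    F ∈ locSupport (powerExp G s) a ↔ negSupp a ⊆ F ∧ ∃ L : List (Fin n × Fin n),
      L.length = s ∧ (∀ e ∈ L, G.Adj e.1 e.2) ∧
      ∀ v ∉ F, (L.map Prod.fst ++ L.map Prod.snd).count v ≤ (a v).toNat := by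
  constructor
  · rintro ⟨k, b, ⟨L, hL, hL', h⟩, hb⟩
    have hv : ∀ v ∉ F, (b v : ℤ) = a v := by
      intro v hv
      have := congrFun hb v
      simpa [emb, ind, hv] using this
    refine ⟨fun v hv' => ?_, L, hL, hL', fun v hv' => ?_⟩
    · by_contra h'
      have h1 := hv v h'
      simp only [negSupp, Finset.mem_filter] at hv'
      omega
    · have h1 := hv v hv'
      have h2 := h v
      omega
  · rintro ⟨hF, L, hL, hL', h⟩
    -- A vertex occurs at most 2s times in s edges; the second summand outweighs every negative
    -- coordinate of a.
    let k : ℕ := 2 * s + ∑ v, (a v).natAbs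
    have hk : ∀ v ∈ F, 2 * (s : ℤ) ≤ a v + k := by
      intro v _
      have h1 : (a v).natAbs ≤ ∑ v, (a v).natAbs :=
        Finset.single_le_sum (f := fun v => (a v).natAbs) (fun _ _ => Nat.zero_le _)
          (Finset.mem_univ v)
      simp only [k]
      push_cast
      have h2 : ((a v).natAbs : ℤ) ≤ ∑ v, ((a v).natAbs : ℤ) := by exact_mod_cast h1
      have h3 : ∑ v, ((a v).natAbs : ℤ) = ∑ v, |a v| := by simp
      rw [h3] at h2
      omega
    have h0 : ∀ v ∉ F, 0 ≤ a v := by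
      intro v hv
      by_contra h'
      exact hv (hF (by simpa [negSupp] using h'))
    refine ⟨k, Finsupp.equivFunOnFinite.symm fun v => (a v + k * ind F v).toNat,
      ⟨L, hL, hL', fun v => ?_⟩, ?_⟩
    · by_cases hv : v ∈ F
      · have h1 := hk v hv
        have h2 : (L.map Prod.fst ++ L.map Prod.snd).count v ≤ 2 * s := by
          refine List.count_le_length.trans ?_
          simp [hL, two_mul]
        simp only [Finsupp.coe_equivFunOnFinite_symm, ind, hv, if_true]
        omega
      · simpa [ind, hv] using h v hv
    · ext v
      by_cases hv : v ∈ F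
      · have h1 := hk v hv
        simp only [emb, AddMonoidHom.coe_mk, ZeroHom.coe_mk, Finsupp.coe_equivFunOnFinite_symm, ind,
          hv, if_true, Pi.add_apply, Pi.smul_apply]
        simp
        omega
      · have h1 := h0 v hv
        simp only [emb, AddMonoidHom.coe_mk, ZeroHom.coe_mk, Finsupp.coe_equivFunOnFinite_symm, ind,
          hv, if_false, Pi.add_apply, Pi.smul_apply]
        simp
        omega

/-- The units of the positive part of `a`: a vertex `v` occurs `a v` times. -/
abbrev Slots (a : Fin n → ℤ) : Type := Σ v : Fin n, Fin (a v).toNat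

theorem card_units (a : Fin n → ℤ) : Fintype.card (Slots a) = ∑ v, (a v).toNat := by
  simp [Fintype.card_sigma]

theorem exists_units {a : Fin n → ℤ} (X : List (Fin n)) (h : ∀ v, X.count v ≤ (a v).toNat) :
    ∃ Y : List (Slots a), Y.Nodup ∧ Y.map Sigma.fst = X := by
  induction X with
  | nil => exact ⟨[], List.nodup_nil, rfl⟩
  | cons x X ih =>
    obtain ⟨Y, hY, rfl⟩ := ih fun v => (List.count_le_count_cons).trans (h v)
    -- If all slots over x were taken, x would already occur a x times in the tail, leaving no room
    -- for its occurrence at the head.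
    have h1 : ∃ i : Fin (a x).toNat, (⟨x, i⟩ : Slots a) ∉ Y := by
      by_contra! h'
      have h2 : (Finset.univ : Finset (Fin (a x).toNat)).card ≤
          (Y.filter fun y => y.1 = x).toFinset.card := by
        refine Finset.card_le_card_of_injOn (fun i => ⟨x, i⟩) ?_ ?_
        · intro i _
          simp [h' i]
        · intro i _ j _ hij
          simpa using hij
      rw [Finset.card_fin] at h2
      have h3 := h2.trans (List.toFinset_card_le _)
      have h4 := h x
      rw [List.count_cons_self, List.count, List.countP_map, List.countP_eq_length_filter] at h4
      have h5 : (Y.filter ((fun y => y == x) ∘ Sigma.fst)) = Y.filter fun y => y.1 = x := by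
        congr 1
      rw [h5] at h4
      omega
    obtain ⟨i, hi⟩ := h1
    exact ⟨⟨x, i⟩ :: Y, List.nodup_cons.2 ⟨hi, hY⟩, rfl⟩

theorem count_units_le {a : Fin n → ℤ} {Y : List (Slots a)} (hY : Y.Nodup) (v : Fin n) :
    (Y.map Sigma.fst).count v ≤ (a v).toNat := by
  rw [List.count, List.countP_map, List.countP_eq_length_filter]
  have h1 := (hY.filter ((fun y => y == v) ∘ Sigma.fst))
  rw [← List.toFinset_card_of_nodup h1]
  calc _ ≤ (Finset.univ.image fun i : Fin (a v).toNat => (⟨v, i⟩ : Slots a)).card := by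
        refine Finset.card_le_card fun y hy => ?_
        obtain ⟨w, i⟩ := y
        simp only [List.mem_toFinset, List.mem_filter, Function.comp_apply, beq_iff_eq] at hy
        obtain ⟨_, rfl⟩ := hy
        exact Finset.mem_image_of_mem _ (Finset.mem_univ i)
    _ ≤ _ := Finset.card_image_le.trans (by simp)

/-- The unit `i` has a neighbour in `F`. -/
def Meets {ι : Type*} (G : SimpleGraph (Fin n)) (β : ι → Fin n) (F : Finset (Fin n)) (i : ι) :
    Prop := ∃ u ∈ F, G.Adj (β i) u

/-- Two disjoint pieces, each a unit in `m` or an edge, can be chosen among the units. -/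
def Reach2 {ι : Type*} (D : SimpleGraph ι) (m : ι → Prop) : Prop :=
  (∃ i j, [i, j].Nodup ∧ m i ∧ m j) ∨
  (∃ i k l, [i, k, l].Nodup ∧ m i ∧ D.Adj k l) ∨
  (∃ i j k l, [i, j, k, l].Nodup ∧ D.Adj i j ∧ D.Adj k l)

/-- Three disjoint pieces, each a unit in `m` or an edge, can be chosen among the units. -/
def Reach3 {ι : Type*} (D : SimpleGraph ι) (m : ι → Prop) : Prop :=
  (∃ i j k, [i, j, k].Nodup ∧ m i ∧ m j ∧ m k) ∨
  (∃ i j k l, [i, j, k, l].Nodup ∧ m i ∧ m j ∧ D.Adj k l) ∨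
  (∃ i k l p q, [i, k, l, p, q].Nodup ∧ m i ∧ D.Adj k l ∧ D.Adj p q) ∨
  (∃ i j k l p q, [i, j, k, l, p, q].Nodup ∧ D.Adj i j ∧ D.Adj k l ∧ D.Adj p q)

/-- Outside an independent F an edge leaves either one vertex that has a neighbour in F, or the
whole edge: the two kinds of pieces. -/
theorem edge_cases {F : Finset (Fin n)} (hF : ¬ HasEdge G F) {p q : Fin n} (h : G.Adj p q) :
    (p ∉ F ∧ ∃ u ∈ F, G.Adj p u) ∨ (q ∉ F ∧ ∃ u ∈ F, G.Adj q u) ∨ (p ∉ F ∧ q ∉ F) := by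
  by_cases hp : p ∈ F
  · exact Or.inr (Or.inl ⟨fun hq => hF ⟨p, hp, q, hq, h⟩, p, hp, h.symm⟩)
  · by_cases hq : q ∈ F
    · exact Or.inl ⟨hp, q, hq, h⟩
    · exact Or.inr (Or.inr ⟨hp, hq⟩)

end Exponents

/-! ### Membership in a strand as a packing of pieces among slots -/

section Reach

variable {n : ℕ} {G : SimpleGraph (Fin n)}

/-- Among the units, `s` disjoint pieces can be chosen, each a unit in `m` or an edge. -/
def Reach {ι : Type*} (D : SimpleGraph ι) (m : ι → Prop) (s : ℕ) : Prop :=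
  ∃ (X : List ι) (E : List (ι × ι)), X.length + E.length = s ∧
    (X ++ (E.map Prod.fst ++ E.map Prod.snd)).Nodup ∧ (∀ i ∈ X, m i) ∧ ∀ e ∈ E, D.Adj e.1 e.2

theorem exists_pieces {F : Finset (Fin n)} (hF : ¬ HasEdge G F) (L : List (Fin n × Fin n))
    (hL : ∀ e ∈ L, G.Adj e.1 e.2) : ∃ (X : List (Fin n)) (E : List (Fin n × Fin n)),
      X.length + E.length = L.length ∧ (∀ v ∈ X ++ (E.map Prod.fst ++ E.map Prod.snd), v ∉ F) ∧
      (∀ v ∈ X, ∃ u ∈ F, G.Adj v u) ∧ (∀ e ∈ E, G.Adj e.1 e.2) ∧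
      ∀ v, (X ++ (E.map Prod.fst ++ E.map Prod.snd)).count v ≤
        (L.map Prod.fst ++ L.map Prod.snd).count v := by
  induction L with
  | nil => exact ⟨[], [], by simp⟩
  | cons e L ih =>
    obtain ⟨p, q⟩ := e
    simp only [List.mem_cons, forall_eq_or_imp] at hL
    obtain ⟨X, E, h1, h2, h3, h4, h5⟩ := ih hL.2
    rcases edge_cases hF hL.1 with ⟨hp, hu⟩ | ⟨hq, hu⟩ | ⟨hp, hq⟩
    · refine ⟨p :: X, E, by simp; omega, ?_, ?_, h4, fun v => ?_⟩
      · simp only [List.cons_append, List.mem_cons, forall_eq_or_imp]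
        exact ⟨hp, h2⟩
      · simp only [List.mem_cons, forall_eq_or_imp]
        exact ⟨hu, h3⟩
      · have := h5 v
        simp only [List.cons_append, List.map_cons, List.count_append, List.count_cons] at this ⊢
        omega
    · refine ⟨q :: X, E, by simp; omega, ?_, ?_, h4, fun v => ?_⟩
      · simp only [List.cons_append, List.mem_cons, forall_eq_or_imp]
        exact ⟨hq, h2⟩
      · simp only [List.mem_cons, forall_eq_or_imp]
        exact ⟨hu, h3⟩
      · have := h5 v
        simp only [List.cons_append, List.map_cons, List.count_append, List.count_cons] at this ⊢
        omega
    · refine ⟨X, (p, q) :: E, by simp; omega, ?_, h3, ?_, fun v => ?_⟩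
      · intro v hv
        simp only [List.map_cons, List.mem_append, List.mem_cons] at hv h2
        rcases hv with hv | (rfl | hv) | (rfl | hv)
        · exact h2 v (Or.inl hv)
        · exact hp
        · exact h2 v (Or.inr (Or.inl hv))
        · exact hq
        · exact h2 v (Or.inr (Or.inr hv))
      · simp only [List.mem_cons, forall_eq_or_imp]
        exact ⟨hL.1, h4⟩
      · have := h5 v
        simp only [List.cons_append, List.map_cons, List.count_append, List.count_cons] at this ⊢
        omega

/-- An edge inside F is invertible and can be used s times for free. Otherwise each edge factor is
trimmed to its part outside F, and the trimmed factors occupy distinct slots; conversely a met slot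
is completed to an edge by its neighbour in F. -/
theorem mem_locSupport_iff_reach (s : ℕ) (a : Fin n → ℤ) (F : Finset (Fin n)) :
    F ∈ locSupport (powerExp G s) a ↔ negSupp a ⊆ F ∧ (HasEdge G F ∨
      Reach (G.comap (Sigma.fst : Slots a → Fin n)) (Meets G Sigma.fst F) s) := by
  rw [mem_locSupport_powerExp]
  refine and_congr_right fun _ => ⟨?_, ?_⟩
  · rintro ⟨L, rfl, hL', h⟩
    refine or_iff_not_imp_left.2 fun hF => ?_
    obtain ⟨X, E, h1, h2, h3, h4, h5⟩ := exists_pieces hF L hL'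
    obtain ⟨Y, hY, hY'⟩ := exists_units (a := a) (X ++ (E.map Prod.fst ++ E.map Prod.snd))
      fun v => by
        by_cases hv : v ∈ F
        · rw [List.count_eq_zero_of_not_mem fun h' => h2 v h' hv]
          exact Nat.zero_le _
        · exact (h5 v).trans (h v hv)
    obtain ⟨Y₁, Y', rfl, rfl, hY''⟩ := List.map_eq_append_iff.1 hY'
    obtain ⟨Y₂, Y₃, rfl, hY₂, hY₃⟩ := List.map_eq_append_iff.1 hY''
    have hl2 : Y₂.length = E.length := by simpa using congrArg List.length hY₂
    have hl3 : Y₃.length = E.length := by simpa using congrArg List.length hY₃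
    have hl : Y₂.length = Y₃.length := hl2.trans hl3.symm
    refine ⟨Y₁, Y₂.zip Y₃, ?_, ?_, ?_, ?_⟩
    · rw [List.length_zip, ← hl, min_self, hl2, ← h1, List.length_map]
    · rwa [List.map_fst_zip hl.le, List.map_snd_zip hl.ge]
    · exact fun i hi => h3 _ (List.mem_map_of_mem hi)
    · rintro ⟨i, j⟩ hij
      refine h4 (i.1, j.1) ?_
      have h6 : (i.1, j.1) ∈ (Y₂.map Sigma.fst).zip (Y₃.map Sigma.fst) := by
        rw [List.zip_map]
        exact List.mem_map.2 ⟨_, hij, rfl⟩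
      rwa [hY₂, hY₃, List.zip_map', List.map_id'] at h6
  · rintro (⟨u, hu, v, hv, huv⟩ | ⟨X, E, rfl, hN, hX, hE⟩)
    · refine ⟨List.replicate s (u, v), by simp, ?_, fun w hw => ?_⟩
      · rintro e he
        rw [List.eq_of_mem_replicate he]
        exact huv
      · have h1 : u ≠ w := fun h => hw (h ▸ hu)
        have h2 : v ≠ w := fun h => hw (h ▸ hv)
        simp [List.count_append, List.count_replicate, h1, h2]
    · have hX' : ∀ i : Slots a, ∃ u, i ∈ X → u ∈ F ∧ G.Adj i.1 u := by
        intro i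
        by_cases hi : i ∈ X
        · obtain ⟨u, hu⟩ := hX i hi
          exact ⟨u, fun _ => hu⟩
        -- An arbitrary default, never used since the slot is not in X.
        · exact ⟨i.1, fun h => absurd h hi⟩
      choose u hu using hX'
      refine ⟨X.map (fun i => (i.1, u i)) ++ E.map fun e => (e.1.1, e.2.1), by simp, ?_,
        fun w hw => ?_⟩
      · intro e he
        simp only [List.mem_append, List.mem_map] at he
        rcases he with ⟨i, hi, rfl⟩ | ⟨e, he, rfl⟩
        · exact (hu i hi).2
        · exact hE e he
      · refine le_trans (le_of_eq ?_) (count_units_le hN w)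
        have h0 : (X.map u).count w = 0 := by
          refine List.count_eq_zero_of_not_mem fun h => ?_
          obtain ⟨i, hi, rfl⟩ := List.mem_map.1 h
          exact hw (hu i hi).1
        simp only [List.map_append, List.map_map, List.count_append]
        have h1 : (Prod.snd ∘ fun i : Slots a => (i.1, u i)) = u := rfl
        rw [h1, h0, zero_add, add_assoc]
        rfl

theorem reach_two_iff {ι : Type*} {D : SimpleGraph ι} {m : ι → Prop} :
    Reach D m 2 ↔ Reach2 D m := by
  constructor
  · rintro ⟨X, E, hl, hN, hX, hE⟩
    rcases X with _ | ⟨i, _ | ⟨j, _ | _⟩⟩ <;> rcases E with _ | ⟨⟨k, l⟩, _ | ⟨⟨p, q⟩, _ | _⟩⟩ <;>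
      simp at hl hX hE <;> try omega
    · refine Or.inr (Or.inr ⟨k, l, p, q, ?_, hE⟩)
      simp at hN ⊢
      tauto
    · exact Or.inr (Or.inl ⟨i, k, l, hN, hX, hE⟩)
    · exact Or.inl ⟨i, j, hN, hX⟩
  · rintro (⟨i, j, hN, h1, h2⟩ | ⟨i, k, l, hN, h1, h2⟩ | ⟨i, j, k, l, hN, h1, h2⟩)
    · exact ⟨[i, j], [], rfl, hN, by simp [h1, h2], by simp⟩
    · exact ⟨[i], [(k, l)], rfl, hN, by simp [h1], by simp [h2]⟩
    · refine ⟨[], [(i, j), (k, l)], rfl, ?_, by simp, by simp [h1, h2]⟩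
      simp at hN ⊢
      tauto

theorem reach_three_iff {ι : Type*} {D : SimpleGraph ι} {m : ι → Prop} :
    Reach D m 3 ↔ Reach3 D m := by
  constructor
  · rintro ⟨X, E, hl, hN, hX, hE⟩
    rcases X with _ | ⟨i, _ | ⟨j, _ | ⟨r, _ | _⟩⟩⟩ <;>
      rcases E with _ | ⟨⟨k, l⟩, _ | ⟨⟨p, q⟩, _ | ⟨⟨s, t⟩, _ | _⟩⟩⟩ <;>
      simp at hl hX hE <;> try omega
    · refine Or.inr (Or.inr (Or.inr ⟨k, l, p, q, s, t, ?_, hE⟩))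
      simp at hN ⊢
      tauto
    · refine Or.inr (Or.inr (Or.inl ⟨i, k, l, p, q, ?_, hX, hE⟩))
      simp at hN ⊢
      tauto
    · exact Or.inr (Or.inl ⟨i, j, k, l, hN, hX.1, hX.2, hE⟩)
    · exact Or.inl ⟨i, j, r, hN, hX⟩
  · rintro (⟨i, j, k, hN, h⟩ | ⟨i, j, k, l, hN, h1, h2, h3⟩ | ⟨i, k, l, p, q, hN, h1, h2, h3⟩ |
      ⟨i, j, k, l, p, q, hN, h1, h2, h3⟩)
    · exact ⟨[i, j, k], [], rfl, hN, by simp [h], by simp⟩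
    · exact ⟨[i, j], [(k, l)], rfl, hN, by simp [h1, h2], by simp [h3]⟩
    · refine ⟨[i], [(k, l), (p, q)], rfl, ?_, by simp [h1], by simp [h2, h3]⟩
      simp at hN ⊢
      tauto
    · refine ⟨[], [(i, j), (k, l), (p, q)], rfl, ?_, by simp, by simp [h1, h2, h3]⟩
      simp at hN ⊢
      tauto

end Reach

/-! ### Vanishing bounds for stars of independence complexes -/

section Bounds

variable {n : ℕ} {K : Type*} [Field K]

/-- The cohomology of all stars `{F ∈ 𝒜 : H ⊆ F}` vanishes in degrees at least `ρ + |H|`. -/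
def Bounded (K : Type*) [Field K] (𝒜 : Set (Finset (Fin n))) (ρ : ℤ) : Prop :=
  ∀ (H : Finset (Fin n)) (i : ℤ), ρ ≤ i - H.card → Vanishes K {F | F ∈ 𝒜 ∧ H ⊆ F} i

theorem ordConnected_star {𝒜 : Set (Finset (Fin n))} (h : IsLowerSet 𝒜) (H : Finset (Fin n)) :
    {F | F ∈ 𝒜 ∧ H ⊆ F}.OrdConnected :=
  h.ordConnected.inter (IsUpperSet.ordConnected fun _ _ hab ha => Finset.Subset.trans ha hab)

/-- The star of H splits into its members without v and the star of H ∪ {v}. The latter is needed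
one degree higher, exactly matching its larger cardinality. -/
theorem Bounded.erase {𝒜 : Set (Finset (Fin n))} {ρ : ℤ} (h : Bounded K 𝒜 ρ)
    (h𝒜 : IsLowerSet 𝒜) (v : Fin n) : Bounded K {F | F ∈ 𝒜 ∧ v ∉ F} ρ := by
  intro H i hi
  by_cases hv : v ∈ H
  · convert vanishes_empty (K := K) i using 1
    ext F
    simp only [Set.mem_ofPred_eq, Set.mem_empty_iff_false, iff_false]
    exact fun h => h.1.2 (h.2 hv)
  · refine IsSplit.vanishes_left (Q := {F | F ∈ 𝒜 ∧ H ⊆ F})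
      (Q₂ := {F | F ∈ 𝒜 ∧ insert v H ⊆ F}) ⟨ordConnected_star h𝒜 H, ?_, ?_, ?_⟩ (h H i hi)
      (h _ _ ?_)
    · ext F
      simp only [Set.mem_union, Set.mem_ofPred_eq, Finset.insert_subset_iff]
      tauto
    · rw [Set.disjoint_left]
      rintro F ⟨⟨-, h1⟩, -⟩ ⟨-, h2⟩
      exact h1 (h2 (Finset.mem_insert_self _ _))
    · rintro F ⟨-, h1⟩ F' ⟨h2, -⟩ hF
      exact ⟨h2, h1.trans hF⟩
    · rw [Finset.card_insert_of_notMem hv]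
      push_cast
      omega

variable (G : SimpleGraph (Fin n))

/-- The independent sets avoiding `W`. -/
def indepAway (W : Finset (Fin n)) : Set (Finset (Fin n)) := {F | ¬ HasEdge G F ∧ Disjoint F W}

variable {G}

theorem not_hasEdge_mono {F F' : Finset (Fin n)} (h : F ⊆ F') (hF : ¬ HasEdge G F') :
    ¬ HasEdge G F := fun ⟨u, hu, v, hv, huv⟩ => hF ⟨u, h hu, v, h hv, huv⟩

theorem isLowerSet_indepAway (W : Finset (Fin n)) : IsLowerSet (indepAway G W) :=
  fun _ _ h hF => ⟨not_hasEdge_mono h hF.1, hF.2.mono_left h⟩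

theorem Bounded.mono_away {W W' : Finset (Fin n)} {ρ : ℤ} (h : Bounded K (indepAway G W) ρ)
    (hW : W ⊆ W') : Bounded K (indepAway G W') ρ := by
  have h1 : ∀ U : Finset (Fin n), Bounded K (indepAway G (W ∪ U)) ρ := by
    intro U
    induction U using Finset.induction_on with
    | empty => simpa using h
    | insert v U _ ih =>
      convert ih.erase (isLowerSet_indepAway _) v using 1
      ext F
      simp only [indepAway, Set.mem_ofPred_eq, Finset.union_insert, Finset.disjoint_insert_right]
      tauto
  have h2 := h1 W'
  rwa [Finset.union_eq_right.2 hW] at h2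

theorem not_hasEdge_insert {F : Finset (Fin n)} {x : Fin n} (hF : ¬ HasEdge G F)
    (hx : ∀ u ∈ F, ¬ G.Adj x u) : ¬ HasEdge G (insert x F) := by
  rintro ⟨u, hu, v, hv, huv⟩
  rcases Finset.mem_insert.1 hu with h1 | hu <;> rcases Finset.mem_insert.1 hv with h2 | hv
  · exact huv.ne (h1.trans h2.symm)
  · exact hx v hv (h1 ▸ huv)
  · exact hx u hu (h2 ▸ huv.symm)
  · exact hF ⟨u, hu, v, hv, huv⟩

/-- An edge that is disjoint from the rest of the graph raises the bound by one. -/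
theorem Bounded.edge {W W' : Finset (Fin n)} {ρ : ℤ} (h : Bounded K (indepAway G W) ρ)
    {x y : Fin n} (hxy : G.Adj x y) (hx : x ∉ W) (hy : y ∉ W) (hW : W ⊆ W')
    (hN : ∀ u, G.Adj x u ∨ G.Adj y u → u ∈ W') : Bounded K (indepAway G W') (ρ - 1) := by
  intro H i hi
  have hxW : x ∈ W' := hN x (Or.inr hxy.symm)
  have hyW : y ∈ W' := hN y (Or.inl hxy)
  by_cases hH : Disjoint H W'
  swap
  · convert vanishes_empty (K := K) i using 1
    ext F
    simp only [Set.mem_ofPred_eq, Set.mem_empty_iff_false, iff_false]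
    exact fun h => hH (h.1.2.mono_left h.2)
  have hxH : x ∉ H := fun h' => Finset.disjoint_left.1 hH h' hxW
  have hyH : y ∉ H := fun h' => Finset.disjoint_left.1 hH h' hyW
  -- Once V is deleted, the edge xy is a connected component of what remains; V still contains W, so
  -- the bound ρ applies there.
  let V := (W'.erase x).erase y
  have hWV : W ⊆ V := fun u hu => Finset.mem_erase.2 ⟨fun h' => hy (h' ▸ hu),
    Finset.mem_erase.2 ⟨fun h' => hx (h' ▸ hu), hW hu⟩⟩
  have hxV : x ∉ V := by simp [V]
  have hyV : y ∉ V := by simp [V]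
  have hb := h.mono_away hWV
  have hlow := isLowerSet_indepAway (G := G) V
  -- With one end of the edge excluded, the other end is isolated and the family is a cone over it.
  have key : ∀ a b : Fin n, a ≠ b → a ∉ V → a ∉ H → (∀ u, G.Adj a u → u = a ∨ u = b ∨ u ∈ V) →
      ∀ i, Vanishes K {F | F ∈ indepAway G V ∧ H ⊆ F ∧ b ∉ F} i := by
    intro a b hab haV haH hadj
    refine vanishes_of_toggle a fun F haF => ?_
    simp only [indepAway, Set.mem_ofPred_eq]
    constructor
    · rintro ⟨⟨h1, h2⟩, h3, h4⟩
      refine ⟨⟨not_hasEdge_insert h1 fun u hu hau => ?_, ?_⟩, h3.trans (Finset.subset_insert _ _),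
        ?_⟩
      · rcases hadj u hau with rfl | rfl | h5
        · exact haF hu
        · exact h4 hu
        · exact Finset.disjoint_left.1 h2 hu h5
      · exact Finset.disjoint_insert_left.2 ⟨haV, h2⟩
      · simp [hab.symm, h4]
    · rintro ⟨⟨h1, h2⟩, h3, h4⟩
      have h5 := Finset.subset_insert a F
      exact ⟨⟨not_hasEdge_mono h5 h1, h2.mono_left h5⟩,
        (Finset.subset_insert_iff_of_notMem haH).1 h3,
        fun h6 => h4 (h5 h6)⟩
  have hNV : ∀ u, G.Adj x u ∨ G.Adj y u → u = x ∨ u = y ∨ u ∈ V := by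
    intro u hu
    have := hN u hu
    simp only [V, Finset.mem_erase]
    tauto
  have k1 := key x y hxy.ne hxV hxH fun u hu => hNV u (Or.inl hu)
  have k2 := key y x hxy.ne' hyV hyH fun u hu => by
    have := hNV u (Or.inr hu)
    tauto
  -- The sets without y form a cone, so those with y inherit the vanishing of the star in degree i +
  -- 1. As these contain y they avoid x, and removing them from the cone of sets avoiding x leaves
  -- the desired family in degree i.
  have v2 : Vanishes K {F | F ∈ indepAway G V ∧ H ⊆ F ∧ y ∈ F} (i + 1) := by
    refine IsSplit.vanishes_right (Q := {F | F ∈ indepAway G V ∧ H ⊆ F})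
      ⟨ordConnected_star hlow H, ?_, ?_, ?_⟩ (hb H (i + 1) (by omega)) (k1 _)
    · ext F
      simp only [Set.mem_union, Set.mem_ofPred_eq]
      tauto
    · rw [Set.disjoint_left]
      exact fun F h1 h2 => h1.2.2 h2.2.2
    · exact fun F h1 F' h2 h3 => ⟨h2.1, h2.2, h3 h1.2.2⟩
  refine IsSplit.vanishes_left (Q := {F | F ∈ indepAway G V ∧ H ⊆ F ∧ x ∉ F}) ⟨?_, ?_, ?_, ?_⟩
    (k2 i) v2
  · convert ordConnected_star (𝒜 := {F | F ∈ indepAway G V ∧ x ∉ F})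
      (fun _ _ h1 h2 => ⟨hlow h1 h2.1, fun h3 => h2.2 (h1 h3)⟩) H using 1
    ext F
    simp only [Set.mem_ofPred_eq]
    tauto
  · have hd : ∀ F : Finset (Fin n), Disjoint F W' ↔ Disjoint F V ∧ x ∉ F ∧ y ∉ F := by
      intro F
      have : W' = insert x (insert y V) := by
        ext u
        simp only [V, Finset.mem_insert, Finset.mem_erase]
        by_cases h1 : u = x <;> by_cases h2 : u = y <;> simp_all
      rw [this, Finset.disjoint_insert_right, Finset.disjoint_insert_right]
      tauto
    have he : ∀ F : Finset (Fin n), ¬ HasEdge G F → y ∈ F → x ∉ F :=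
      fun F h1 h2 h3 => h1 ⟨x, h3, y, h2, hxy⟩
    ext F
    have := he F
    simp only [Set.mem_union, Set.mem_ofPred_eq, indepAway, hd]
    tauto
  · rw [Set.disjoint_left]
    exact fun F h1 h2 => Finset.disjoint_left.1 h1.1.2 h2.2.2 hyW
  · exact fun F h1 F' h2 h3 => ⟨h2.1, h2.2.1, h3 h1.2.2⟩

end Bounds

/-! ### Independent sets with prescribed met slots: Mayer–Vietoris, cones, avoidance -/

section Units

variable {n : ℕ} {K : Type*} [Field K] {ι : Type*}

/-- The independent sets containing `H` for which the set of units met satisfies `Ψ`. -/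
def fam (G : SimpleGraph (Fin n)) (β : ι → Fin n) (H : Finset (Fin n))
    (Ψ : (ι → Prop) → Prop) : Set (Finset (Fin n)) :=
  {F | ¬ HasEdge G F ∧ H ⊆ F ∧ Ψ (Meets G β F)}

/-- `Ψ` is inherited by subsets. -/
def Lower (Ψ : (ι → Prop) → Prop) : Prop := ∀ m m' : ι → Prop, (∀ i, m i → m' i) → Ψ m' → Ψ m

variable {G : SimpleGraph (Fin n)} {β : ι → Fin n} {H : Finset (Fin n)}

theorem meets_mono {F F' : Finset (Fin n)} (h : F ⊆ F') (i : ι) (hi : Meets G β F i) :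
    Meets G β F' i := by
  obtain ⟨u, hu, hiu⟩ := hi
  exact ⟨u, h hu, hiu⟩

theorem ordConnected_fam {Ψ : (ι → Prop) → Prop} (h : Lower Ψ) :
    (fam G β H Ψ).OrdConnected := by
  refine ⟨fun F hF F' hF' E hE => ⟨not_hasEdge_mono hE.2 hF'.1, hF.2.1.trans hE.1,
    h _ _ (meets_mono hE.2) hF'.2.2⟩⟩

/-- The Mayer–Vietoris principle. -/
theorem vanishes_fam_or {Ψ Ψ₁ Ψ₂ : (ι → Prop) → Prop} (h1 : Lower Ψ₁) (h2 : Lower Ψ₂)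
    (h : ∀ m, Ψ m ↔ Ψ₁ m ∨ Ψ₂ m) {i : ℤ} (v1 : Vanishes K (fam G β H Ψ₁) i)
    (v2 : Vanishes K (fam G β H Ψ₂) i)
    (v12 : Vanishes K (fam G β H fun m => Ψ₁ m ∧ Ψ₂ m) (i - 1)) :
    Vanishes K (fam G β H Ψ) i := by
  -- Excision: this difference is the complement both of the intersection in the second family and
  -- of the first family in the union.
  have v : Vanishes K (fam G β H fun m => Ψ₂ m ∧ ¬ Ψ₁ m) i := by
    refine IsSplit.vanishes_right ⟨ordConnected_fam h2, ?_, ?_, ?_⟩ v2 v12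
    · ext F
      simp only [fam, Set.mem_union, Set.mem_ofPred_eq]
      tauto
    · rw [Set.disjoint_left]
      exact fun F h3 h4 => h4.2.2.2 h3.2.2.1
    · exact fun F h3 F' h4 h5 => ⟨h4.1, h4.2.1, h4.2.2,
        fun h6 => h3.2.2.2 (h1 _ _ (meets_mono h5) h6)⟩
  refine IsSplit.vanishes ⟨ordConnected_fam ?_, ?_, ?_, ?_⟩ v1 v
  · intro m m' hm hm'
    rw [h] at hm' ⊢
    exact hm'.imp (h1 _ _ hm) (h2 _ _ hm)
  · ext F
    simp only [fam, Set.mem_union, Set.mem_ofPred_eq, h]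
    tauto
  · rw [Set.disjoint_left]
    exact fun F h3 h4 => h4.2.2.2 h3.2.2
  · refine fun F h3 F' h4 h5 => ⟨h4.1, h4.2.1, ?_⟩
    have h6 : ¬ Ψ₁ (Meets G β F') := fun h6 => h3.2.2.2 (h1 _ _ (meets_mono h5) h6)
    exact ⟨((h _).1 h4.2.2).resolve_left h6, h6⟩

/-- The family is a cone over the vertex of the unit `z`. -/
theorem vanishes_fam_cone {Ψ : (ι → Prop) → Prop} (hΨ : Lower Ψ) {z : ι} (hz : β z ∉ H)
    (h : ∀ m, Ψ m → ¬ m z ∧ Ψ fun i => m i ∨ (G.comap β).Adj z i) (i : ℤ) :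
    Vanishes K (fam G β H Ψ) i := by
  refine vanishes_of_toggle (β z) (fun F hF => ⟨?_, ?_⟩) i
  · rintro ⟨h1, h2, h3⟩
    obtain ⟨h4, h5⟩ := h _ h3
    refine ⟨not_hasEdge_insert h1 fun u hu hzu => h4 ⟨u, hu, hzu⟩,
      h2.trans (Finset.subset_insert _ _), hΨ _ _ ?_ h5⟩
    rintro j ⟨u, hu, hju⟩
    rcases Finset.mem_insert.1 hu with rfl | hu
    · exact Or.inr hju.symm
    · exact Or.inl ⟨u, hu, hju⟩
  · rintro ⟨h1, h2, h3⟩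
    have h5 := Finset.subset_insert (β z) F
    exact ⟨not_hasEdge_mono h5 h1, (Finset.subset_insert_iff_of_notMem hz).1 h2,
      hΨ _ _ (meets_mono h5) h3⟩

theorem vanishes_fam_congr {Ψ Ψ' : (ι → Prop) → Prop} {i : ℤ} (h : ∀ m, Ψ m ↔ Ψ' m)
    (v : Vanishes K (fam G β H Ψ') i) : Vanishes K (fam G β H Ψ) i := by
  have : Ψ = Ψ' := funext fun m => propext (h m)
  rwa [this]

open Classical in
/-- The neighbours of the units in `A`. -/
def nbrs (G : SimpleGraph (Fin n)) (β : ι → Fin n) (A : Set ι) : Finset (Fin n) :=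
  Finset.univ.filter fun u => ∃ i ∈ A, G.Adj (β i) u

theorem fam_avoid (A : Set ι) : fam G β H (fun m => ∀ i ∈ A, ¬ m i) =
    {F | F ∈ indepAway G (nbrs G β A) ∧ H ⊆ F} := by
  ext F
  simp only [fam, indepAway, nbrs, Set.mem_ofPred_eq, Meets, Finset.disjoint_left,
    Finset.mem_filter, Finset.mem_univ, true_and]
  constructor
  · rintro ⟨h1, h2, h3⟩
    exact ⟨⟨h1, fun u hu ⟨i, hi, hiu⟩ => h3 i hi ⟨u, hu, hiu⟩⟩, h2⟩
  · rintro ⟨⟨h1, h3⟩, h2⟩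
    exact ⟨h1, h2, fun i hi ⟨u, hu, hiu⟩ => h3 hu ⟨i, hi, hiu⟩⟩

/-- Meeting no slot of A means avoiding all neighbours of A, and deleting vertices preserves the
bound. -/
theorem vanishes_avoid {ρ : ℤ} (h : Bounded K (indepAway G ∅) ρ) (A : Set ι) {i : ℤ}
    (hi : ρ ≤ i - H.card) : Vanishes K (fam G β H fun m => ∀ i ∈ A, ¬ m i) i := by
  rw [fam_avoid]
  exact h.mono_away (Finset.empty_subset _) H i hi

theorem mem_nbrs {A : Set ι} {u : Fin n} : u ∈ nbrs G β A ↔ ∃ i ∈ A, G.Adj (β i) u := by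
  simp [nbrs]

theorem nbrs_mono {A B : Set ι} (h : A ⊆ B) : nbrs G β A ⊆ nbrs G β B := fun _ hu =>
  let ⟨i, hi, hiu⟩ := mem_nbrs.1 hu
  mem_nbrs.2 ⟨i, h hi, hiu⟩

theorem bounded_edge {ρ : ℤ} (h : Bounded K (indepAway G ∅) ρ) {A : Set ι} {x y : ι}
    (hxy : (G.comap β).Adj x y) (hx : x ∈ A) (hy : y ∈ A) :
    Bounded K (indepAway G (nbrs G β A)) (ρ - 1) :=
  h.edge (x := β x) (y := β y) hxy (by simp) (by simp) (Finset.empty_subset _)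
    fun _ hu => mem_nbrs.2 (hu.elim (fun h' => ⟨x, hx, h'⟩) fun h' => ⟨y, hy, h'⟩)

/-- The neighbours of A include the closed neighbourhood of the edge xy, so one degree is gained. -/
theorem vanishes_avoid_edge {ρ : ℤ} (h : Bounded K (indepAway G ∅) ρ) (A : Set ι) {x y : ι}
    (hxy : (G.comap β).Adj x y) (hx : x ∈ A) (hy : y ∈ A) {i : ℤ}
    (hi : ρ ≤ i + 1 - H.card) : Vanishes K (fam G β H fun m => ∀ i ∈ A, ¬ m i) i := by
  rw [fam_avoid]
  exact bounded_edge h hxy hx hy H i (by omega)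

/-- The absence of edges between xy and zw lets zw survive the deletion of the neighbours of x and
y, so `Bounded.edge` applies a second time. -/
theorem vanishes_avoid_two_edges {ρ : ℤ} (h : Bounded K (indepAway G ∅) ρ) (A : Set ι)
    {x y z w : ι} (hxy : (G.comap β).Adj x y) (hzw : (G.comap β).Adj z w)
    (hxz : ¬ (G.comap β).Adj x z) (hxw : ¬ (G.comap β).Adj x w) (hyz : ¬ (G.comap β).Adj y z)
    (hyw : ¬ (G.comap β).Adj y w) (hx : x ∈ A) (hy : y ∈ A) (hz : z ∈ A) (hw : w ∈ A) {i : ℤ}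
    (hi : ρ ≤ i + 2 - H.card) : Vanishes K (fam G β H fun m => ∀ i ∈ A, ¬ m i) i := by
  rw [fam_avoid]
  have h1 : Bounded K (indepAway G (nbrs G β A)) (ρ - 1 - 1) := by
    refine (bounded_edge h hxy (A := {x, y}) (by simp) (by simp)).edge (x := β z) (y := β w) hzw
      ?_ ?_ (nbrs_mono ?_) ?_
    · rw [mem_nbrs]
      rintro ⟨_, rfl | rfl, h'⟩
      exacts [hxz h', hyz h']
    · rw [mem_nbrs]
      rintro ⟨_, rfl | rfl, h'⟩
      exacts [hxw h', hyw h']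
    · rintro _ (rfl | rfl)
      exacts [hx, hy]
    · exact fun _ hu => mem_nbrs.2 (hu.elim (fun h' => ⟨z, hz, h'⟩) fun h' => ⟨w, hw, h'⟩)
  exact h1 H i (by omega)

end Units

/-! ### Combinatorics of disjoint pieces -/

section ReachLemmas

variable {ι : Type*} {D : SimpleGraph ι} {m : ι → Prop}

theorem lower_not_reach2 : Lower fun m => ¬ Reach2 D m := by
  intro m m' h h'
  unfold Reach2 at *
  grind

theorem lower_not_reach3 : Lower fun m => ¬ Reach3 D m := by
  intro m m' h h'
  unfold Reach3 at *
  grind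

/-- A piece that uses the newly met neighbour p of z can be replaced by the edge zp: z is not met
and p is its only neighbour, so no other piece uses z. -/
theorem reach2_leaf {z : ι} (hz : ∀ p q, D.Adj z p → D.Adj z q → p = q) (hm : ¬ m z)
    (h : Reach2 D fun i => m i ∨ D.Adj z i) : Reach2 D m := by
  have hs : ∀ a b, D.Adj a b → D.Adj b a := fun _ _ h => h.symm
  have hi : ∀ a, ¬ D.Adj a a := fun a h => h.ne rfl
  simp only [Reach2, List.nodup_cons, List.mem_cons, List.not_mem_nil, not_or, or_false,
    List.nodup_nil, not_false_eq_true, and_true] at *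
  rcases h with ⟨i, j, h⟩ | ⟨i, k, l, h⟩ | ⟨i, j, k, l, h⟩ <;> grind

theorem reach3_leaf {z : ι} (hz : ∀ p q, D.Adj z p → D.Adj z q → p = q) (hm : ¬ m z)
    (h : Reach3 D fun i => m i ∨ D.Adj z i) : Reach3 D m := by
  have hs : ∀ a b, D.Adj a b → D.Adj b a := fun _ _ h => h.symm
  have hi : ∀ a, ¬ D.Adj a a := fun a h => h.ne rfl
  simp only [Reach3, List.nodup_cons, List.mem_cons, List.not_mem_nil, not_or, or_false,
    List.nodup_nil, not_false_eq_true, and_true] at *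
  rcases h with ⟨i, j, k, h⟩ | ⟨i, j, k, l, h⟩ | ⟨i, j, k, l, p, h⟩ | ⟨i, j, k, l, p, q, h⟩ <;>
    grind

/-- Every piece contains p or q, so at most two pieces are disjoint. -/
theorem not_reach3_of_cover {p q : ι} (hD : ∀ a b, D.Adj a b → a = p ∨ a = q ∨ b = p ∨ b = q)
    (hm : ∀ i, m i → i = p ∨ i = q) : ¬ Reach3 D m := by
  intro h
  simp only [Reach3, List.nodup_cons, List.mem_cons, List.not_mem_nil, not_or, or_false,
    List.nodup_nil, not_false_eq_true, and_true] at *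
  rcases h with ⟨i, j, k, h⟩ | ⟨i, j, k, l, h⟩ | ⟨i, j, k, l, p, h⟩ | ⟨i, j, k, l, p, q, h⟩ <;>
    grind

theorem not_five_units {a b c d : ι} (hu : ∀ i, i = a ∨ i = b ∨ i = c ∨ i = d)
    {i j k l p : ι} (hN : [i, j, k, l, p].Nodup) : False := by
  have h : [i, j, k, l, p] ⊆ [a, b, c, d] := fun x _ => by simpa using hu x
  simpa using (List.subperm_of_subset hN h).length_le

/-- Four slots hold three pieces as two met slots and a disjoint edge, or as three met slots; three
of the four contain {a, b} or {c, d}, which reduces the latter to the former. -/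
theorem not_reach3_four {a b c d : ι} (hN : [a, b, c, d].Nodup)
    (hu : ∀ i, i = a ∨ i = b ∨ i = c ∨ i = d) (hab : D.Adj a b) (hcd : D.Adj c d) :
    ¬ Reach3 D m ↔ ¬ (m a ∧ m b) ∧ ¬ (m c ∧ m d) ∧ (D.Adj a c → ¬ (m b ∧ m d)) ∧
      (D.Adj b d → ¬ (m a ∧ m c)) ∧ (D.Adj a d → ¬ (m b ∧ m c)) ∧
      (D.Adj b c → ¬ (m a ∧ m d)) := by
  have hs : ∀ a b, D.Adj a b → D.Adj b a := fun _ _ h => h.symm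
  have hi : ∀ a, ¬ D.Adj a a := fun a h => h.ne rfl
  constructor
  · simp only [Reach3, List.nodup_cons, List.mem_cons, List.not_mem_nil, not_or, or_false,
      List.nodup_nil, not_false_eq_true, and_true] at *
    grind
  · intro h h'
    simp only [Reach3, List.nodup_cons, List.mem_cons, List.not_mem_nil, not_or, or_false,
      List.nodup_nil, not_false_eq_true, and_true] at *
    rcases h' with ⟨i, j, k, h'⟩ | ⟨i, j, k, l, h'⟩ | ⟨i, j, k, l, p, h'⟩ |
      ⟨i, j, k, l, p, q, h'⟩
    · have := hu i; have := hu j; have := hu k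
      grind
    · have := hu i; have := hu j; have := hu k; have := hu l
      grind
    · exact not_five_units hu (i := i) (j := j) (k := k) (l := l) (p := p) (by simp; tauto)
    · exact not_five_units hu (i := i) (j := j) (k := k) (l := l) (p := p) (by simp; tauto)

theorem reach3_of_unit {i k l p q : ι} (hN : [i, k, l, p, q].Nodup) (hi : m i)
    (hkl : D.Adj k l) (hpq : D.Adj p q) : Reach3 D m :=
  Or.inr (Or.inr (Or.inl ⟨i, k, l, p, q, hN, hi, hkl, hpq⟩))

theorem reach3_of_units {i j k l : ι} (hN : [i, j, k, l].Nodup) (hi : m i) (hj : m j)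
    (hkl : D.Adj k l) : Reach3 D m :=
  Or.inr (Or.inl ⟨i, j, k, l, hN, hi, hj, hkl⟩)

/-- The graph has three disjoint edges. -/
theorem reach3_of_edges {i j k l p q : ι} (hN : [i, j, k, l, p, q].Nodup)
    (hij : D.Adj i j) (hkl : D.Adj k l) (hpq : D.Adj p q) : Reach3 D m :=
  Or.inr (Or.inr (Or.inr ⟨i, j, k, l, p, q, hN, hij, hkl, hpq⟩))

end ReachLemmas

/-! ### Cones over leaves of the slot graph -/

section Cones

variable {n : ℕ} {K : Type*} [Field K] {ι : Type*}

/-- No unit in `A` is met. -/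
abbrev Avoid (A : Set ι) (m : ι → Prop) : Prop := ∀ i ∈ A, ¬ m i

theorem lower_avoid (A : Set ι) : Lower (Avoid A) := fun _ _ h h' i hi hm => h' i hi (h i hm)

theorem Lower.and {Ψ₁ Ψ₂ : (ι → Prop) → Prop} (h1 : Lower Ψ₁) (h2 : Lower Ψ₂) :
    Lower fun m => Ψ₁ m ∧ Ψ₂ m := fun m m' h h' => ⟨h1 m m' h h'.1, h2 m m' h h'.2⟩

theorem Lower.or {Ψ₁ Ψ₂ : (ι → Prop) → Prop} (h1 : Lower Ψ₁) (h2 : Lower Ψ₂) :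
    Lower fun m => Ψ₁ m ∨ Ψ₂ m := fun m m' h h' => h'.imp (h1 m m' h) (h2 m m' h)

theorem lower_not_both (c d : ι) : Lower fun m => ¬ (m c ∧ m d) :=
  fun _ _ h h' h'' => h' ⟨h c h''.1, h d h''.2⟩

variable {G : SimpleGraph (Fin n)} {β : ι → Fin n} {H : Finset (Fin n)}

theorem vanishes_fam_of_false {Ψ : (ι → Prop) → Prop} (h : ∀ m, ¬ Ψ m) (i : ℤ) :
    Vanishes K (fam G β H Ψ) i := by
  convert vanishes_empty (K := K) i using 1
  ext F
  simp only [fam, Set.mem_ofPred_eq, Set.mem_empty_iff_false, iff_false]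
  exact fun h' => h _ h'.2.2

theorem vanishes_avoid_cone {A : Set ι} {z : ι} (hzH : β z ∉ H) (hz : z ∈ A)
    (hA : ∀ w ∈ A, ¬ (G.comap β).Adj z w) (i : ℤ) : Vanishes K (fam G β H (Avoid A)) i :=
  vanishes_fam_cone (lower_avoid A) hzH
    (fun _ h => ⟨h z hz, fun w hw h' => h'.elim (h w hw) (hA w hw)⟩) i

theorem vanishes_leaf {A : Set ι} {z : ι} (hzH : β z ∉ H) (hz : z ∈ A)
    (hA : ∀ w ∈ A, ¬ (G.comap β).Adj z w)
    (hleaf : ∀ p q, (G.comap β).Adj z p → (G.comap β).Adj z q → p = q) (i : ℤ) :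
    Vanishes K (fam G β H fun m => ¬ Reach3 (G.comap β) m ∧ Avoid A m) i :=
  vanishes_fam_cone (lower_not_reach3.and (lower_avoid A)) hzH
    (fun _ h => ⟨h.2 z hz, fun h' => h.1 (reach3_leaf hleaf (h.2 z hz) h'),
      fun w hw h' => h'.elim (h.2 w hw) (hA w hw)⟩) i

/-- If two units of degree at most one cannot be met together, there is no cohomology. -/
theorem vanishes_two_leaves {z w : ι} (hβ : ∀ i, β i ∉ H) (hzw : ¬ (G.comap β).Adj z w)
    (hz : ∀ p q, (G.comap β).Adj z p → (G.comap β).Adj z q → p = q)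
    (hw : ∀ p q, (G.comap β).Adj w p → (G.comap β).Adj w q → p = q)
    (h : ∀ m : ι → Prop, m z → m w → Reach3 (G.comap β) m) (i : ℤ) :
    Vanishes K (fam G β H fun m => ¬ Reach3 (G.comap β) m) i := by
  refine vanishes_fam_or (Ψ₁ := fun m => ¬ Reach3 (G.comap β) m ∧ Avoid {z} m)
    (Ψ₂ := fun m => ¬ Reach3 (G.comap β) m ∧ Avoid {w} m)
    (lower_not_reach3.and (lower_avoid _)) (lower_not_reach3.and (lower_avoid _)) (fun m => ?_)
    (vanishes_leaf (A := {z}) (z := z) (hβ z) (Set.mem_singleton z) (by simp) hz i)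
    (vanishes_leaf (A := {w}) (z := w) (hβ w) (Set.mem_singleton w) (by simp) hw i)
    -- Since z and w are not adjacent, meeting the neighbours of z does not meet w, so the
    -- intersection is a cone over z as well.
    (vanishes_fam_congr (Ψ' := fun m => ¬ Reach3 (G.comap β) m ∧ Avoid {z, w} m) (fun m => ?_)
      (vanishes_leaf (z := z) (hβ z) (by simp) (by simpa using hzw) hz _))
  · have := h m
    simp only [Avoid, Set.mem_singleton_iff, forall_eq]
    tauto
  · simp only [Avoid, Set.mem_singleton_iff, Set.mem_insert_iff, forall_eq_or_imp, forall_eq]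
    tauto

end Cones

/-! ### Three pieces from four slots with a perfect matching -/

section FourUnits

variable {n : ℕ} {K : Type*} [Field K] {ι : Type*}
  {G : SimpleGraph (Fin n)} {β : ι → Fin n} {H : Finset (Fin n)} {ρ i : ℤ} {a b c d : ι}

/-- The condition is that neither edge has both ends met. Two rounds of Mayer–Vietoris involve only
cones, down to the family meeting no slot two degrees lower, where both edges gain. -/
theorem vanishes_two_disjoint_edges (hβ : ∀ i, β i ∉ H) (hb : Bounded K (indepAway G ∅) ρ)
    (hi : ρ ≤ i - H.card) (hN : [a, b, c, d].Nodup) (hu : ∀ i, i = a ∨ i = b ∨ i = c ∨ i = d)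
    (hab : (G.comap β).Adj a b) (hcd : (G.comap β).Adj c d) (hac : ¬ (G.comap β).Adj a c)
    (had : ¬ (G.comap β).Adj a d) (hbc : ¬ (G.comap β).Adj b c) (hbd : ¬ (G.comap β).Adj b d) :
    Vanishes K (fam G β H fun m => ¬ Reach3 (G.comap β) m) i := by
  have hs : ∀ a b, (G.comap β).Adj a b → (G.comap β).Adj b a := fun _ _ h => h.symm
  refine vanishes_fam_or (Ψ₁ := fun m => Avoid {a} m ∧ ¬ (m c ∧ m d))
    (Ψ₂ := fun m => Avoid {b} m ∧ ¬ (m c ∧ m d)) ((lower_avoid _).and (lower_not_both _ _))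
    ((lower_avoid _).and (lower_not_both _ _)) (fun m => ?_) ?_ ?_ ?_
  · rw [not_reach3_four hN hu hab hcd]
    simp only [Avoid, Set.mem_singleton_iff, forall_eq,
      hac, had, hbc, hbd, false_imp_iff, and_true]
    grind only
  · refine vanishes_fam_cone ((lower_avoid _).and (lower_not_both _ _)) (hβ a) (fun m hm => ?_) i
    simp only [Avoid, Set.mem_singleton_iff, forall_eq, SimpleGraph.irrefl] at hm ⊢
    tauto
  · refine vanishes_fam_cone ((lower_avoid _).and (lower_not_both _ _)) (hβ b) (fun m hm => ?_) i
    simp only [Avoid, Set.mem_singleton_iff, forall_eq, SimpleGraph.irrefl] at hm ⊢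
    tauto
  · refine vanishes_fam_or (Ψ₁ := Avoid {a, b, c}) (Ψ₂ := Avoid {a, b, d}) (lower_avoid _)
      (lower_avoid _) (fun m => ?_) (vanishes_avoid_cone (z := c) (hβ c) (by simp) ?_ _)
      (vanishes_avoid_cone (z := d) (hβ d) (by simp) ?_ _) (vanishes_fam_congr
        (Ψ' := Avoid {a, b, c, d}) (fun m => ?_) (vanishes_avoid_two_edges hb _ hab hcd hac had hbc
        hbd (by simp) (by simp) (by simp) (by simp) (by omega)))
    · simp only [Avoid, Set.mem_singleton_iff, Set.mem_insert_iff, forall_eq_or_imp, forall_eq]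
      tauto
    · simp only [Set.mem_singleton_iff, Set.mem_insert_iff, forall_eq_or_imp, forall_eq,
        SimpleGraph.irrefl, not_false_eq_true, and_true]
      exact ⟨fun h => hac h.symm, fun h => hbc h.symm⟩
    · simp only [Set.mem_singleton_iff, Set.mem_insert_iff, forall_eq_or_imp, forall_eq,
        SimpleGraph.irrefl, not_false_eq_true, and_true]
      exact ⟨fun h => had h.symm, fun h => hbd h.symm⟩
    · simp only [Avoid, Set.mem_singleton_iff, Set.mem_insert_iff, forall_eq_or_imp, forall_eq]
      tauto

/-- On the path a–b–c–d both families in the cover are cones, over a and over b; the intersection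
avoids the edge ab. -/
theorem vanishes_path (hβ : ∀ i, β i ∉ H) (hb : Bounded K (indepAway G ∅) ρ)
    (hi : ρ ≤ i - H.card) (hN : [a, b, c, d].Nodup) (hu : ∀ i, i = a ∨ i = b ∨ i = c ∨ i = d)
    (hab : (G.comap β).Adj a b) (hcd : (G.comap β).Adj c d) (hac : ¬ (G.comap β).Adj a c)
    (had : ¬ (G.comap β).Adj a d) (hbc : (G.comap β).Adj b c) (hbd : ¬ (G.comap β).Adj b d) :
    Vanishes K (fam G β H fun m => ¬ Reach3 (G.comap β) m) i := by
  refine vanishes_fam_or (Ψ₁ := fun m => Avoid {a} m ∧ ¬ (m c ∧ m d))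
    (Ψ₂ := Avoid {b, d}) ((lower_avoid _).and (lower_not_both _ _)) (lower_avoid _)
    (fun m => ?_) ?_ (vanishes_avoid_cone (z := b) (hβ b) (by simp) (by simpa using hbd) i)
    (vanishes_fam_congr (Ψ' := Avoid {a, b, d}) (fun m => ?_) (vanishes_avoid_edge hb _ hab
      (by simp) (by simp) (by omega)))
  · rw [not_reach3_four hN hu hab hcd]
    simp only [Avoid, Set.mem_singleton_iff, Set.mem_insert_iff, forall_eq_or_imp, forall_eq,
      hac, had, hbc, hbd, true_imp_iff, false_imp_iff, true_and]
    grind only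
  · refine vanishes_fam_cone ((lower_avoid _).and (lower_not_both _ _)) (hβ a) (fun m hm => ?_) i
    simp only [Avoid, Set.mem_singleton_iff, forall_eq, SimpleGraph.irrefl] at hm ⊢
    tauto
  · simp only [Avoid, Set.mem_singleton_iff, Set.mem_insert_iff, forall_eq_or_imp, forall_eq]
    tauto

/-- The met slots must lie in one of the two diagonals, and either choice gives a cone. -/
theorem vanishes_square (hβ : ∀ i, β i ∉ H) (hb : Bounded K (indepAway G ∅) ρ)
    (hi : ρ ≤ i - H.card) (hN : [a, b, c, d].Nodup) (hu : ∀ i, i = a ∨ i = b ∨ i = c ∨ i = d)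
    (hab : (G.comap β).Adj a b) (hcd : (G.comap β).Adj c d) (hac : ¬ (G.comap β).Adj a c)
    (had : (G.comap β).Adj a d) (hbc : (G.comap β).Adj b c) (hbd : ¬ (G.comap β).Adj b d) :
    Vanishes K (fam G β H fun m => ¬ Reach3 (G.comap β) m) i := by
  refine vanishes_fam_or (Ψ₁ := Avoid {a, c}) (Ψ₂ := Avoid {b, d}) (lower_avoid _) (lower_avoid _)
    (fun m => ?_) (vanishes_avoid_cone (z := a) (hβ a) (by simp) (by simpa using hac) i)
    (vanishes_avoid_cone (z := b) (hβ b) (by simp) (by simpa using hbd) i)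
    (vanishes_fam_congr (Ψ' := Avoid {a, b, c, d}) (fun m => ?_) (vanishes_avoid_edge hb _ hab
      (by simp) (by simp) (by omega)))
  · rw [not_reach3_four hN hu hab hcd]
    simp only [Avoid, Set.mem_singleton_iff, Set.mem_insert_iff, forall_eq_or_imp, forall_eq,
      hac, had, hbc, hbd, true_imp_iff, false_imp_iff, true_and]
    grind only
  · simp only [Avoid, Set.mem_singleton_iff, Set.mem_insert_iff, forall_eq_or_imp, forall_eq]
    tauto

/-- Either the pendant slot b is unmet, giving a cone over b, or the whole triangle acd is unmet,
giving a gain from its edges. -/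
theorem vanishes_paw (hβ : ∀ i, β i ∉ H) (hb : Bounded K (indepAway G ∅) ρ)
    (hi : ρ ≤ i - H.card) (hN : [a, b, c, d].Nodup) (hu : ∀ i, i = a ∨ i = b ∨ i = c ∨ i = d)
    (hab : (G.comap β).Adj a b) (hcd : (G.comap β).Adj c d) (hac : (G.comap β).Adj a c)
    (had : (G.comap β).Adj a d) (hbc : ¬ (G.comap β).Adj b c) (hbd : ¬ (G.comap β).Adj b d) :
    Vanishes K (fam G β H fun m => ¬ Reach3 (G.comap β) m) i := by
  refine vanishes_fam_or (Ψ₁ := fun m => Avoid {b} m ∧ ¬ (m c ∧ m d))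
    (Ψ₂ := Avoid {a, c, d}) ((lower_avoid _).and (lower_not_both _ _)) (lower_avoid _)
    (fun m => ?_) ?_ (vanishes_avoid_edge hb _ hac (by simp) (by simp) (by omega))
    (vanishes_fam_congr (Ψ' := Avoid {a, b, c, d}) (fun m => ?_) (vanishes_avoid_edge hb _ hab
      (by simp) (by simp) (by omega)))
  · rw [not_reach3_four hN hu hab hcd]
    simp only [Avoid, Set.mem_singleton_iff, Set.mem_insert_iff, forall_eq_or_imp, forall_eq,
      hac, had, hbc, hbd, true_imp_iff, false_imp_iff, and_true, true_and]
    grind only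
  · refine vanishes_fam_cone ((lower_avoid _).and (lower_not_both _ _)) (hβ b) (fun m hm => ?_) i
    simp only [Avoid, Set.mem_singleton_iff, forall_eq, SimpleGraph.irrefl] at hm ⊢
    tauto
  · simp only [Avoid, Set.mem_singleton_iff, Set.mem_insert_iff, forall_eq_or_imp, forall_eq]
    tauto

/-- Two slots can be met together only if they are a and c, the ends of the diagonal. The family
allowing this pair is a cone over b; the others have at most one slot met and avoid an edge. -/
theorem vanishes_diamond (hβ : ∀ i, β i ∉ H) (hb : Bounded K (indepAway G ∅) ρ)
    (hi : ρ ≤ i - H.card) (hN : [a, b, c, d].Nodup) (hu : ∀ i, i = a ∨ i = b ∨ i = c ∨ i = d)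
    (hab : (G.comap β).Adj a b) (hcd : (G.comap β).Adj c d) (hac : (G.comap β).Adj a c)
    (had : (G.comap β).Adj a d) (hbc : (G.comap β).Adj b c) (hbd : ¬ (G.comap β).Adj b d) :
    Vanishes K (fam G β H fun m => ¬ Reach3 (G.comap β) m) i := by
  have hall : ∀ {Ψ : (ι → Prop) → Prop}, (∀ m, Ψ m ↔ ¬ m a ∧ ¬ m b ∧ ¬ m c ∧ ¬ m d) →
      Vanishes K (fam G β H Ψ) (i - 1) := fun h =>
    vanishes_fam_congr (Ψ' := Avoid {a, b, c, d}) (fun m => by rw [h m]; simp [Avoid])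
      (vanishes_avoid_edge hb _ hab (by simp) (by simp) (by omega))
  refine vanishes_fam_or (Ψ₁ := Avoid {b, d})
    (Ψ₂ := fun m => Avoid {a, b, c} m ∨ Avoid {a, c, d} m) (lower_avoid _)
    ((lower_avoid _).or (lower_avoid _)) (fun m => ?_)
    (vanishes_avoid_cone (z := b) (hβ b) (by simp) (by simpa using hbd) i)
    (vanishes_fam_or (lower_avoid _) (lower_avoid _) (fun m => Iff.rfl)
      (vanishes_avoid_edge hb _ hac (by simp) (by simp) (by omega))
      (vanishes_avoid_edge hb _ hac (by simp) (by simp) (by omega)) (hall fun m => ?_))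
    (hall fun m => ?_)
  · rw [not_reach3_four hN hu hab hcd]
    simp only [Avoid, Set.mem_singleton_iff, Set.mem_insert_iff, forall_eq_or_imp, forall_eq,
      hac, had, hbc, hbd, true_imp_iff, false_imp_iff, true_and]
    grind only
  · simp only [Avoid, Set.mem_singleton_iff, Set.mem_insert_iff, forall_eq_or_imp, forall_eq]
    tauto
  · simp only [Avoid, Set.mem_singleton_iff, Set.mem_insert_iff, forall_eq_or_imp, forall_eq]
    tauto

/-- At most one slot may be met. The four families avoiding a triple each gain one degree, and all
their intersections avoid all four slots. -/
theorem vanishes_complete (hb : Bounded K (indepAway G ∅) ρ)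
    (hi : ρ ≤ i - H.card) (hN : [a, b, c, d].Nodup) (hu : ∀ i, i = a ∨ i = b ∨ i = c ∨ i = d)
    (hab : (G.comap β).Adj a b) (hcd : (G.comap β).Adj c d) (hac : (G.comap β).Adj a c)
    (had : (G.comap β).Adj a d) (hbc : (G.comap β).Adj b c) (hbd : (G.comap β).Adj b d) :
    Vanishes K (fam G β H fun m => ¬ Reach3 (G.comap β) m) i := by
  have hall : ∀ {Ψ : (ι → Prop) → Prop}, (∀ m, Ψ m ↔ ¬ m a ∧ ¬ m b ∧ ¬ m c ∧ ¬ m d) →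
      Vanishes K (fam G β H Ψ) (i - 1) := fun h =>
    vanishes_fam_congr (Ψ' := Avoid {a, b, c, d}) (fun m => by rw [h m]; simp [Avoid])
      (vanishes_avoid_edge hb _ hab (by simp) (by simp) (by omega))
  refine vanishes_fam_or (Ψ₁ := fun m => Avoid {a, b, c} m ∨ Avoid {a, b, d} m)
    (Ψ₂ := fun m => Avoid {a, c, d} m ∨ Avoid {b, c, d} m) ((lower_avoid _).or (lower_avoid _))
    ((lower_avoid _).or (lower_avoid _)) (fun m => ?_)
    (vanishes_fam_or (lower_avoid _) (lower_avoid _) (fun m => Iff.rfl)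
      (vanishes_avoid_edge hb _ hab (by simp) (by simp) (by omega))
      (vanishes_avoid_edge hb _ hab (by simp) (by simp) (by omega)) (hall fun m => ?_))
    (vanishes_fam_or (lower_avoid _) (lower_avoid _) (fun m => Iff.rfl)
      (vanishes_avoid_edge hb _ hcd (by simp) (by simp) (by omega))
      (vanishes_avoid_edge hb _ hcd (by simp) (by simp) (by omega)) (hall fun m => ?_))
    (hall fun m => ?_)
  · rw [not_reach3_four hN hu hab hcd]
    simp only [Avoid, Set.mem_singleton_iff, Set.mem_insert_iff, forall_eq_or_imp, forall_eq,
      hac, had, hbc, hbd, true_imp_iff]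
    grind only
  all_goals
    simp only [Avoid, Set.mem_singleton_iff, Set.mem_insert_iff, forall_eq_or_imp, forall_eq]
    tauto

theorem vanishes_four_units (hβ : ∀ i, β i ∉ H) (hb : Bounded K (indepAway G ∅) ρ)
    (hi : ρ ≤ i - H.card) (hN : [a, b, c, d].Nodup) (hu : ∀ i, i = a ∨ i = b ∨ i = c ∨ i = d)
    (hab : (G.comap β).Adj a b) (hcd : (G.comap β).Adj c d) :
    Vanishes K (fam G β H fun m => ¬ Reach3 (G.comap β) m) i := by
  have hba := hab.symm
  have hdc := hcd.symm
  have n1 : [b, a, c, d].Nodup := by simp at hN ⊢; tauto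
  have n2 : [a, b, d, c].Nodup := by simp at hN ⊢; tauto
  have n3 : [b, a, d, c].Nodup := by simp at hN ⊢; tauto
  have n4 : [c, d, a, b].Nodup := by simp at hN ⊢; tauto
  have n5 : [d, c, a, b].Nodup := by simp at hN ⊢; tauto
  have u1 : ∀ i, i = b ∨ i = a ∨ i = c ∨ i = d := fun i => by have := hu i; tauto
  have u2 : ∀ i, i = a ∨ i = b ∨ i = d ∨ i = c := fun i => by have := hu i; tauto
  have u3 : ∀ i, i = b ∨ i = a ∨ i = d ∨ i = c := fun i => by have := hu i; tauto
  have u4 : ∀ i, i = c ∨ i = d ∨ i = a ∨ i = b := fun i => by have := hu i; tauto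
  have u5 : ∀ i, i = d ∨ i = c ∨ i = a ∨ i = b := fun i => by have := hu i; tauto
  by_cases hac : (G.comap β).Adj a c <;> by_cases had : (G.comap β).Adj a d <;>
    by_cases hbc : (G.comap β).Adj b c <;> by_cases hbd : (G.comap β).Adj b d
  · exact vanishes_complete hb hi hN hu hab hcd hac had hbc hbd
  · exact vanishes_diamond hβ hb hi hN hu hab hcd hac had hbc hbd
  · exact vanishes_diamond hβ hb hi n2 u2 hab hdc had hac hbd hbc
  · exact vanishes_paw hβ hb hi hN hu hab hcd hac had hbc hbd
  · exact vanishes_diamond hβ hb hi n1 u1 hba hcd hbc hbd hac had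
  · exact vanishes_paw hβ hb hi n4 u4 hcd hab hac.symm hbc.symm (fun h => had h.symm)
      fun h => hbd h.symm
  · exact vanishes_square hβ hb hi n1 u1 hba hcd hbc hbd hac had
  · exact vanishes_path hβ hb hi n1 u1 hba hcd hbc hbd hac had
  · exact vanishes_diamond hβ hb hi n3 u3 hba hdc hbd hbc had hac
  · exact vanishes_square hβ hb hi hN hu hab hcd hac had hbc hbd
  · exact vanishes_paw hβ hb hi n5 u5 hdc hab had.symm hbd.symm (fun h => hac h.symm)
      fun h => hbc h.symm
  · exact vanishes_path hβ hb hi n3 u3 hba hdc hbd hbc had hac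
  · exact vanishes_paw hβ hb hi n1 u1 hba hcd hbc hbd hac had
  · exact vanishes_path hβ hb hi hN hu hab hcd hac had hbc hbd
  · exact vanishes_path hβ hb hi n2 u2 hab hdc had hac hbd hbc
  · exact vanishes_two_disjoint_edges hβ hb hi hN hu hab hcd hac had hbc hbd

end FourUnits

/-! ### Counting slots -/

section Fresh

variable {ι : Type*} [Fintype ι]

theorem card_le_of_forall_mem {L : List ι} (h : ∀ i, i ∈ L) : Fintype.card ι ≤ L.length := by
  classical
  calc Fintype.card ι ≤ L.toFinset.card :=
        Finset.card_le_card fun i _ => List.mem_toFinset.2 (h i)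
    _ ≤ _ := L.toFinset_card_le

theorem not_reach3_of_card_le_two {D : SimpleGraph ι} (h : Fintype.card ι ≤ 2) (m : ι → Prop) :
    ¬ Reach3 D m := by
  have h3 : ∀ i j k : ι, ¬ [i, j, k].Nodup := fun i j k h' => by
    have := h'.length_le_card
    simp at this
    omega
  simp only [List.nodup_cons, List.mem_cons, List.not_mem_nil, not_or, or_false,
    List.nodup_nil, not_false_eq_true, and_true] at h3
  rintro (⟨i, j, k, h', -⟩ | ⟨i, j, k, l, h', -⟩ | ⟨i, j, k, l, p, h', -⟩ |
    ⟨i, j, k, l, p, q, h', -⟩) <;>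
  simp only [List.nodup_cons, List.mem_cons, List.not_mem_nil, not_or, or_false,
    List.nodup_nil, not_false_eq_true, and_true] at h' <;>
  exact h3 i j k (by tauto)

end Fresh

/-! ### Critical slots and tight slot graphs -/

section Critical

variable {ι : Type*} {D : SimpleGraph ι} {m : ι → Prop}

/-- The graph has no three disjoint edges. -/
def NoThreeEdges (D : SimpleGraph ι) : Prop :=
  ∀ i j k l p q, [i, j, k, l, p, q].Nodup → D.Adj i j → D.Adj k l → ¬ D.Adj p q

/-- The graph with the unit `z` removed has two disjoint edges. -/
def Critical (D : SimpleGraph ι) (z : ι) : Prop :=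
  ∃ a b c d, [z, a, b, c, d].Nodup ∧ D.Adj a b ∧ D.Adj c d

/-- Meeting a critical slot completes three pieces; without three disjoint edges at least one met
slot is needed. -/
theorem not_reach3_iff_avoid (hT : NoThreeEdges D) (h : ∀ z, Critical D z) :
    ¬ Reach3 D m ↔ Avoid Set.univ m := by
  constructor
  · intro hm i _ hi
    obtain ⟨a, b, c, d, hN, h1, h2⟩ := h i
    exact hm (reach3_of_unit hN hi h1 h2)
  · rintro hm (⟨i, j, k, -, hi, -⟩ | ⟨i, j, k, l, -, hi, -⟩ | ⟨i, j, k, l, p, -, hi, -⟩ |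
      ⟨i, j, k, l, p, q, hN, h1, h2, h3⟩)
    · exact hm i trivial hi
    · exact hm i trivial hi
    · exact hm i trivial hi
    · exact hT _ _ _ _ _ _ hN h1 h2 h3

theorem critical_of_cycle {a b c d z : ι} (hN : [a, b, c, d, z].Nodup)
    (hu : ∀ i, i = a ∨ i = b ∨ i = c ∨ i = d ∨ i = z)
    (hab : D.Adj a b) (hcd : D.Adj c d) (hza : D.Adj z a) (hzc : D.Adj z c) (hbd : D.Adj b d)
    (i : ι) : Critical D i := by
  simp only [List.nodup_cons, List.mem_cons, List.not_mem_nil, not_or, or_false,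
    List.nodup_nil, not_false_eq_true, and_true] at hN
  rcases hu i with rfl | rfl | rfl | rfl | rfl
  · exact ⟨z, c, b, d, by simp; tauto, hzc, hbd⟩
  · exact ⟨z, a, c, d, by simp; tauto, hza, hcd⟩
  · exact ⟨z, a, b, d, by simp; tauto, hza, hbd⟩
  · exact ⟨a, b, z, c, by simp; tauto, hab, hzc⟩
  · exact ⟨a, b, c, d, by simp; tauto, hab, hcd⟩

/-- The units whose removal leaves two disjoint edges have degree at least two, and no such unit
has exactly two neighbours which cover all edges. -/
structure Tight (D : SimpleGraph ι) : Prop where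
  noThree : NoThreeEdges D
  two_le : ∀ z, Critical D z → ¬ ∀ p q, D.Adj z p → D.Adj z q → p = q
  cover : ∀ a b c d z, [a, b, c, d, z].Nodup → D.Adj a b → D.Adj c d → D.Adj z a → D.Adj z c →
    (∀ p, D.Adj z p → p = a ∨ p = c) → D.Adj b d

/-- All neighbours of z lie on the two edges, and there are at least two. Either z forms a triangle
with one edge, or it has exactly one neighbour on each, and the covering condition closes a
five-cycle. -/
theorem Tight.cases (h : Tight D) {a b c d z : ι} (hN : [a, b, c, d, z].Nodup)
    (hab : D.Adj a b) (hcd : D.Adj c d) : (D.Adj z a ∧ D.Adj z b) ∨ (D.Adj z c ∧ D.Adj z d) ∨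
      (D.Adj z a ∧ D.Adj z c ∧ D.Adj b d) ∨ (D.Adj z a ∧ D.Adj z d ∧ D.Adj b c) ∨
      (D.Adj z b ∧ D.Adj z c ∧ D.Adj a d) ∨ (D.Adj z b ∧ D.Adj z d ∧ D.Adj a c) := by
  have hN' : [z, a, b, c, d].Nodup := by
    simp only [List.nodup_cons, List.mem_cons, List.not_mem_nil, not_or, or_false,
      List.nodup_nil, not_false_eq_true, and_true] at hN ⊢
    tauto
  have hz := h.two_le z ⟨a, b, c, d, hN', hab, hcd⟩
  have hnb : ∀ u, D.Adj z u → u = a ∨ u = b ∨ u = c ∨ u = d := by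
    intro u hu
    by_contra! h'
    have := hu.ne'
    refine h.noThree a b c d z u ?_ hab hcd hu
    simp only [List.nodup_cons, List.mem_cons, List.not_mem_nil, not_or, or_false,
      List.nodup_nil, not_false_eq_true, and_true] at hN ⊢
    grind
  have n1 : [b, a, c, d, z].Nodup := by
    simp only [List.nodup_cons, List.mem_cons, List.not_mem_nil, not_or, or_false,
      List.nodup_nil, not_false_eq_true, and_true] at hN ⊢
    tauto
  have n2 : [a, b, d, c, z].Nodup := by
    simp only [List.nodup_cons, List.mem_cons, List.not_mem_nil, not_or, or_false,
      List.nodup_nil, not_false_eq_true, and_true] at hN ⊢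
    tauto
  have n3 : [b, a, d, c, z].Nodup := by
    simp only [List.nodup_cons, List.mem_cons, List.not_mem_nil, not_or, or_false,
      List.nodup_nil, not_false_eq_true, and_true] at hN ⊢
    tauto
  have c0 := h.cover a b c d z hN hab hcd
  have c1 := h.cover b a c d z n1 hab.symm hcd
  have c2 := h.cover a b d c z n2 hab hcd.symm
  have c3 := h.cover b a d c z n3 hab.symm hcd.symm
  by_cases ha : D.Adj z a <;> by_cases hb : D.Adj z b <;> by_cases hc : D.Adj z c <;>
    by_cases hd : D.Adj z d <;> grind

/-- A five-cycle is too large if there is one more unit. -/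
theorem Tight.not_cycle (h : Tight D) {a b c d z w : ι} (hN : [a, b, c, d, z, w].Nodup)
    (hab : D.Adj a b) (hcd : D.Adj c d) (hza : D.Adj z a) (hzc : D.Adj z c) : ¬ D.Adj b d := by
  intro hbd
  simp only [List.nodup_cons, List.mem_cons, List.not_mem_nil, not_or, or_false,
    List.nodup_nil, not_false_eq_true, and_true] at hN
  have hw := h.two_le w ⟨a, b, c, d, by simp; tauto, hab, hcd⟩
  have hT := h.noThree
  apply hw
  -- Deleting any vertex of a five-cycle leaves two disjoint edges, so an edge at w would be a
  -- third; yet w is critical and needs two neighbours.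
  intro u _ hu
  exfalso
  have hne := hu.ne'
  by_cases h1 : u = a
  · subst h1
    exact hT z c b d w u (by simp; tauto) hzc hbd hu
  by_cases h2 : u = b
  · subst h2
    exact hT z a c d w u (by simp; tauto) hza hcd hu
  by_cases h3 : u = c
  · subst h3
    exact hT z a b d w u (by simp; tauto) hza hbd hu
  by_cases h4 : u = d
  · subst h4
    exact hT a b z c w u (by simp; tauto) hab hzc hu
  · exact hT a b c d w u (by simp; tauto) hab hcd hu

end Critical

/-! ### Triangles in tight slot graphs -/

section Triangle

variable {ι : Type*} {D : SimpleGraph ι}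

/-- Only c is in doubt. The slot d is critical through xc and yt, so it has a neighbour besides c,
necessarily in the triangle; that edge and the rest of the triangle show that c is critical. -/
theorem Tight.critical_of_cross (h : Tight D) {x y t c d : ι} (hN : [x, y, t, c, d].Nodup)
    (hu : ∀ i, i = x ∨ i = y ∨ i = t ∨ i = c ∨ i = d) (hxy : D.Adj x y) (hxt : D.Adj x t)
    (hyt : D.Adj y t) (hcd : D.Adj c d) (hxc : D.Adj x c) (i : ι) : Critical D i := by
  simp only [List.nodup_cons, List.mem_cons, List.not_mem_nil, not_or, or_false,
    List.nodup_nil, not_false_eq_true, and_true] at hN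
  have hd : Critical D d := ⟨x, c, y, t, by simp; grind, hxc, hyt⟩
  rcases hu i with rfl | rfl | rfl | rfl | rfl
  · exact ⟨y, t, c, d, by simp; grind, hyt, hcd⟩
  · exact ⟨x, t, c, d, by simp; grind, hxt, hcd⟩
  · exact ⟨x, y, c, d, by simp; grind, hxy, hcd⟩
  · by_contra hi
    refine h.two_le d hd fun p q hp hq => ?_
    have key : ∀ p, D.Adj d p → p = i := by
      intro p hp
      rcases hu p with rfl | rfl | rfl | rfl | rfl
      · exact absurd ⟨d, p, y, t, by simp; grind, hp, hyt⟩ hi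
      · exact absurd ⟨d, p, x, t, by simp; grind, hp, hxt⟩ hi
      · exact absurd ⟨d, p, x, y, by simp; grind, hp, hxy⟩ hi
      · rfl
      · exact absurd rfl hp.ne
    rw [key p hp, key q hq]
  · exact hd

/-- Two disjoint triangles. -/
theorem Tight.triangles (h : Tight D) {a b c d z w : ι} (hN : [a, b, c, d, z, w].Nodup)
    (hab : D.Adj a b) (hcd : D.Adj c d) : (D.Adj z a ∧ D.Adj z b ∧ D.Adj w c ∧ D.Adj w d) ∨
      (D.Adj w a ∧ D.Adj w b ∧ D.Adj z c ∧ D.Adj z d) := by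
  simp only [List.nodup_cons, List.mem_cons, List.not_mem_nil, not_or, or_false,
    List.nodup_nil, not_false_eq_true, and_true] at hN
  have key : ∀ z w, [a, b, c, d, z, w].Nodup →
      (D.Adj z a ∧ D.Adj z b) ∨ (D.Adj z c ∧ D.Adj z d) := by
    intro z w hN'
    simp only [List.nodup_cons, List.mem_cons, List.not_mem_nil, not_or, or_false,
      List.nodup_nil, not_false_eq_true, and_true] at hN'
    rcases h.cases (a := a) (b := b) (c := c) (d := d) (z := z) (by simp; grind) hab hcd with
      h1 | h1 | ⟨h1, h2, h3⟩ | ⟨h1, h2, h3⟩ | ⟨h1, h2, h3⟩ | ⟨h1, h2, h3⟩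
    · exact Or.inl h1
    · exact Or.inr h1
    · exact absurd h3 (h.not_cycle (z := z) (w := w) (by simp; grind) hab hcd h1 h2)
    · exact absurd h3 (h.not_cycle (z := z) (w := w) (by simp; grind) hab hcd.symm h1 h2)
    · exact absurd h3 (h.not_cycle (z := z) (w := w) (by simp; grind) hab.symm hcd h1 h2)
    · exact absurd h3 (h.not_cycle (z := z) (w := w) (by simp; grind) hab.symm hcd.symm h1 h2)
  rcases key z w (by simp; grind) with ⟨h1, h2⟩ | ⟨h1, h2⟩ <;>
    rcases key w z (by simp; grind) with ⟨h3, h4⟩ | ⟨h3, h4⟩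
  -- Two slots attached to the same edge would give three disjoint edges.
  · exact absurd hcd (h.noThree z a w b c d (by simp; grind) h1 h4)
  · exact Or.inl ⟨h1, h2, h3, h4⟩
  · exact Or.inr ⟨h3, h4, h1, h2⟩
  · exact absurd hab (h.noThree z c w d a b (by simp; grind) h1 h4)

theorem Tight.not_cross (h : Tight D) {x y t u v w : ι} (hN : [x, y, t, u, v, w].Nodup)
    (hyt : D.Adj y t) (hvw : D.Adj v w) : ¬ D.Adj x u := by
  intro hxu
  exact h.noThree x u y t v w (by simp at hN ⊢; grind) hxu hyt hvw

/-- There is no seventh unit. -/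
theorem Tight.not_seven (h : Tight D) {a b c d z w v : ι} (hN : [a, b, c, d, z, w, v].Nodup)
    (hab : D.Adj a b) (hcd : D.Adj c d) : False := by
  simp only [List.nodup_cons, List.mem_cons, List.not_mem_nil, not_or, or_false,
    List.nodup_nil, not_false_eq_true, and_true] at hN
  have h1 := h.triangles (z := z) (w := w) (by simp; grind) hab hcd
  have h2 := h.triangles (z := z) (w := v) (by simp; grind) hab hcd
  have h3 := h.triangles (z := w) (w := v) (by simp; grind) hab hcd
  have hT := h.noThree
  rcases h1 with h1 | h1 <;> rcases h2 with h2 | h2 <;> rcases h3 with h3 | h3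
  all_goals first
    | exact hT w a v b c d (by simp; grind) (by tauto) (by tauto) (by tauto)
    | exact hT z a v b c d (by simp; grind) (by tauto) (by tauto) (by tauto)
    | exact hT z a w b c d (by simp; grind) (by tauto) (by tauto) (by tauto)

end Triangle

/-! ### Vanishing for critical configurations and for a triangle with an edge -/

section ManyUnits

variable {n : ℕ} {K : Type*} [Field K] {ι : Type*}
  {G : SimpleGraph (Fin n)} {β : ι → Fin n} {H : Finset (Fin n)} {ρ i : ℤ} {a b c d z w : ι}

theorem vanishes_of_critical (hb : Bounded K (indepAway G ∅) ρ) (hi : ρ ≤ i + 1 - H.card)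
    (hT : NoThreeEdges (G.comap β)) (h : ∀ z, Critical (G.comap β) z)
    (hab : (G.comap β).Adj a b) :
    Vanishes K (fam G β H fun m => ¬ Reach3 (G.comap β) m) i :=
  vanishes_fam_congr (fun _ => not_reach3_iff_avoid hT h)
    (vanishes_avoid_edge hb Set.univ hab (Set.mem_univ _) (Set.mem_univ _) hi)

/-- All six slots are critical, and an edge between the triangles would leave a third disjoint edge.
So no slot is met and the gain is two. -/
theorem vanishes_two_triangles (hb : Bounded K (indepAway G ∅) ρ) (hi : ρ ≤ i + 2 - H.card)
    (h : Tight (G.comap β)) (hN : [a, b, c, d, z, w].Nodup)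
    (hu : ∀ i, i = a ∨ i = b ∨ i = c ∨ i = d ∨ i = z ∨ i = w)
    (hab : (G.comap β).Adj a b) (hcd : (G.comap β).Adj c d)
    (hza : (G.comap β).Adj z a) (hzb : (G.comap β).Adj z b)
    (hwc : (G.comap β).Adj w c) (hwd : (G.comap β).Adj w d) :
    Vanishes K (fam G β H fun m => ¬ Reach3 (G.comap β) m) i := by
  simp only [List.nodup_cons, List.mem_cons, List.not_mem_nil, not_or, or_false,
    List.nodup_nil, not_false_eq_true, and_true] at hN
  refine vanishes_fam_congr (fun _ => not_reach3_iff_avoid h.noThree fun i => ?_)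
    (vanishes_avoid_two_edges hb Set.univ hab hcd ?_ ?_ ?_ ?_ (Set.mem_univ _) (Set.mem_univ _)
      (Set.mem_univ _) (Set.mem_univ _) hi)
  · rcases hu i with rfl | rfl | rfl | rfl | rfl | rfl
    · exact ⟨z, b, c, d, by simp; grind, hzb, hcd⟩
    · exact ⟨z, a, c, d, by simp; grind, hza, hcd⟩
    · exact ⟨a, b, w, d, by simp; grind, hab, hwd⟩
    · exact ⟨a, b, w, c, by simp; grind, hab, hwc⟩
    · exact ⟨a, b, c, d, by simp; grind, hab, hcd⟩
    · exact ⟨a, b, c, d, by simp; grind, hab, hcd⟩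
  · exact h.not_cross (y := z) (t := b) (v := w) (w := d) (by simp; grind) hzb hwd
  · exact h.not_cross (y := z) (t := b) (v := w) (w := c) (by simp; grind) hzb hwc
  · exact h.not_cross (y := z) (t := a) (v := w) (w := d) (by simp; grind) hza hwd
  · exact h.not_cross (y := z) (t := a) (v := w) (w := c) (by simp; grind) hza hwc

theorem not_reach3_triangle_edge {D : SimpleGraph ι} {m : ι → Prop} (hT : NoThreeEdges D)
    (hN : [a, b, c, d, z].Nodup)
    (hu : ∀ i, i = a ∨ i = b ∨ i = c ∨ i = d ∨ i = z) (hc : ∀ p, D.Adj c p → p = d)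
    (hm : ∀ i, m i → i = d) : ¬ Reach3 D m := by
  have hs : ∀ a b, D.Adj a b → D.Adj b a := fun _ _ h => h.symm
  have hi : ∀ a, ¬ D.Adj a a := fun a h => h.ne rfl
  rintro (⟨i, j, k, h, hi, hj, -⟩ | ⟨i, j, k, l, h, hi, hj, -⟩ | ⟨i, k, l, p, q, h, hi, h1, h2⟩ |
    ⟨i, j, k, l, p, q, hN, h1, h2, h3⟩)
  · simp [hm i hi, hm j hj] at h
  · simp [hm i hi, hm j hj] at h
  · have h3 := hm i hi
    subst h3
    simp only [List.nodup_cons, List.mem_cons, List.not_mem_nil, not_or, or_false,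
      List.nodup_nil, not_false_eq_true, and_true] at hN h
    have := hu k; have := hu l; have := hu p; have := hu q
    have := hc k; have := hc l; have := hc p; have := hc q
    grind
  · exact hT _ _ _ _ _ _ hN h1 h2 h3

/-- The triangle slots are critical, while c and d merely cannot both be met. Both halves of the
cover are cones because cd is isolated; the intersection gains two degrees. -/
theorem vanishes_triangle_edge (hβ : ∀ i, β i ∉ H) (hb : Bounded K (indepAway G ∅) ρ)
    (hi : ρ ≤ i + 1 - H.card) (hT : NoThreeEdges (G.comap β)) (hN : [a, b, c, d, z].Nodup)
    (hu : ∀ i, i = a ∨ i = b ∨ i = c ∨ i = d ∨ i = z)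
    (hab : (G.comap β).Adj a b) (hcd : (G.comap β).Adj c d)
    (hza : (G.comap β).Adj z a) (hzb : (G.comap β).Adj z b)
    (hc : ∀ p, (G.comap β).Adj c p → p = d) (hd : ∀ p, (G.comap β).Adj d p → p = c) :
    Vanishes K (fam G β H fun m => ¬ Reach3 (G.comap β) m) i := by
  have hN' := hN
  simp only [List.nodup_cons, List.mem_cons, List.not_mem_nil, not_or, or_false,
    List.nodup_nil, not_false_eq_true, and_true] at hN'
  refine vanishes_fam_or (Ψ₁ := Avoid {a, b, z, c}) (Ψ₂ := Avoid {a, b, z, d}) (lower_avoid _)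
    (lower_avoid _) (fun m => ⟨fun h => ?_, fun h => ?_⟩)
    (vanishes_avoid_cone (z := c) (hβ c) (by simp) (fun p hp h => ?_) _)
    (vanishes_avoid_cone (z := d) (hβ d) (by simp) (fun p hp h => ?_) _)
    (vanishes_fam_congr (Ψ' := Avoid {a, b, z, c, d}) (fun m => ?_)
      (vanishes_avoid_two_edges hb _ hab hcd ?_ ?_ ?_ ?_ (by simp) (by simp) (by simp) (by simp)
        (by omega)))
  · have h1 : ¬ m a := fun h' => h (reach3_of_unit (by simp; grind) h' hzb hcd)
    have h2 : ¬ m b := fun h' => h (reach3_of_unit (by simp; grind) h' hza hcd)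
    have h3 : ¬ m z := fun h' => h (reach3_of_unit (by simp; grind) h' hab hcd)
    have h4 : ¬ (m c ∧ m d) := fun h' => h (reach3_of_units (by simp; grind) h'.1 h'.2 hab)
    simp only [Avoid, Set.mem_singleton_iff, Set.mem_insert_iff, forall_eq_or_imp, forall_eq]
    tauto
  · simp only [Avoid, Set.mem_singleton_iff, Set.mem_insert_iff, forall_eq_or_imp, forall_eq] at h
    rcases h with h | h
    · refine not_reach3_triangle_edge hT hN hu hc fun i hi => ?_
      rcases hu i with rfl | rfl | rfl | rfl | rfl <;> tauto
    · refine not_reach3_triangle_edge hT (a := a) (b := b) (c := d) (d := c) (z := z)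
        (by simp; grind) (fun i => by have := hu i; tauto) hd fun i hi => ?_
      rcases hu i with rfl | rfl | rfl | rfl | rfl <;> tauto
  · have := hc p h
    simp only [Set.mem_singleton_iff, Set.mem_insert_iff] at hp
    grind
  · have := hd p h
    simp only [Set.mem_singleton_iff, Set.mem_insert_iff] at hp
    grind
  · simp only [Avoid, Set.mem_singleton_iff, Set.mem_insert_iff, forall_eq_or_imp, forall_eq]
    tauto
  · intro h
    have := hc a h.symm
    grind
  · intro h
    have := hd a h.symm
    grind
  · intro h
    have := hc b h.symm
    grind
  · intro h
    have := hd b h.symm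
    grind

end ManyUnits

/-! ### Third power: slot graphs with two disjoint edges -/

section Three

variable {n : ℕ} {K : Type*} [Field K] {ι : Type*}
  {G : SimpleGraph (Fin n)} {β : ι → Fin n} {H : Finset (Fin n)} {ρ i : ℤ} {a b c d z w : ι}

theorem vanishes_five_triangle (hβ : ∀ i, β i ∉ H) (hb : Bounded K (indepAway G ∅) ρ)
    (hi : ρ ≤ i + 1 - H.card) (h : Tight (G.comap β)) (hN : [a, b, c, d, z].Nodup)
    (hu : ∀ i, i = a ∨ i = b ∨ i = c ∨ i = d ∨ i = z)
    (hab : (G.comap β).Adj a b) (hcd : (G.comap β).Adj c d)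
    (hza : (G.comap β).Adj z a) (hzb : (G.comap β).Adj z b) :
    Vanishes K (fam G β H fun m => ¬ Reach3 (G.comap β) m) i := by
  simp only [List.nodup_cons, List.mem_cons, List.not_mem_nil, not_or, or_false,
    List.nodup_nil, not_false_eq_true, and_true] at hN
  have key : ∀ x y t c d, [x, y, t, c, d].Nodup →
      (∀ i, i = x ∨ i = y ∨ i = t ∨ i = c ∨ i = d) → (G.comap β).Adj x y → (G.comap β).Adj x t →
      (G.comap β).Adj y t → (G.comap β).Adj c d → (G.comap β).Adj x c →
      Vanishes K (fam G β H fun m => ¬ Reach3 (G.comap β) m) i :=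
    fun x y t c d hN hu hxy hxt hyt hcd hxc => vanishes_of_critical hb hi h.noThree
      (h.critical_of_cross hN hu hxy hxt hyt hcd hxc) hab
  by_cases hac : (G.comap β).Adj a c
  · exact key a b z c d (by simp; grind) (fun i => by have := hu i; tauto) hab hza.symm hzb.symm
      hcd hac
  by_cases had : (G.comap β).Adj a d
  · exact key a b z d c (by simp; grind) (fun i => by have := hu i; tauto) hab hza.symm hzb.symm
      hcd.symm had
  by_cases hbc : (G.comap β).Adj b c
  · exact key b a z c d (by simp; grind) (fun i => by have := hu i; tauto) hab.symm hzb.symm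
      hza.symm hcd hbc
  by_cases hbd : (G.comap β).Adj b d
  · exact key b a z d c (by simp; grind) (fun i => by have := hu i; tauto) hab.symm hzb.symm
      hza.symm hcd.symm hbd
  by_cases hzc : (G.comap β).Adj z c
  · exact key z a b c d (by simp; grind) (fun i => by have := hu i; tauto) hza hzb hab hcd hzc
  by_cases hzd : (G.comap β).Adj z d
  · exact key z a b d c (by simp; grind) (fun i => by have := hu i; tauto) hza hzb hab
      hcd.symm hzd
  refine vanishes_triangle_edge hβ hb hi h.noThree (by simp; grind) hu hab hcd hza hzb
    (fun p hp => ?_) (fun p hp => ?_)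
  · rcases hu p with rfl | rfl | rfl | rfl | rfl
    exacts [absurd hp.symm hac, absurd hp.symm hbc, absurd rfl hp.ne, rfl, absurd hp.symm hzc]
  · rcases hu p with rfl | rfl | rfl | rfl | rfl
    exacts [absurd hp.symm had, absurd hp.symm hbd, rfl, absurd rfl hp.ne, absurd hp.symm hzd]

theorem vanishes_five_units (hβ : ∀ i, β i ∉ H) (hb : Bounded K (indepAway G ∅) ρ)
    (hi : ρ ≤ i + 1 - H.card) (h : Tight (G.comap β)) (hN : [a, b, c, d, z].Nodup)
    (hu : ∀ i, i = a ∨ i = b ∨ i = c ∨ i = d ∨ i = z)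
    (hab : (G.comap β).Adj a b) (hcd : (G.comap β).Adj c d) :
    Vanishes K (fam G β H fun m => ¬ Reach3 (G.comap β) m) i := by
  have hN' := hN
  simp only [List.nodup_cons, List.mem_cons, List.not_mem_nil, not_or, or_false,
    List.nodup_nil, not_false_eq_true, and_true] at hN'
  have key : ∀ a b c d, [a, b, c, d, z].Nodup →
      (∀ i, i = a ∨ i = b ∨ i = c ∨ i = d ∨ i = z) → (G.comap β).Adj a b → (G.comap β).Adj c d →
      (G.comap β).Adj z a → (G.comap β).Adj z c → (G.comap β).Adj b d →
      Vanishes K (fam G β H fun m => ¬ Reach3 (G.comap β) m) i :=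
    fun a b c d hN hu hab hcd hza hzc hbd => vanishes_of_critical hb hi h.noThree
      (critical_of_cycle hN hu hab hcd hza hzc hbd) hab
  rcases h.cases hN hab hcd with ⟨h1, h2⟩ | ⟨h1, h2⟩ | ⟨h1, h2, h3⟩ | ⟨h1, h2, h3⟩ |
    ⟨h1, h2, h3⟩ | ⟨h1, h2, h3⟩
  · exact vanishes_five_triangle hβ hb hi h hN hu hab hcd h1 h2
  · exact vanishes_five_triangle hβ hb hi h (a := c) (b := d) (c := a) (d := b) (z := z)
      (by simp; grind) (fun i => by have := hu i; tauto) hcd hab h1 h2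
  · exact key a b c d hN hu hab hcd h1 h2 h3
  · exact key a b d c (by simp; grind) (fun i => by have := hu i; tauto) hab hcd.symm h1 h2 h3
  · exact key b a c d (by simp; grind) (fun i => by have := hu i; tauto) hab.symm hcd h1 h2 h3
  · exact key b a d c (by simp; grind) (fun i => by have := hu i; tauto) hab.symm hcd.symm h1 h2 h3

/-- The slots a and c cover all edges, since any other edge completes three disjoint ones, and any
met slot outside {a, c} would reach three pieces. Meeting also the neighbours a, c of z therefore
stays short of three pieces, so z is a cone point. -/
theorem vanishes_cover (hβ : ∀ i, β i ∉ H) (hT : NoThreeEdges (G.comap β))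
    (hN : [a, b, c, d, z].Nodup) (hab : (G.comap β).Adj a b) (hcd : (G.comap β).Adj c d)
    (hza : (G.comap β).Adj z a) (hzc : (G.comap β).Adj z c)
    (hz : ∀ p, (G.comap β).Adj z p → p = a ∨ p = c) (hbd : ¬ (G.comap β).Adj b d) (i : ℤ) :
    Vanishes K (fam G β H fun m => ¬ Reach3 (G.comap β) m) i := by
  simp only [List.nodup_cons, List.mem_cons, List.not_mem_nil, not_or, or_false,
    List.nodup_nil, not_false_eq_true, and_true] at hN
  refine vanishes_fam_cone lower_not_reach3 (hβ z) (fun m hm => ⟨fun h =>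
    hm (reach3_of_unit (by simp; grind) h hab hcd), not_reach3_of_cover (p := a) (q := c)
      (fun x y hxy => ?_) fun x hx' => ?_⟩) i
  · by_contra! h'
    have hs := hxy.symm
    have hne := hxy.ne
    have hzx : x ≠ z := fun h => by subst h; have := hz y hxy; tauto
    have hzy : y ≠ z := fun h => by subst h; have := hz x hs; tauto
    by_cases h1 : x = b
    · subst h1
      have h2 : y ≠ d := fun h => hbd (h ▸ hxy)
      exact hT z a x y c d (by simp; grind) hza hxy hcd
    by_cases h2 : y = b
    · subst h2
      have h2 : x ≠ d := fun h => hbd (h ▸ hs)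
      exact hT z a y x c d (by simp; grind) hza hs hcd
    by_cases h3 : x = d
    · subst h3
      exact hT z c x y a b (by simp; grind) hzc hxy hab
    by_cases h4 : y = d
    · subst h4
      exact hT z c y x a b (by simp; grind) hzc hs hab
    · exact hT x y a b c d (by simp; grind) hxy hab hcd
  · refine hx'.elim (fun hx => ?_) (hz x)
    by_contra! h'
    by_cases h1 : x = z
    · subst h1
      exact hm (reach3_of_unit (by simp; grind) hx hab hcd)
    by_cases h2 : x = b
    · subst h2
      exact hm (reach3_of_unit (by simp; grind) hx hza hcd)
    by_cases h3 : x = d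
    · subst h3
      exact hm (reach3_of_unit (by simp; grind) hx hzc hab)
    · exact hm (reach3_of_unit (by simp; grind) hx hab hcd)

/-- With more than four slots, failure of any clause of `Tight` gives an empty family or a cone. A
tight graph with two disjoint edges has at most six slots, and each extra slot is paid for by a
degree gained. -/
theorem vanishes_of_disjoint_edges [Fintype ι] (hβ : ∀ i, β i ∉ H)
    (hb : Bounded K (indepAway G ∅) ρ) (hi : ρ + 4 - Fintype.card ι ≤ i - H.card)
    (hN : [a, b, c, d].Nodup) (hab : (G.comap β).Adj a b) (hcd : (G.comap β).Adj c d) :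
    Vanishes K (fam G β H fun m => ¬ Reach3 (G.comap β) m) i := by
  have hN' := hN
  simp only [List.nodup_cons, List.mem_cons, List.not_mem_nil, not_or, or_false,
    List.nodup_nil, not_false_eq_true, and_true] at hN
  by_cases h4 : ∀ i, i ∈ [a, b, c, d]
  · have hc := card_le_of_forall_mem h4
    simp only [List.length_cons, List.length_nil] at hc
    exact vanishes_four_units hβ hb (by omega) hN' (fun i => by simpa using h4 i) hab hcd
  by_cases hT : NoThreeEdges (G.comap β)
  swap
  · simp only [NoThreeEdges, not_forall, not_not] at hT
    obtain ⟨j, k, l, p, q, r, hN, h1, h2, h3⟩ := hT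
    exact vanishes_fam_of_false (fun m => not_not.2 (reach3_of_edges hN h1 h2 h3)) i
  by_cases h2 : ∀ z, Critical (G.comap β) z →
      ¬ ∀ p q, (G.comap β).Adj z p → (G.comap β).Adj z q → p = q
  swap
  · push Not at h2
    obtain ⟨z, ⟨p, q, r, s, hN, h1, h2⟩, hz⟩ := h2
    refine vanishes_fam_cone lower_not_reach3 (hβ z) (fun m hm => ?_) i
    have h3 : ¬ m z := fun h => hm (reach3_of_unit hN h h1 h2)
    exact ⟨h3, fun h => hm (reach3_leaf hz h3 h)⟩
  by_cases h3 : ∀ a b c d z, [a, b, c, d, z].Nodup → (G.comap β).Adj a b → (G.comap β).Adj c d →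
      (G.comap β).Adj z a → (G.comap β).Adj z c →
      (∀ p, (G.comap β).Adj z p → p = a ∨ p = c) → (G.comap β).Adj b d
  swap
  · push Not at h3
    obtain ⟨a, b, c, d, z, hN, hab, hcd, hza, hzc, hz, hbd⟩ := h3
    exact vanishes_cover hβ hT hN hab hcd hza hzc hz hbd i
  have h : Tight (G.comap β) := ⟨hT, h2, h3⟩
  push Not at h4
  obtain ⟨z, hz⟩ := h4
  simp only [List.mem_cons, List.not_mem_nil, or_false, not_or] at hz
  by_cases h5 : ∀ i, i ∈ [a, b, c, d, z]
  · have hc := card_le_of_forall_mem h5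
    simp only [List.length_cons, List.length_nil] at hc
    exact vanishes_five_units hβ hb (by omega) h (z := z) (by simp; grind)
      (fun i => by simpa using h5 i) hab hcd
  push Not at h5
  obtain ⟨w, hw⟩ := h5
  simp only [List.mem_cons, List.not_mem_nil, or_false, not_or] at hw
  by_cases h6 : ∀ i, i ∈ [a, b, c, d, z, w]
  · have hc := card_le_of_forall_mem h6
    simp only [List.length_cons, List.length_nil] at hc
    rcases h.triangles (z := z) (w := w) (by simp; grind) hab hcd with ⟨k1, k2, k3, k4⟩ |
      ⟨k1, k2, k3, k4⟩
    · exact vanishes_two_triangles hb (by omega) h (z := z) (w := w) (by simp; grind)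
        (fun i => by simpa using h6 i) hab hcd k1 k2 k3 k4
    · exact vanishes_two_triangles hb (by omega) h (a := a) (b := b) (c := c) (d := d) (z := w)
        (w := z) (by simp; grind) (fun i => by have := h6 i; simp at this; tauto) hab hcd k1 k2
        k3 k4
  · push Not at h6
    obtain ⟨v, hv⟩ := h6
    simp only [List.mem_cons, List.not_mem_nil, or_false, not_or] at hv
    exact (h.not_seven (z := z) (w := w) (v := v) (by simp; grind) hab hcd).elim

end Three

/-! ### Third power: remaining slot graphs and conclusion -/

section Summary

variable {n : ℕ} {K : Type*} [Field K] {ι : Type*}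
  {G : SimpleGraph (Fin n)} {β : ι → Fin n} {H : Finset (Fin n)} {ρ i : ℤ} {a b c x y z w : ι}

theorem vanishes_no_edges (hβ : ∀ i, β i ∉ H) (hE : ∀ p q, ¬ (G.comap β).Adj p q)
    (hN : [a, b, c].Nodup) (i : ℤ) :
    Vanishes K (fam G β H fun m => ¬ Reach3 (G.comap β) m) i := by
  have cone : ∀ (A : Set ι) (z : ι), z ∈ A → ∀ i,
      Vanishes K (fam G β H fun m => ¬ Reach3 (G.comap β) m ∧ Avoid A m) i :=
    fun A z hz i => vanishes_leaf (hβ z) hz (fun w _ => hE z w) (fun p _ h => (hE z p h).elim) i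
  refine vanishes_fam_or (Ψ₁ := fun m => ¬ Reach3 (G.comap β) m ∧ Avoid {a} m)
    (Ψ₂ := fun m => (¬ Reach3 (G.comap β) m ∧ Avoid {b} m) ∨
      (¬ Reach3 (G.comap β) m ∧ Avoid {c} m))
    (lower_not_reach3.and (lower_avoid _))
    ((lower_not_reach3.and (lower_avoid _)).or (lower_not_reach3.and (lower_avoid _)))
    (fun m => ?_) (cone {a} a (by simp) i)
    (vanishes_fam_or (lower_not_reach3.and (lower_avoid _)) (lower_not_reach3.and (lower_avoid _))
      (fun m => Iff.rfl) (cone {b} b (by simp) i) (cone {c} c (by simp) i)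
      (vanishes_fam_congr (fun m => ?_) (cone {b, c} b (by simp) (i - 1))))
    (vanishes_fam_or (Ψ₁ := fun m => ¬ Reach3 (G.comap β) m ∧ Avoid {a, b} m)
      (Ψ₂ := fun m => ¬ Reach3 (G.comap β) m ∧ Avoid {a, c} m)
      (lower_not_reach3.and (lower_avoid _)) (lower_not_reach3.and (lower_avoid _))
      (fun m => ?_) (cone {a, b} a (by simp) _) (cone {a, c} a (by simp) _)
      (vanishes_fam_congr (fun m => ?_) (cone {a, b, c} a (by simp) _)))
  · have h : m a → m b → m c → Reach3 (G.comap β) m := fun h1 h2 h3 =>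
      Or.inl ⟨a, b, c, hN, h1, h2, h3⟩
    simp only [Avoid, Set.mem_singleton_iff, forall_eq]
    tauto
  all_goals
    simp only [Avoid, Set.mem_singleton_iff, Set.mem_insert_iff, forall_eq_or_imp, forall_eq]
    tauto

/-- The condition is that some slot is unmet. Inclusion–exclusion over three slots costs two degrees
in the triple intersection, where the edge restores one. -/
theorem vanishes_three_units (hb : Bounded K (indepAway G ∅) ρ)
    (hi : ρ + 1 ≤ i - H.card) (hN : [a, b, c].Nodup) (hu : ∀ i, i = a ∨ i = b ∨ i = c)
    (hxy : (G.comap β).Adj x y) :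
    Vanishes K (fam G β H fun m => ¬ Reach3 (G.comap β) m) i := by
  have hR : ∀ m, Reach3 (G.comap β) m ↔ m a ∧ m b ∧ m c := by
    refine fun m => ⟨?_, fun h => Or.inl ⟨a, b, c, hN, h⟩⟩
    have h4 : ∀ i j k l : ι, ¬ [i, j, k, l].Nodup := fun i j k l h => by
      have h' : [i, j, k, l] ⊆ [a, b, c] := fun x _ => by simpa using hu x
      simpa using (List.subperm_of_subset h h').length_le
    rintro (⟨i, j, k, h, h1, h2, h3⟩ | ⟨i, j, k, l, h, -⟩ | ⟨i, j, k, l, p, h, -⟩ |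
      ⟨i, j, k, l, p, q, h, -⟩)
    · have := hu i; have := hu j; have := hu k
      simp only [List.nodup_cons, List.mem_cons, List.not_mem_nil, not_or, or_false,
        List.nodup_nil, not_false_eq_true, and_true] at h
      grind
    · exact (h4 i j k l h).elim
    · exact (h4 i j k l (by simp at h ⊢; tauto)).elim
    · exact (h4 i j k l (by simp at h ⊢; tauto)).elim
  refine vanishes_fam_or (Ψ₁ := Avoid {a}) (Ψ₂ := fun m => Avoid {b} m ∨ Avoid {c} m)
    (lower_avoid _) ((lower_avoid _).or (lower_avoid _)) (fun m => ?_)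
    (vanishes_avoid hb {a} (by omega))
    (vanishes_fam_or (lower_avoid _) (lower_avoid _) (fun m => Iff.rfl)
      (vanishes_avoid hb {b} (by omega)) (vanishes_avoid hb {c} (by omega))
      (vanishes_fam_congr (fun m => ?_) (vanishes_avoid hb {b, c} (by omega))))
    (vanishes_fam_or (Ψ₁ := Avoid {a, b}) (Ψ₂ := Avoid {a, c}) (lower_avoid _) (lower_avoid _)
      (fun m => ?_) (vanishes_avoid hb {a, b} (by omega)) (vanishes_avoid hb {a, c} (by omega))
      (vanishes_fam_congr (fun m => ?_) (vanishes_avoid_edge hb Set.univ hxy (Set.mem_univ _)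
        (Set.mem_univ _) (by omega))))
  · rw [hR]
    simp only [Avoid, Set.mem_singleton_iff, forall_eq]
    tauto
  · simp only [Avoid, Set.mem_singleton_iff, Set.mem_insert_iff, forall_eq_or_imp, forall_eq]
  · simp only [Avoid, Set.mem_singleton_iff, Set.mem_insert_iff, forall_eq_or_imp, forall_eq]
    tauto
  · simp only [Avoid, Set.mem_singleton_iff, Set.mem_insert_iff, forall_eq_or_imp, forall_eq,
      Set.mem_univ, true_imp_iff]
    refine ⟨fun h i => ?_, fun h => ⟨⟨h a, h b⟩, h a, h c⟩⟩
    rcases hu i with rfl | rfl | rfl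
    exacts [h.1.1, h.1.2, h.2.2]

/-- The graph has no two disjoint edges. -/
def NoTwoEdges (D : SimpleGraph ι) : Prop :=
  ∀ i j k l, [i, j, k, l].Nodup → D.Adj i j → ¬ D.Adj k l

theorem NoTwoEdges.isolated {D : SimpleGraph ι} (hD : NoTwoEdges D) (hxy : D.Adj x y)
    (hxz : D.Adj x z) (hyz : D.Adj y z) (hw : w ≠ x ∧ w ≠ y ∧ w ≠ z) (v : ι) : ¬ D.Adj w v := by
  intro h
  have h1 := hxy.ne
  have h2 := hxz.ne
  have h3 := hyz.ne
  have h4 := h.ne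
  by_cases hx : v = x
  · subst hx
    exact hD w v y z (by simp; grind) h hyz
  by_cases hy : v = y
  · subst hy
    exact hD w v x z (by simp; grind) h hxz
  · exact hD w v x y (by simp; grind) h hxy

/-- The slot w cannot be met together with a triangle slot. So either w is unmet and the family is a
cone over it, or the triangle is unmet. -/
theorem vanishes_triangle_isolated (hβ : ∀ i, β i ∉ H) (hb : Bounded K (indepAway G ∅) ρ)
    (hi : ρ ≤ i - H.card) (hD : NoTwoEdges (G.comap β)) (hxy : (G.comap β).Adj x y)
    (hxz : (G.comap β).Adj x z) (hyz : (G.comap β).Adj y z) (hw : w ≠ x ∧ w ≠ y ∧ w ≠ z)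
    (hu : ∀ i, i = x ∨ i = y ∨ i = z ∨ i = w) :
    Vanishes K (fam G β H fun m => ¬ Reach3 (G.comap β) m) i := by
  have h1 := hxy.ne
  have h2 := hxz.ne
  have h3 := hyz.ne
  have hiso := hD.isolated hxy hxz hyz hw
  have hfree : ∀ m : ι → Prop, Avoid {x, y, z} m → ¬ Reach3 (G.comap β) m := by
    intro m hm
    simp only [Avoid, Set.mem_singleton_iff, Set.mem_insert_iff, forall_eq_or_imp, forall_eq]
      at hm
    have hm' : ∀ i, m i → i = w := fun i hi => by
      rcases hu i with rfl | rfl | rfl | rfl <;> tauto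
    rintro (⟨i, j, k, h, hi, hj, -⟩ | ⟨i, j, k, l, h, hi, hj, -⟩ |
      ⟨i, k, l, p, q, h, hi, h1, h2⟩ | ⟨i, j, k, l, p, q, h, h1, h2, h3⟩)
    · simp [hm' i hi, hm' j hj] at h
    · simp [hm' i hi, hm' j hj] at h
    · exact hD k l p q h.of_cons h1 h2
    · exact hD k l p q h.of_cons.of_cons h2 h3
  refine vanishes_fam_or (Ψ₁ := fun m => ¬ Reach3 (G.comap β) m ∧ Avoid {w} m)
    (Ψ₂ := Avoid {x, y, z}) (lower_not_reach3.and (lower_avoid _)) (lower_avoid _)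
    (fun m => ⟨fun h => ?_, fun h => h.elim And.left (hfree m)⟩)
    (vanishes_leaf (z := w) (hβ w) (Set.mem_singleton w) (fun p _ => hiso p)
      (fun p _ h => (hiso p h).elim) i) (vanishes_avoid hb _ hi)
    (vanishes_fam_congr (fun m => ?_) (vanishes_avoid_edge hb {x, y, z, w} hxy (by simp)
      (by simp) (by omega)))
  · have h4 : ¬ (m w ∧ m x) := fun h' => h (reach3_of_units (by simp; grind) h'.1 h'.2 hyz)
    have h5 : ¬ (m w ∧ m y) := fun h' => h (reach3_of_units (by simp; grind) h'.1 h'.2 hxz)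
    have h6 : ¬ (m w ∧ m z) := fun h' => h (reach3_of_units (by simp; grind) h'.1 h'.2 hxy)
    simp only [Avoid, Set.mem_singleton_iff, Set.mem_insert_iff, forall_eq_or_imp, forall_eq]
    tauto
  · have := hfree m
    simp only [Avoid, Set.mem_singleton_iff, Set.mem_insert_iff, forall_eq_or_imp, forall_eq]
      at this ⊢
    tauto

/-- The combinatorial heart of the bound for the third power. -/
theorem vanishes_three [Fintype ι] (hβ : ∀ i, β i ∉ H) (hb : Bounded K (indepAway G ∅) ρ)
    (hi : ρ + 4 - Fintype.card ι ≤ i - H.card) :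
    Vanishes K (fam G β H fun m => ¬ Reach3 (G.comap β) m) i := by
  by_cases hc2 : Fintype.card ι ≤ 2
  · refine vanishes_fam_congr (fun m => ?_) (vanishes_avoid hb ∅ (by omega))
    simpa using not_reach3_of_card_le_two hc2 m
  by_cases hE : ∀ p q, ¬ (G.comap β).Adj p q
  · obtain ⟨a, b, c, h1, h2, h3⟩ := Fintype.two_lt_card_iff.1 (not_le.1 hc2)
    exact vanishes_no_edges hβ hE (a := a) (b := b) (c := c) (by simp; tauto) i
  push Not at hE
  obtain ⟨x, y, hxy⟩ := hE
  by_cases hD : NoTwoEdges (G.comap β)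
  swap
  · simp only [NoTwoEdges, not_forall, not_not] at hD
    obtain ⟨a, b, c, d, hN, hab, hcd⟩ := hD
    exact vanishes_of_disjoint_edges hβ hb hi hN hab hcd
  have three : ∀ a b c : ι, [a, b, c].Nodup → (∀ i, i ∈ [a, b, c]) →
      Vanishes K (fam G β H fun m => ¬ Reach3 (G.comap β) m) i := fun a b c hN h => by
    have hc := card_le_of_forall_mem h
    simp only [List.length_cons, List.length_nil] at hc
    exact vanishes_three_units hb (by omega) hN (fun i => by simpa using h i) hxy
  by_cases htri : ∃ x y z, (G.comap β).Adj x y ∧ (G.comap β).Adj x z ∧ (G.comap β).Adj y z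
  · obtain ⟨x, y, z, hxy, hxz, hyz⟩ := htri
    have n1 := hxy.ne
    have n2 := hxz.ne
    have n3 := hyz.ne
    by_cases h3 : ∀ i, i ∈ [x, y, z]
    · exact three x y z (by simp; tauto) h3
    push Not at h3
    obtain ⟨w, hw⟩ := h3
    simp only [List.mem_cons, List.not_mem_nil, or_false, not_or] at hw
    by_cases h4 : ∀ i, i ∈ [x, y, z, w]
    · have hc := card_le_of_forall_mem h4
      simp only [List.length_cons, List.length_nil] at hc
      exact vanishes_triangle_isolated hβ hb (by omega) hD hxy hxz hyz hw
        fun i => by simpa using h4 i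
    push Not at h4
    obtain ⟨v, hv⟩ := h4
    simp only [List.mem_cons, List.not_mem_nil, or_false, not_or] at hv
    have iw := hD.isolated hxy hxz hyz hw
    have iv := hD.isolated hxy hxz hyz ⟨hv.1, hv.2.1, hv.2.2.1⟩
    -- Two isolated slots, if both met, form three pieces with an edge of the triangle.
    exact vanishes_two_leaves (z := v) (w := w) hβ (iv w) (fun p _ h => (iv p h).elim)
      (fun p _ h => (iw p h).elim)
      (fun m h1 h2 => reach3_of_units (by simp; grind) h1 h2 hxy) i
  have n1 := hxy.ne
  by_cases h2 : ∀ i, i ∈ [x, y]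
  · have hc := card_le_of_forall_mem h2
    exact absurd hc hc2
  push Not at h2
  obtain ⟨z, hz⟩ := h2
  simp only [List.mem_cons, List.not_mem_nil, or_false, not_or] at hz
  by_cases h3 : ∀ i, i ∈ [x, y, z]
  · exact three x y z (by simp; grind) h3
  push Not at h3
  obtain ⟨w, hw⟩ := h3
  simp only [List.mem_cons, List.not_mem_nil, or_false, not_or] at hw
  have hnb : ∀ u, u ≠ x → u ≠ y → ∀ p, (G.comap β).Adj u p → p = x ∨ p = y := by
    intro u h1 h2 p hp
    by_contra! h'
    have := hp.ne
    exact hD u p x y (by simp; grind) hp hxy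
  -- No triangles and no two disjoint edges: outside xy every slot has degree at most one, and z, w
  -- are two such slots.
  have hleaf : ∀ u, u ≠ x → u ≠ y →
      ∀ p q, (G.comap β).Adj u p → (G.comap β).Adj u q → p = q := by
    intro u h1 h2 p q hp hq
    by_contra hpq
    rcases hnb u h1 h2 p hp with rfl | rfl <;> rcases hnb u h1 h2 q hq with rfl | rfl
    · exact hpq rfl
    · exact htri ⟨p, q, u, hxy, hp.symm, hq.symm⟩
    · exact htri ⟨q, p, u, hxy, hq.symm, hp.symm⟩
    · exact hpq rfl
  refine vanishes_two_leaves (z := z) (w := w) hβ (fun h => ?_) (hleaf z hz.1 hz.2)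
    (hleaf w hw.1 hw.2.1) (fun m h1 h2 => reach3_of_units (by simp; grind) h1 h2 hxy) i
  have := hnb z hz.1 hz.2 w h
  tauto

end Summary

/-! ### Second power -/

section Two

variable {n : ℕ} {K : Type*} [Field K] {ι : Type*}
  {G : SimpleGraph (Fin n)} {β : ι → Fin n} {H : Finset (Fin n)} {ρ i : ℤ} {a b x y z w : ι}

theorem reach2_of_unit {D : SimpleGraph ι} {m : ι → Prop} (hN : [z, x, y].Nodup) (hz : m z)
    (hxy : D.Adj x y) : Reach2 D m := Or.inr (Or.inl ⟨z, x, y, hN, hz, hxy⟩)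

theorem vanishes_no_edges_two (hβ : ∀ i, β i ∉ H) (hE : ∀ p q, ¬ (G.comap β).Adj p q)
    (hN : a ≠ b) (i : ℤ) : Vanishes K (fam G β H fun m => ¬ Reach2 (G.comap β) m) i := by
  have cone : ∀ (A : Set ι) (z : ι), z ∈ A → ∀ i,
      Vanishes K (fam G β H fun m => ¬ Reach2 (G.comap β) m ∧ Avoid A m) i :=
    fun A z hz i => vanishes_fam_cone (lower_not_reach2.and (lower_avoid A)) (hβ z)
      (fun m h => ⟨h.2 z hz, fun h' => h.1 (reach2_leaf (fun p _ h => (hE z p h).elim)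
        (h.2 z hz) h'), fun w hw h' => h'.elim (h.2 w hw) (hE z w)⟩) i
  refine vanishes_fam_or (Ψ₁ := fun m => ¬ Reach2 (G.comap β) m ∧ Avoid {a} m)
    (Ψ₂ := fun m => ¬ Reach2 (G.comap β) m ∧ Avoid {b} m)
    (lower_not_reach2.and (lower_avoid _)) (lower_not_reach2.and (lower_avoid _))
    (fun m => ?_) (cone {a} a (by simp) i) (cone {b} b (by simp) i)
    (vanishes_fam_congr (fun m => ?_) (cone {a, b} a (by simp) (i - 1)))
  · have h : m a → m b → Reach2 (G.comap β) m := fun h1 h2 =>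
      Or.inl ⟨a, b, by simpa using hN, h1, h2⟩
    simp only [Avoid, Set.mem_singleton_iff, forall_eq]
    tauto
  · simp only [Avoid, Set.mem_singleton_iff, Set.mem_insert_iff, forall_eq_or_imp, forall_eq]
    tauto

theorem vanishes_one_edge (hb : Bounded K (indepAway G ∅) ρ) (hi : ρ ≤ i - H.card)
    (hu : ∀ i, i = x ∨ i = y) (hxy : (G.comap β).Adj x y) :
    Vanishes K (fam G β H fun m => ¬ Reach2 (G.comap β) m) i := by
  have hne := hxy.ne
  have hR : ∀ m, Reach2 (G.comap β) m ↔ m x ∧ m y := by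
    refine fun m => ⟨?_, fun h => Or.inl ⟨x, y, by simpa using hne, h⟩⟩
    rintro (⟨j, k, h, h1, h2⟩ | ⟨j, k, l, h, -⟩ | ⟨j, k, l, p, h, -⟩) <;>
      have := hu j <;> have := hu k
    · simp only [List.nodup_cons, List.mem_cons, List.not_mem_nil, or_false,
        List.nodup_nil, not_false_eq_true, and_true] at h
      grind
    · have := hu l
      simp only [List.nodup_cons, List.mem_cons, List.not_mem_nil, not_or, or_false,
        List.nodup_nil, not_false_eq_true, and_true] at h
      grind
    · have := hu l
      simp only [List.nodup_cons, List.mem_cons, List.not_mem_nil, not_or, or_false,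
        List.nodup_nil, not_false_eq_true, and_true] at h
      grind
  refine vanishes_fam_or (Ψ₁ := Avoid {x}) (Ψ₂ := Avoid {y}) (lower_avoid _) (lower_avoid _)
    (fun m => ?_) (vanishes_avoid hb _ hi) (vanishes_avoid hb _ hi)
    (vanishes_fam_congr (fun m => ?_) (vanishes_avoid_edge hb {x, y} hxy (by simp) (by simp)
      (by omega)))
  · rw [hR]
    simp only [Avoid, Set.mem_singleton_iff, forall_eq]
    tauto
  · simp only [Avoid, Set.mem_singleton_iff, Set.mem_insert_iff, forall_eq_or_imp, forall_eq]

theorem vanishes_one_triangle (hb : Bounded K (indepAway G ∅) ρ) (hi : ρ ≤ i + 1 - H.card)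
    (hD : NoTwoEdges (G.comap β)) (hu : ∀ i, i = x ∨ i = y ∨ i = z)
    (hxy : (G.comap β).Adj x y) (hxz : (G.comap β).Adj x z) (hyz : (G.comap β).Adj y z) :
    Vanishes K (fam G β H fun m => ¬ Reach2 (G.comap β) m) i := by
  have h1 := hxy.ne
  have h2 := hxz.ne
  have h3 := hyz.ne
  refine vanishes_fam_congr (fun m => ⟨fun hm i _ hi => hm ?_, fun hm => ?_⟩)
    (vanishes_avoid_edge hb Set.univ hxy (Set.mem_univ _) (Set.mem_univ _) hi)
  · rcases hu i with rfl | rfl | rfl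
    · exact reach2_of_unit (by simp; grind) hi hyz
    · exact reach2_of_unit (by simp; grind) hi hxz
    · exact reach2_of_unit (by simp; grind) hi hxy
  · rintro (⟨j, k, -, hj, -⟩ | ⟨j, k, l, -, hj, -⟩ | ⟨j, k, l, p, h, h1, h2⟩)
    · exact hm j trivial hj
    · exact hm j trivial hj
    · exact hD _ _ _ _ h h1 h2

/-- The combinatorial heart of the bound for the second power. -/
theorem vanishes_two [Fintype ι] (hβ : ∀ i, β i ∉ H) (hb : Bounded K (indepAway G ∅) ρ)
    (hi : ρ + 2 - Fintype.card ι ≤ i - H.card) :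
    Vanishes K (fam G β H fun m => ¬ Reach2 (G.comap β) m) i := by
  by_cases hc1 : Fintype.card ι ≤ 1
  · have := Fintype.card_le_one_iff_subsingleton.1 hc1
    refine vanishes_fam_congr (fun m => ?_) (vanishes_avoid hb ∅ (by omega))
    simp only [Reach2, Subsingleton.elim _ (Classical.choice _), Set.mem_empty_iff_false,
      false_imp_iff, implies_true, iff_true]
    rintro (⟨j, k, h, -⟩ | ⟨j, k, l, h, -⟩ | ⟨j, k, l, p, h, -⟩) <;>
      simp [Subsingleton.elim j k] at h
  by_cases hE : ∀ p q, ¬ (G.comap β).Adj p q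
  · obtain ⟨a, b, h⟩ := Fintype.one_lt_card_iff.1 (not_le.1 hc1)
    exact vanishes_no_edges_two hβ hE h i
  push Not at hE
  obtain ⟨x, y, hxy⟩ := hE
  by_cases hD : NoTwoEdges (G.comap β)
  swap
  · simp only [NoTwoEdges, not_forall, not_not] at hD
    obtain ⟨a, b, c, d, hN, hab, hcd⟩ := hD
    exact vanishes_fam_of_false (fun m => not_not.2 (Or.inr (Or.inr ⟨a, b, c, d, hN, hab, hcd⟩))) i
  have n1 := hxy.ne
  by_cases h2 : ∀ i, i ∈ [x, y]
  · have hc := card_le_of_forall_mem h2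
    simp only [List.length_cons, List.length_nil] at hc
    exact vanishes_one_edge hb (by omega) (fun i => by simpa using h2 i) hxy
  push Not at h2
  obtain ⟨z, hz⟩ := h2
  simp only [List.mem_cons, List.not_mem_nil, or_false, not_or] at hz
  -- Any slot off the edge xy is critical here, so a single leaf already yields a cone. Otherwise z
  -- closes a triangle, and a fourth slot would be isolated.
  have cone : ∀ u, u ≠ x → u ≠ y →
      (∀ p q, (G.comap β).Adj u p → (G.comap β).Adj u q → p = q) →
      Vanishes K (fam G β H fun m => ¬ Reach2 (G.comap β) m) i := by
    refine fun u h1 h2 h => vanishes_fam_cone lower_not_reach2 (hβ u) (fun m hm => ?_) i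
    have h3 : ¬ m u := fun h => hm (reach2_of_unit (by simp; tauto) h hxy)
    exact ⟨h3, fun h' => hm (reach2_leaf h h3 h')⟩
  by_cases hl : ∀ p q, (G.comap β).Adj z p → (G.comap β).Adj z q → p = q
  · exact cone z hz.1 hz.2 hl
  have hnb : ∀ p, (G.comap β).Adj z p → p = x ∨ p = y := by
    intro p hp
    by_contra! h'
    have := hp.ne
    exact hD z p x y (by simp; grind) hp hxy
  have hzxy : (G.comap β).Adj x z ∧ (G.comap β).Adj y z := by
    push Not at hl
    obtain ⟨p, q, hp, hq, hpq⟩ := hl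
    rcases hnb p hp with rfl | rfl <;> rcases hnb q hq with rfl | rfl
    exacts [absurd rfl hpq, ⟨hp.symm, hq.symm⟩, ⟨hq.symm, hp.symm⟩, absurd rfl hpq]
  by_cases h3 : ∀ i, i ∈ [x, y, z]
  · have hc := card_le_of_forall_mem h3
    simp only [List.length_cons, List.length_nil] at hc
    exact vanishes_one_triangle hb (by omega) hD (fun i => by simpa using h3 i) hxy hzxy.1 hzxy.2
  push Not at h3
  obtain ⟨w, hw⟩ := h3
  simp only [List.mem_cons, List.not_mem_nil, or_false, not_or] at hw
  exact cone w hw.1 hw.2.1 fun p _ h => (hD.isolated hxy hzxy.1 hzxy.2 hw p h).elim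

end Two

/-! ### From the regularity of the ideal to that of its powers -/

section Powers

variable {n : ℕ} {K : Type*} [Field K] {G : SimpleGraph (Fin n)} {R : ℤ}

theorem vanishes_of_neg (Q : Set (Finset (Fin n))) {i : ℤ} (hi : i < 0) : Vanishes K Q i := by
  intro c hc _
  have h0 : ∀ F, c F = 0 := fun F => by
    by_contra h
    have := (hc F h).2
    omega
  exact ⟨fun _ => 0, fun F hF => absurd rfl hF, fun F _ => by simp [bdry, h0]⟩

theorem locSupport_of_isEmpty {s : ℕ} (hs : 0 < s) (a : Fin n → ℤ) (ha : IsEmpty (Slots a)) :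
    locSupport (powerExp G s) a = {F | negSupp a ⊆ F ∧ HasEdge G F} := by
  ext F
  rw [mem_locSupport_iff_reach]
  refine and_congr_right fun _ => or_iff_left ?_
  rintro ⟨X, E, h, -⟩
  rcases X with _ | ⟨x, X⟩
  · rcases E with _ | ⟨e, E⟩
    · exact hs.ne h
    · exact ha.elim e.1
  · exact ha.elim x

theorem vanishes_hasEdge
    (h : ∀ (i : ℕ) (j : ℤ), R ≤ i + j →
      ∀ z ∈ localCohDegree n K (idealGrading (edgeIdeal K G)) i j, z = 0)
    (H : Finset (Fin n)) {i : ℤ} (hi : R ≤ i - H.card) :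
    Vanishes K {F | H ⊆ F ∧ HasEdge G F} i := by
  rcases lt_or_ge i 0 with h0 | h0
  · exact vanishes_of_neg _ h0
  lift i to ℕ using h0
  have hJ := isMonomialIdeal_edgeIdeal_pow (K := K) G 1
  rw [pow_one] at hJ
  -- The multidegree -1_H has negative support H and no slots, so its strand is the family of sets
  -- that contain H and an edge.
  have hsum : ∑ v, (-ind H) v = -(H.card : ℤ) := by simp [ind]
  have hv := vanishes_locSupport hJ (h i _ (by omega)) hsum
  rw [locSupport_of_isEmpty one_pos] at hv
  · have hH : negSupp (-ind H) = H := by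
      ext v
      simp only [negSupp, ind, Pi.neg_apply]
      by_cases h : v ∈ H <;> simp [h]
    rwa [hH] at hv
  · refine ⟨fun ⟨v, k⟩ => ?_⟩
    have := k.2
    simp only [ind, Pi.neg_apply] at this
    split_ifs at this <;> simp at this

theorem ordConnected_supersets (H : Finset (Fin n)) : {F | H ⊆ F}.OrdConnected :=
  IsUpperSet.ordConnected fun _ _ hab ha => Finset.Subset.trans ha hab

theorem vanishes_supersets {H : Finset (Fin n)} {v : Fin n} (hv : v ∉ H) (i : ℤ) :
    Vanishes K {F | H ⊆ F} i :=
  vanishes_of_toggle v (fun _ _ => ⟨fun h => h.trans (Finset.subset_insert _ _),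
    (Finset.subset_insert_iff_of_notMem hv).1⟩) i

/-- Independent sets containing H are the complement, in the cone of all sets containing H, of those
with an edge; hence the shift by one. If H is everything there is no cone, but the star is empty
because G has an edge. -/
theorem bounded_indepAway {p q : Fin n} (hpq : G.Adj p q)
    (h : ∀ (H : Finset (Fin n)) (i : ℤ), R ≤ i - H.card →
      Vanishes K {F | H ⊆ F ∧ HasEdge G F} i) :
    Bounded K (indepAway G ∅) (R - 1) := by
  intro H i hi
  by_cases hH : ∃ v, v ∉ H
  · obtain ⟨v, hv⟩ := hH
    refine IsSplit.vanishes_left (Q := {F | H ⊆ F}) ⟨ordConnected_supersets H, ?_, ?_, ?_⟩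
      (vanishes_supersets hv i) (h H (i + 1) (by omega))
    · ext F
      simp only [indepAway, Finset.disjoint_empty_right, Set.mem_union, Set.mem_ofPred_eq]
      tauto
    · rw [Set.disjoint_left]
      exact fun F h1 h2 => h1.1.1 h2.2
    · rintro F ⟨-, u, hu, v, hv, huv⟩ F' h2 h3
      exact ⟨h2, u, h3 hu, v, h3 hv, huv⟩
  · push Not at hH
    convert vanishes_empty (K := K) i using 1
    ext F
    simp only [Set.mem_ofPred_eq, Set.mem_empty_iff_false, iff_false]
    exact fun h' => h'.1.1 ⟨p, h'.2 (hH p), q, h'.2 (hH q), hpq⟩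

theorem vanishes_locSupport_empty {s : ℕ} (hs : 0 < s) (hE : ∀ p q, ¬ G.Adj p q)
    (a : Fin n → ℤ) (i : ℤ) : Vanishes K (locSupport (powerExp G s) a) i := by
  convert vanishes_empty (K := K) i using 1
  ext F
  rw [mem_locSupport_powerExp]
  simp only [Set.mem_empty_iff_false, iff_false]
  rintro ⟨-, L, hL, hL', -⟩
  obtain ⟨e, L, rfl⟩ := List.exists_cons_of_length_pos (hL ▸ hs)
  exact hE _ _ (hL' e (by simp))

theorem sum_le_card_slots (a : Fin n → ℤ) :
    ∑ v, a v ≤ Fintype.card (Slots a) - (negSupp a).card := by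
  rw [card_units, negSupp, Finset.card_filter]
  push_cast
  rw [← Finset.sum_sub_distrib]
  refine Finset.sum_le_sum fun v _ => ?_
  split_ifs <;> omega

/-- Without slots the strand is one of the ideal itself. With a slot, the complement in the cone of
sets containing `negSupp a` is governed by `vanishes_two` or `vanishes_three`; the shift of the
bound to R - 1 cancels the shift of the degree to i - 1. -/
theorem vanishes_locSupport_pow {s : ℕ} (hs : s = 2 ∨ s = 3)
    (h : ∀ (H : Finset (Fin n)) (i : ℤ), R ≤ i - H.card →
      Vanishes K {F | H ⊆ F ∧ HasEdge G F} i)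
    (a : Fin n → ℤ) {i : ℤ} (hi : R + (2 * s - 2) ≤ i + ∑ v, a v) :
    Vanishes K (locSupport (powerExp G s) a) i := by
  have hs0 : 0 < s := by omega
  by_cases hE : ∀ p q, ¬ G.Adj p q
  · exact vanishes_locSupport_empty hs0 hE a i
  push Not at hE
  obtain ⟨p, q, hpq⟩ := hE
  have hsum := sum_le_card_slots a
  rcases isEmpty_or_nonempty (Slots a) with he | ⟨⟨v, k⟩⟩
  · rw [locSupport_of_isEmpty hs0 a he]
    rw [Fintype.card_eq_zero] at hsum
    exact h _ _ (by push_cast at hsum; omega)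
  have hb := bounded_indepAway hpq h
  have hβ : ∀ i : Slots a, i.1 ∉ negSupp a := by
    rintro ⟨v, k⟩ hv
    have := k.2
    simp only [negSupp, Finset.mem_filter] at hv
    omega
  have hΓ : Vanishes K (fam G (Sigma.fst : Slots a → Fin n) (negSupp a)
      fun m => ¬ Reach (G.comap Sigma.fst) m s) (i - 1) := by
    rcases hs with rfl | rfl
    · simp only [reach_two_iff]
      refine vanishes_two hβ hb ?_
      change _ - (Fintype.card (Slots a) : ℤ) ≤ _
      push_cast at hi
      omega
    · simp only [reach_three_iff]
      refine vanishes_three hβ hb ?_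
      change _ - (Fintype.card (Slots a) : ℤ) ≤ _
      push_cast at hi
      omega
  have hJ := isMonomialIdeal_edgeIdeal_pow (K := K) G s
  refine IsSplit.vanishes_right (Q := {F | negSupp a ⊆ F})
    ⟨ordConnected_supersets _, ?_, ?_, ?_⟩ (vanishes_supersets (hβ ⟨v, k⟩) i) hΓ
  · ext F
    simp only [fam, Set.mem_union, mem_locSupport_iff_reach, Set.mem_ofPred_eq]
    tauto
  · rw [Set.disjoint_left]
    intro F h1 h2
    rw [mem_locSupport_iff_reach] at h2
    exact h2.2.elim h1.1 h1.2.2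
  · exact fun F h1 F' _ h3 => locSupport_upper hJ a F F' h3 h1

theorem localCohDegree_pow_eq_zero {s : ℕ} (hs : s = 2 ∨ s = 3)
    (h : ∀ (i : ℕ) (j : ℤ), R ≤ i + j →
      ∀ z ∈ localCohDegree n K (idealGrading (edgeIdeal K G)) i j, z = 0)
    {i : ℕ} {j : ℤ} (hij : R + (2 * s - 2) ≤ i + j) :
    ∀ z ∈ localCohDegree n K (idealGrading (edgeIdeal K G ^ s)) i j, z = 0 :=
  localCohDegree_eq_zero (isMonomialIdeal_edgeIdeal_pow G s) fun a ha =>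
    vanishes_locSupport_pow hs (fun H _ hi => vanishes_hasEdge h H hi) a (by rw [ha]; exact hij)

end Powers

end EdgeIdealReg

end

theorem theorem5p1 {K : Type*} [Field K] {n : ℕ} (G : SimpleGraph (Fin n)) (s : ℕ)
    (hs : s = 2 ∨ s = 3) :
    EdgeIdealReg.reg (EdgeIdealReg.edgeIdeal K G ^ s) ≤
      EdgeIdealReg.reg (EdgeIdealReg.edgeIdeal K G) + ((2 * (s : ℝ) - 2 : ℝ) : EReal) := by
  refine iSup_le fun i => iSup_le fun j => iSup_le fun ⟨z, hz, hz0⟩ => ?_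
  -- The threshold R is fitted to the given nonzero class, so nothing about the supremum being
  -- finite or attained is needed.
  have h : ∃ (i' : ℕ) (j' : ℤ), (i + j - (2 * s - 2) : ℤ) ≤ i' + j' ∧
      ∃ z ∈ EdgeIdealReg.localCohDegree n K
        (EdgeIdealReg.idealGrading (EdgeIdealReg.edgeIdeal K G)) i' j', z ≠ 0 := by
    by_contra! h
    exact hz0 (EdgeIdealReg.localCohDegree_pow_eq_zero hs h (by omega) z hz)
  obtain ⟨i', j', hle, hne⟩ := h
  have h1 : (((i' + j' : ℤ) : ℝ) : EReal) ≤ EdgeIdealReg.reg (EdgeIdealReg.edgeIdeal K G) :=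
    le_iSup_of_le i' (le_iSup_of_le j' (le_iSup_of_le hne le_rfl))
  refine le_trans ?_ (add_le_add_left h1 _)
  rw [← EReal.coe_add, EReal.coe_le_coe_iff]
  have h2 : ((i + j - (2 * s - 2) : ℤ) : ℝ) ≤ ((i' + j' : ℤ) : ℝ) := Int.cast_le.2 hle
  push_cast at h2 ⊢
  linarith
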